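/- Let $\Sigma$ be an alphabet given effectively (for instance any finite alphabet, or a countably infinite alphabet whose letters are coded in a primitive recursive way by natural numbers). For words $u \neq v$ in $\Sigma^*$ let $d(u,v) = 2^{-|M|}$, where $M$ is a smallest finite monoid such that $\varphi(u) \neq \varphi(v)$ for some homomorphism $\varphi : \Sigma^* \to M$, and let $d(u,u) = 0$. The free profinite monoid $\widehat{\Sigma^*}$ is the completion of $\Sigma^*$ with respect to the metric $d$, with the continuous extension of concatenation as multiplication; its elements are called pseudowords. For a pseudoword $\alpha$ let $\alpha^{\omega-1} = \lim_{k\to\infty} \alpha^{k!-1}$. An $(\omega-1)$-term is an expression built from the letters of $\Sigma$ by concatenation and the operation $(\cdot)^{\omega-1}$; it denotes a pseudoword. Let $\mathbf{DAb}$ be the class of all finite monoids in which every $\mathcal{D}$-class that contains an idempotent forms an Abelian group under the multiplication of the monoid. For pseudowords $\alpha, \beta$ write $\mathbf{DAb} \models \alpha = \beta$ if $\varphi(\alpha) = \varphi(\beta)$ for every $M \in \mathbf{DAb}$ and every continuous homomorphism $\varphi : \widehat{\Sigma^*} \to M$, where $M$ carries the discrete topology. Then the word problem for $(\omega-1)$-terms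 over $\mathbf{DAb}$ is decidable: there is an algorithm that, given two $(\omega-1)$-terms $\alpha$ and $\beta$ over $\Sigma$ (as finite expressions), decides whether $\mathbf{DAb} \models \alpha = \beta$ holds. -/

import Mathlib

open Filter Topology

universe u

/-! ### The profinite metric on finite words -/

namespace ProfiniteWord

variable {A : Type u}

/-- The cardinalities of the finite monoids in which the words `x` and `y` can be mapped to
different elements by a homomorphism. (Every finite monoid has a copy in `Type`.) -/
def sepCards (x y : FreeMonoid A) : Set ℕ :=
  {n | ∃ (M : Type) (_ : Monoid M) (_ : Finite M) (φ : FreeMonoid A →* M),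
    Nat.card M = n ∧ φ x ≠ φ y}

open Classical in
/-- The profinite metric: `0` if `x = y`, and otherwise `2 ^ (-n)` where `n` is the cardinality of a
smallest monoid separating `x` and `y`. -/
noncomputable def wordDist (x y : FreeMonoid A) : ℝ :=
  if x = y then 0 else (1 / 2 : ℝ) ^ sInf (sepCards x y)

open Classical in
/-- One step of an automaton that accepts exactly the word `l`. -/
noncomputable def stepFun (l : List A) (a : A) : Function.End (Fin (l.length + 2)) :=
  fun i => if h : l[(i : ℕ)]? = some a then
      ⟨i + 1, by have := (List.getElem?_eq_some_iff.1 h).1; omega⟩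
    else ⟨l.length + 1, by omega⟩

theorem run_eq_iff (l w : List A) (i : Fin (l.length + 2)) :
    ((w.foldl (fun i a => stepFun l a i) i : Fin (l.length + 2)) : ℕ) = l.length ↔
      (i : ℕ) ≤ l.length ∧ w = l.drop i := by
  induction w generalizing i with
  | nil =>
    have := i.2
    simp only [List.foldl_nil]
    constructor
    · intro h
      exact ⟨h.le, by simp [h]⟩
    · rintro ⟨h, h'⟩
      have h2 := congrArg List.length h'
      simp at h2
      omega
  | cons a w ih =>
    simp only [List.foldl_cons]
    rw [ih]
    by_cases h : l[(i : ℕ)]? = some a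
    · obtain ⟨h1, h2⟩ := List.getElem?_eq_some_iff.1 h
      have hs : stepFun l a i = ⟨i + 1, by omega⟩ := by simp [stepFun, h]
      rw [hs, List.drop_eq_getElem_cons h1, h2]
      simp only [List.cons.injEq, true_and]
      constructor
      · rintro ⟨_, h4⟩; exact ⟨h1.le, h4⟩
      · rintro ⟨_, h4⟩; exact ⟨h1, h4⟩
    · have hs : stepFun l a i = ⟨l.length + 1, by omega⟩ := by simp [stepFun, h]
      rw [hs]
      constructor
      · rintro ⟨h3, _⟩; simp at h3
      · rintro ⟨_, h4⟩
        exfalso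
        apply h
        have h5 := congrArg (fun t => t[0]?) h4
        simpa using h5.symm

/-- Distinct words are separated by some finite monoid. -/
theorem sepCards_nonempty {x y : FreeMonoid A} (h : x ≠ y) : (sepCards x y).Nonempty := by
  let l : List A := FreeMonoid.toList x
  let φ : FreeMonoid A →* (Function.End (Fin (l.length + 2)))ᵐᵒᵖ :=
    FreeMonoid.lift fun a => MulOpposite.op (stepFun l a)
  have hφ : ∀ w : FreeMonoid A, ∀ i, (φ w).unop i =
      (FreeMonoid.toList w).foldl (fun i a => stepFun l a i) i := by
    intro w
    induction w using FreeMonoid.inductionOn' with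
    | one => intro i; simp [φ]; rfl
    | of_mul a w ih =>
      intro i
      rw [map_mul, MulOpposite.unop_mul, FreeMonoid.toList_of_mul, List.foldl_cons, ← ih]
      simp [φ, Function.End.mul_def]
      rfl
  have : Finite (Function.End (Fin (l.length + 2)))ᵐᵒᵖ :=
    Finite.of_injective (β := Fin (l.length + 2) → Fin (l.length + 2)) (fun f => f.unop)
      MulOpposite.unop_injective
  refine ⟨_, (Function.End (Fin (l.length + 2)))ᵐᵒᵖ, inferInstance, this, φ, rfl, ?_⟩
  intro he
  have h1 := congrArg
    (fun f : (Function.End (Fin (l.length + 2)))ᵐᵒᵖ => f.unop ⟨0, by omega⟩) he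
  simp only [hφ] at h1
  have h2 := (run_eq_iff l l ⟨0, by omega⟩).2 (by simp)
  have h3 := (run_eq_iff l (FreeMonoid.toList y) ⟨0, by omega⟩).1 (by rw [← h1]; exact h2)
  apply h
  apply FreeMonoid.toList.injective
  simpa [l] using h3.2.symm

theorem wordDist_self (x : FreeMonoid A) : wordDist x x = 0 := by simp [wordDist]

theorem wordDist_comm (x y : FreeMonoid A) : wordDist x y = wordDist y x := by
  have h : sepCards x y = sepCards y x := by
    ext n
    simp only [sepCards, ne_comm]
  by_cases hxy : x = y
  · rw [hxy]
  · rw [wordDist, wordDist, if_neg hxy, if_neg (Ne.symm hxy), h]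

theorem wordDist_nonneg (x y : FreeMonoid A) : 0 ≤ wordDist x y := by
  unfold wordDist; split_ifs <;> positivity

/-- Two words are at distance at most `2 ^ (-(n + 1))` if and only if no monoid with at most `n`
elements separates them. -/
theorem wordDist_le_iff (x y : FreeMonoid A) (n : ℕ) :
    wordDist x y ≤ (1 / 2 : ℝ) ^ (n + 1) ↔
      ∀ (M : Type) [Monoid M] [Finite M] (φ : FreeMonoid A →* M), Nat.card M ≤ n → φ x = φ y := by
  by_cases h : x = y
  · subst h; simp [wordDist_self]
  rw [wordDist, if_neg h, pow_le_pow_iff_right_of_lt_one₀ (by norm_num) (by norm_num)]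
  constructor
  · intro hle M _ _ φ hM
    by_contra hne
    have : sInf (sepCards x y) ≤ Nat.card M := Nat.sInf_le ⟨M, _, ‹_›, φ, rfl, hne⟩
    omega
  · intro H
    obtain ⟨M, i1, i2, φ, hc, hne⟩ := Nat.sInf_mem (sepCards_nonempty h)
    by_contra hlt
    exact hne (H M φ (by omega))

theorem wordDist_triangle_max (x y z : FreeMonoid A) :
    wordDist x z ≤ max (wordDist x y) (wordDist y z) := by
  by_cases h : x = z
  · subst h; rw [wordDist_self]; exact le_max_of_le_left (wordDist_nonneg _ _)
  obtain ⟨M, i1, i2, φ, hc, hne⟩ := Nat.sInf_mem (sepCards_nonempty h)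
  have key : ∀ s t : FreeMonoid A, φ s ≠ φ t → wordDist x z ≤ wordDist s t := by
    intro s t hst
    have hne' : s ≠ t := fun e => hst (by rw [e])
    rw [wordDist, wordDist, if_neg h, if_neg hne',
      pow_le_pow_iff_right_of_lt_one₀ (by norm_num) (by norm_num), ← hc]
    exact Nat.sInf_le ⟨M, _, ‹_›, φ, rfl, hst⟩
  by_cases h1 : φ x = φ y
  · exact le_max_of_le_right (key _ _ (by rw [← h1]; exact hne))
  · exact le_max_of_le_left (key _ _ h1)

noncomputable instance instMetricSpace : MetricSpace (FreeMonoid A) where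
  dist := wordDist
  dist_self := wordDist_self
  dist_comm := wordDist_comm
  dist_triangle x y z := (wordDist_triangle_max x y z).trans
    (max_le_add_of_nonneg (wordDist_nonneg _ _) (wordDist_nonneg _ _))
  eq_of_dist_eq_zero {x y} h := by
    by_contra hne
    change wordDist x y = 0 at h
    rw [wordDist, if_neg hne] at h
    exact absurd h (by positivity)

theorem dist_le_iff (x y : FreeMonoid A) (n : ℕ) :
    dist x y ≤ (1 / 2 : ℝ) ^ (n + 1) ↔
      ∀ (M : Type) [Monoid M] [Finite M] (φ : FreeMonoid A →* M), Nat.card M ≤ n → φ x = φ y :=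
  wordDist_le_iff x y n

theorem wordDist_mul_le (x x' y y' : FreeMonoid A) :
    wordDist (x * y) (x' * y') ≤ max (wordDist x x') (wordDist y y') := by
  by_cases h : x * y = x' * y'
  · rw [h, wordDist_self]; exact le_max_of_le_left (wordDist_nonneg _ _)
  obtain ⟨M, i1, i2, φ, hc, hne⟩ := Nat.sInf_mem (sepCards_nonempty h)
  have key : ∀ s t : FreeMonoid A, φ s ≠ φ t → wordDist (x * y) (x' * y') ≤ wordDist s t := by
    intro s t hst
    have hne' : s ≠ t := fun e => hst (by rw [e])
    rw [wordDist, wordDist, if_neg h, if_neg hne',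
      pow_le_pow_iff_right_of_lt_one₀ (by norm_num) (by norm_num), ← hc]
    exact Nat.sInf_le ⟨M, _, ‹_›, φ, rfl, hst⟩
  by_cases h1 : φ x = φ x'
  · refine le_max_of_le_right (key _ _ fun h2 => hne ?_)
    rw [map_mul, map_mul, h1, h2]
  · exact le_max_of_le_left (key _ _ h1)

theorem uniformContinuous₂_mul :
    UniformContinuous₂ (fun x y : FreeMonoid A => x * y) := by
  refine Metric.uniformContinuous_iff.2 fun ε hε => ⟨ε, hε, ?_⟩
  rintro ⟨x, y⟩ ⟨x', y'⟩ h
  rw [Prod.dist_eq] at h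
  exact (wordDist_mul_le x x' y y').trans_lt h

end ProfiniteWord

/-! ### The free profinite monoid -/

/-- The free profinite monoid over `A`, whose elements are the pseudowords: the completion of the
monoid of finite words with respect to the profinite metric. -/
abbrev FreeProfiniteMonoid (A : Type u) : Type u := UniformSpace.Completion (FreeMonoid A)

namespace FreeProfiniteMonoid

open UniformSpace

variable {A : Type u}

noncomputable instance instMul : Mul (FreeProfiniteMonoid A) :=
  ⟨Completion.map₂ (fun x y : FreeMonoid A => x * y)⟩

noncomputable instance instOne : One (FreeProfiniteMonoid A) := ⟨((1 : FreeMonoid A) : Completion _)⟩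

theorem coe_mul (x y : FreeMonoid A) :
    ((x * y : FreeMonoid A) : FreeProfiniteMonoid A) = (x : FreeProfiniteMonoid A) * y :=
  (Completion.map₂_coe_coe x y _ ProfiniteWord.uniformContinuous₂_mul).symm

theorem coe_one : ((1 : FreeMonoid A) : FreeProfiniteMonoid A) = 1 := rfl

instance instContinuousMul : ContinuousMul (FreeProfiniteMonoid A) :=
  ⟨Completion.continuous_map₂ continuous_fst continuous_snd⟩

/-- Multiplication of pseudowords is the continuous extension of concatenation of words. -/
noncomputable instance instMonoid : Monoid (FreeProfiniteMonoid A) where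
  mul_assoc a b c := by
    refine Completion.induction_on₃ a b c (isClosed_eq (by fun_prop) (by fun_prop)) ?_
    intro x y z
    simp only [← coe_mul, mul_assoc]
  one_mul a := by
    refine Completion.induction_on a (isClosed_eq (by fun_prop) (by fun_prop)) ?_
    intro x
    rw [← coe_one, ← coe_mul, one_mul]
  mul_one a := by
    refine Completion.induction_on a (isClosed_eq (by fun_prop) (by fun_prop)) ?_
    intro x
    rw [← coe_one, ← coe_mul, mul_one]

theorem coe_pow (x : FreeMonoid A) (n : ℕ) :
    ((x ^ n : FreeMonoid A) : FreeProfiniteMonoid A) = (x : FreeProfiniteMonoid A) ^ n := by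
  induction n with
  | zero => rfl
  | succ n ih => rw [pow_succ, pow_succ, coe_mul, ih]

/-- In a monoid with at most `n` elements, the powers `s ^ (k! - 1)` do not depend on `k ≥ n + 2`. -/
theorem pow_factorial_sub_one_eq {M : Type*} [Monoid M] [Finite M] {n k l : ℕ}
    (hM : Nat.card M ≤ n) (hk : n + 2 ≤ k) (hl : n + 2 ≤ l) (s : M) :
    s ^ (k.factorial - 1) = s ^ (l.factorial - 1) := by
  have : Fintype M := Fintype.ofFinite M
  obtain ⟨i, j, hij, he⟩ := Fintype.exists_ne_map_eq_of_card_lt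
    (fun i : Fin (n + 1) => s ^ (i : ℕ)) (by
      rw [Fintype.card_fin, ← Nat.card_eq_fintype_card]; omega)
  have hij' : (i : ℕ) ≠ j := fun e => hij (Fin.ext e)
  obtain ⟨a, p, hp, hap, hs⟩ : ∃ a p : ℕ, 0 < p ∧ a + p ≤ n ∧ s ^ (a + p) = s ^ a := by
    have h1 := i.2
    have h2 := j.2
    rcases lt_or_gt_of_ne hij' with h | h
    · exact ⟨i, j - i, by omega, by omega, by
        rw [Nat.add_sub_cancel' h.le]; exact he.symm⟩
    · exact ⟨j, i - j, by omega, by omega, by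
        rw [Nat.add_sub_cancel' h.le]; exact he⟩
  have hper : ∀ t c : ℕ, a ≤ c → s ^ (c + p * t) = s ^ c := by
    intro t
    induction t with
    | zero => intro c _; simp
    | succ t ih =>
      intro c hc
      obtain ⟨d, rfl⟩ := Nat.exists_eq_add_of_le hc
      have h3 : a + d + p * (t + 1) = (a + p + d) + p * t := by ring
      rw [h3, ih _ (by omega), pow_add, hs, ← pow_add]
  have hred : ∀ k l : ℕ, n + 2 ≤ l → l ≤ k →
      s ^ (k.factorial - 1) = s ^ (l.factorial - 1) := by
    intro k l hl hlk
    have h1 : p ∣ l.factorial := Nat.dvd_factorial hp (by omega)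
    have h2 : p ∣ k.factorial := Nat.dvd_factorial hp (by omega)
    have h3 : l.factorial ≤ k.factorial := Nat.factorial_le hlk
    obtain ⟨t, ht⟩ := Nat.dvd_sub h2 h1
    have h4 : l ≤ l.factorial := Nat.self_le_factorial l
    have h5 : k.factorial - 1 = (l.factorial - 1) + p * t := by omega
    rw [h5, hper _ _ (by omega)]
  rcases le_total k l with h | h
  · exact (hred l k hk h).symm
  · exact hred k l hl h

theorem dist_pow_le (α : FreeProfiniteMonoid A) {n k l : ℕ} (hk : n + 2 ≤ k) (hl : n + 2 ≤ l) :
    dist (α ^ (k.factorial - 1)) (α ^ (l.factorial - 1)) ≤ (1 / 2 : ℝ) ^ (n + 1) := by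
  refine Completion.induction_on α (isClosed_le (by fun_prop) (by fun_prop)) ?_
  intro x
  rw [← coe_pow, ← coe_pow, Completion.dist_eq, ProfiniteWord.dist_le_iff]
  intro M _ _ φ hM
  rw [map_pow, map_pow]
  exact pow_factorial_sub_one_eq hM hk hl (φ x)

/-- The `(ω - 1)`-power of a pseudoword `α`: the limit of `α ^ (k! - 1)` for `k → ∞`. -/
noncomputable def omegaSubOnePow (α : FreeProfiniteMonoid A) : FreeProfiniteMonoid A :=
  haveI : Nonempty (FreeProfiniteMonoid A) := ⟨1⟩
  limUnder atTop fun k : ℕ => α ^ (k.factorial - 1)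

/-- The limit defining the `(ω - 1)`-power exists. -/
theorem tendsto_omegaSubOnePow (α : FreeProfiniteMonoid A) :
    Tendsto (fun k : ℕ => α ^ (k.factorial - 1)) atTop (𝓝 (omegaSubOnePow α)) := by
  have : Nonempty (FreeProfiniteMonoid A) := ⟨1⟩
  refine CauchySeq.tendsto_limUnder (Metric.cauchySeq_iff.2 fun ε hε => ?_)
  obtain ⟨n, hn⟩ := exists_pow_lt_of_lt_one hε (by norm_num : (1 / 2 : ℝ) < 1)
  refine ⟨n + 2, fun k hk l hl => (dist_pow_le α hk hl).trans_lt (lt_of_le_of_lt ?_ hn)⟩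
  exact pow_le_pow_of_le_one (by norm_num) (by norm_num) (Nat.le_succ n)

end FreeProfiniteMonoid

/-! ### Green's relations and the variety of finite monoids whose regular `𝒟`-classes form Abelian
groups -/

namespace Green

variable {M : Type*} [Monoid M]

/-- Green's relation `ℒ`. -/
def L (s t : M) : Prop := ∃ x x' : M, x * s = t ∧ s = x' * t

/-- Green's relation `ℛ`. -/
def R (s t : M) : Prop := ∃ y y' : M, s * y = t ∧ s = t * y'

/-- Green's relation `𝒟`: two elements are related if they are connected by a finite chain of
`ℒ`- and `ℛ`-steps. -/
def D : M → M → Prop := Relation.ReflTransGen fun s t => L s t ∨ R s t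

/-- The `𝒟`-class of `s`. -/
def DClass (s : M) : Set M := {t | D s t}

/-- A `𝒟`-class is regular if it contains an idempotent. -/
def IsRegularDClass (C : Set M) : Prop := (∃ s : M, C = DClass s) ∧ ∃ e ∈ C, e * e = e

end Green

/-- A subset of a monoid forms an Abelian group under the multiplication of the monoid (the neutral
element of this group need not be the neutral element of the monoid). -/
def FormsAbelianGroup {M : Type*} [Monoid M] (C : Set M) : Prop :=
  (∀ a ∈ C, ∀ b ∈ C, a * b ∈ C) ∧
  (∀ a ∈ C, ∀ b ∈ C, a * b = b * a) ∧
  ∃ e ∈ C, (∀ a ∈ C, e * a = a) ∧ ∀ a ∈ C, ∃ b ∈ C, a * b = e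

/-- The variety **DAb** of all finite monoids whose regular `𝒟`-classes form Abelian groups. -/
def IsDAb (M : Type*) [Monoid M] : Prop :=
  Finite M ∧ ∀ C : Set M, Green.IsRegularDClass C → FormsAbelianGroup C

/-! ### Equations of pseudowords -/

/-- The monoid `M` satisfies the equation `α = β` of pseudowords if `α` and `β` have the same image
under every continuous homomorphism into `M`, where `M` carries the discrete topology. -/
def SatisfiesEq {A : Type u} (M : Type*) [Monoid M] (α β : FreeProfiniteMonoid A) : Prop :=
  letI : TopologicalSpace M := ⊥
  ∀ φ : FreeProfiniteMonoid A →* M, Continuous φ → φ α = φ β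

/-- `DAb ⊨ α = β`. (Every finite monoid has a copy in `Type`.) -/
def DAbSatisfiesEq {A : Type u} (α β : FreeProfiniteMonoid A) : Prop :=
  ∀ (M : Type) [Monoid M], IsDAb M → SatisfiesEq M α β

/-! ### `(ω - 1)`-terms -/

/-- `(ω - 1)`-terms as finite objects: trees built from letters by concatenation and
`(ω - 1)`-power. -/
inductive OmegaTerm (A : Type u) : Type u
  | letter (a : A) : OmegaTerm A
  | concat (s t : OmegaTerm A) : OmegaTerm A
  | power (t : OmegaTerm A) : OmegaTerm A

namespace OmegaTerm

variable {A : Type u}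

/-- The pseudoword denoted by an `(ω - 1)`-term. -/
noncomputable def toPseudoword : OmegaTerm A → FreeProfiniteMonoid A
  | letter a => ((FreeMonoid.of a : FreeMonoid A) : UniformSpace.Completion (FreeMonoid A))
  | concat s t => s.toPseudoword * t.toPseudoword
  | power t => t.toPseudoword.omegaSubOnePow

/-! As inputs of algorithms, terms are written in postfix notation as finite words of symbols:
`inl a` is the letter `a`, `inr false` is the concatenation, `inr true` is the `(ω - 1)`-power. -/

/-- The postfix notation of a term. -/
def postfixWord : OmegaTerm A → List (A ⊕ Bool)
  | letter a => [Sum.inl a]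
  | concat s t => s.postfixWord ++ (t.postfixWord ++ [Sum.inr false])
  | power t => t.postfixWord ++ [Sum.inr true]

/-- Process one symbol of a postfix word, with a stack of terms; `none` signals a failure. -/
def parseStep (st : Option (List (OmegaTerm A))) (c : A ⊕ Bool) : Option (List (OmegaTerm A)) :=
  match st, c with
  | some l, Sum.inl a => some (letter a :: l)
  | some (t :: s :: l), Sum.inr false => some (concat s t :: l)
  | some (t :: l), Sum.inr true => some (power t :: l)
  | _, _ => none

/-- The effect of `parseStep` on the height of the stack. -/
def depthStep (d : Option ℕ) (c : A ⊕ Bool) : Option ℕ :=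
  d.bind fun n => Sum.casesOn c (fun _ => some (n + 1))
    fun b => cond b (if 1 ≤ n then some n else none) (if 2 ≤ n then some (n - 1) else none)

/-- A word of symbols is well-formed if reading it leaves a stack of height one. -/
def WellFormed (w : List (A ⊕ Bool)) : Prop := w.foldl depthStep (some 0) = some 1

instance : DecidablePred (WellFormed (A := A)) := fun _ => inferInstanceAs (Decidable (_ = _))

theorem length_parseStep (st : Option (List (OmegaTerm A))) (c : A ⊕ Bool) :
    (parseStep st c).map List.length = depthStep (st.map List.length) c := by
  rcases st with _ | _ | ⟨t, _ | ⟨s, l⟩⟩ <;> rcases c with a | _ | _ <;>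
    simp [parseStep, depthStep]

theorem length_parse (w : List (A ⊕ Bool)) (st : Option (List (OmegaTerm A))) :
    (w.foldl parseStep st).map List.length = w.foldl depthStep (st.map List.length) := by
  induction w generalizing st with
  | nil => rfl
  | cons c w ih => rw [List.foldl_cons, List.foldl_cons, ih, length_parseStep]

theorem parse_postfixWord (t : OmegaTerm A) (l : List (OmegaTerm A)) :
    t.postfixWord.foldl parseStep (some l) = some (t :: l) := by
  induction t generalizing l with
  | letter a => rfl
  | concat s t ihs iht => simp [postfixWord, List.foldl_append, ihs, iht, parseStep]
  | power t ih => simp [postfixWord, List.foldl_append, ih, parseStep]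

theorem parse_sound (w : List (A ⊕ Bool)) (l : List (OmegaTerm A))
    (h : w.foldl parseStep (some []) = some l) :
    w = (l.reverse.map postfixWord).flatten := by
  induction w using List.reverseRecOn generalizing l with
  | nil => simp at h; subst h; rfl
  | append_singleton w c ih =>
    rw [List.foldl_append, List.foldl_cons, List.foldl_nil] at h
    rcases hw : w.foldl parseStep (some []) with _ | m
    · rw [hw] at h; simp [parseStep] at h
    · rw [hw] at h
      rw [ih m hw]
      rcases m with _ | ⟨t, _ | ⟨s, l'⟩⟩ <;> rcases c with a | _ | _ <;>
        simp [parseStep] at h <;> subst h <;> simp [postfixWord]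

theorem wellFormed_postfixWord (t : OmegaTerm A) : WellFormed t.postfixWord := by
  have := length_parse t.postfixWord (some [])
  rw [parse_postfixWord] at this
  exact this.symm

theorem postfixWord_injective : Function.Injective (postfixWord (A := A)) := by
  intro s t h
  have h1 := parse_postfixWord s []
  rw [h, parse_postfixWord t []] at h1
  simpa using h1.symm

theorem exists_of_wellFormed {w : List (A ⊕ Bool)} (h : WellFormed w) :
    ∃ t : OmegaTerm A, t.postfixWord = w := by
  have h1 := length_parse w (some [])
  rw [show Option.map List.length (some ([] : List (OmegaTerm A))) = some 0 from rfl,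
    show w.foldl depthStep (some 0) = some 1 from h] at h1
  obtain ⟨l, hl, hlen⟩ := Option.map_eq_some_iff.1 h1
  obtain ⟨t, rfl⟩ := List.length_eq_one_iff.1 hlen
  exact ⟨t, by simpa using (parse_sound w [t] hl).symm⟩

/-- Terms correspond bijectively to the well-formed words of symbols. -/
noncomputable def equivWellFormed : OmegaTerm A ≃ {w : List (A ⊕ Bool) // WellFormed w} :=
  Equiv.ofBijective (fun t => ⟨t.postfixWord, t.wellFormed_postfixWord⟩)
    ⟨fun _ _ h => postfixWord_injective (congrArg Subtype.val h),
      fun w => (exists_of_wellFormed w.2).imp fun _ h => Subtype.ext h⟩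

theorem primrecPred_wellFormed [Primcodable A] : PrimrecPred (WellFormed (A := A)) := by
  have hstep : Primrec₂ (depthStep (A := A)) := by
    have hn : Primrec fun p : ((Option ℕ × (A ⊕ Bool)) × ℕ) × Bool => p.1.2 :=
      Primrec.snd.comp Primrec.fst
    refine Primrec.option_bind Primrec.fst ?_
    refine Primrec.sumCasesOn (Primrec.snd.comp Primrec.fst) ?_ ?_
    · exact Primrec.option_some.comp (Primrec.succ.comp (Primrec.snd.comp Primrec.fst))
    · refine Primrec.cond Primrec.snd ?_ ?_
      · exact Primrec.ite (Primrec.nat_le.comp (Primrec.const 1) hn)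
          (Primrec.option_some.comp hn) (Primrec.const none)
      · exact Primrec.ite (Primrec.nat_le.comp (Primrec.const 2) hn)
          (Primrec.option_some.comp (Primrec.nat_sub.comp hn (Primrec.const 1)))
          (Primrec.const none)
  have hfold : Primrec fun w : List (A ⊕ Bool) => w.foldl depthStep (some 0) :=
    Primrec.list_foldl Primrec.id (Primrec.const (some 0))
      (hstep.comp (Primrec.fst.comp Primrec.snd) (Primrec.snd.comp Primrec.snd)).to₂
  exact PrimrecRel.comp Primrec.eq hfold (Primrec.const (some 1))

/-- Terms over an effectively given alphabet are coded by their postfix notation. -/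
noncomputable instance instPrimcodable [Primcodable A] : Primcodable (OmegaTerm A) :=
  letI : Primcodable {w : List (A ⊕ Bool) // WellFormed w} :=
    Primcodable.subtype primrecPred_wellFormed
  Primcodable.ofEquiv _ equivWellFormed

end OmegaTerm

/-! In a monoid of **DAb** the idempotent power of a word depends only on the content of the word
(`wordVal_pow_congr`), and every letter of this content commutes with the idempotent `e` and acts on
the Abelian group of `e` by a translation (`acts_of_factor`). Hence an `(ω - 1)`-power takes its
value in such a group and is determined by a content together with signed numbers of occurrences of
letters. A term thus becomes a list of letters and blocks, where a block is a nonempty content with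
a signed multiset of letters. A block absorbs every neighbour whose letters it contains
(`val_merge`), and exhaustive absorption gives a reduced list with the same value.

Reduced lists are not yet unique: a letter lying in the contents of two neighbouring blocks can be
moved from one block to the other. `Matches` factors out exactly this freedom. The letters and
contents must agree in order, the signed counts must agree in total, and at each cut they must agree
for the letters that cannot be moved across. Matching lists have equal values, as the difference of
the first items can be pushed into the second ones (`wordVal_eq_of_matches`).

The converse needs enough monoids in **DAb**. The congruence `ruleCon m n` identifies, next to `m`
factors of a common content, words of this content whose letter counts agree modulo `n`. Over
finitely many letters the quotient is finite (`finite_boundedWords`) and lies in **DAb**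
(`isDAb_boundedWords`). If `m` is large compared with the number of items, the rules cannot destroy
the shape of a word obtained from a reduced list: it splits into letters, cores of blocks, and
segments of movable letters between the cores of neighbouring blocks, and the rules preserve such a
splitting as well as the counts modulo `n` at the relevant cuts (`exists_of_rightRule`,
`exists_of_leftRule`). If two reduced lists have equal values, their skeletons therefore embed into
each other and coincide (`Emb.antisymm`), and uniqueness of the splitting (`valid_unique`) makes the
counts at the cuts comparable. Letting `n` vary gives equality of the counts
(`matches_of_wordVal_eq`).

Reduction and matching are primitive recursive in the postfix notation, so the decision procedure is
even primitive recursive. -/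

/-! ### Idempotents of monoids whose regular `𝒟`-classes form Abelian groups -/

namespace DAbMonoid

variable {M : Type*} [Monoid M] {e : M}

theorem formsAbelianGroup_dClass (hM : IsDAb M) (he : e * e = e) :
    FormsAbelianGroup (Green.DClass e) :=
  hM.2 _ ⟨⟨e, rfl⟩, e, Relation.ReflTransGen.refl, he⟩

/-- A group has only one idempotent, so the neutral element `f` supplied by the definition must be
`e` itself. -/
theorem mul_eq_of_D (hM : IsDAb M) (he : e * e = e) {a : M} (ha : Green.D e a) : e * a = a := by
  obtain ⟨hmul, hcomm, f, hf, hone, hinv⟩ := formsAbelianGroup_dClass hM he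
  have hee : e ∈ Green.DClass e := Relation.ReflTransGen.refl
  obtain ⟨b, hb, hab⟩ := hinv e hee
  have : f = e := by
    calc f = e * b := hab.symm
      _ = e * (e * b) := by rw [← mul_assoc, he]
      _ = f * e := by rw [hab, hcomm _ hee _ hf]
      _ = e := hone e hee
  rw [← this]
  exact hone a ha

/-- The `𝒟`-class of an idempotent of a monoid in **DAb**, as a type. -/
@[ext]
structure DGroup (hM : IsDAb M) (he : e * e = e) where
  /-- The underlying element of the monoid. -/
  val : M
  property : Green.D e val

namespace DGroup

variable {hM : IsDAb M} {he : e * e = e}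

noncomputable instance : CommGroup (DGroup hM he) where
  mul x y := ⟨x.1 * y.1, (formsAbelianGroup_dClass hM he).1 _ x.2 _ y.2⟩
  mul_assoc x y z := DGroup.ext (mul_assoc _ _ _)
  one := ⟨e, Relation.ReflTransGen.refl⟩
  one_mul x := DGroup.ext (mul_eq_of_D hM he x.2)
  mul_one x := DGroup.ext (((formsAbelianGroup_dClass hM he).2.1 _ x.2 _
    Relation.ReflTransGen.refl).trans (mul_eq_of_D hM he x.2))
  inv x := ⟨((formsAbelianGroup_dClass hM he).2.2.choose_spec.2.2 _ x.2).choose,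
    ((formsAbelianGroup_dClass hM he).2.2.choose_spec.2.2 _ x.2).choose_spec.1⟩
  inv_mul_cancel x := by
    refine DGroup.ext ?_
    have h := formsAbelianGroup_dClass hM he
    have h1 := (h.2.2.choose_spec.2.2 _ x.2).choose_spec
    refine (h.2.1 _ h1.1 _ x.2).trans (h1.2.trans ?_)
    have hf := h.2.2.choose_spec
    have hee : e ∈ Green.DClass e := Relation.ReflTransGen.refl
    exact (mul_eq_of_D hM he hf.1).symm.trans ((h.2.1 _ hee _ hf.1).trans (hf.2.1 e hee))
  mul_comm x y := DGroup.ext ((formsAbelianGroup_dClass hM he).2.1 _ x.2 _ y.2)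

theorem val_mul (x y : DGroup hM he) : (x * y).val = x.val * y.val := rfl

theorem val_one : (1 : DGroup hM he).val = e := rfl

theorem val_injective : Function.Injective (val : DGroup hM he → M) := fun _ _ => DGroup.ext

theorem mul_val (x : DGroup hM he) : e * x.val = x.val := mul_eq_of_D hM he x.2

theorem val_mul_self (x : DGroup hM he) : x.val * e = x.val := by
  exact congrArg val (mul_one x)

theorem val_pow (x : DGroup hM he) {n : ℕ} (hn : n ≠ 0) : (x ^ n).val = x.val ^ n := by
  induction n with
  | zero => exact absurd rfl hn
  | succ n ih =>
    rcases eq_or_ne n 0 with rfl | h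
    · simp
    · rw [pow_succ, pow_succ, val_mul, ih h]

end DGroup

theorem eq_of_D_of_idempotent (hM : IsDAb M) (he : e * e = e) {f : M} (hf : f * f = f)
    (h : Green.D e f) : f = e := by
  let x : DGroup hM he := ⟨f, h⟩
  have h1 : x * x = x := DGroup.val_injective hf
  have h2 : x = 1 := by simpa using h1
  exact congrArg DGroup.val h2

/-- A conjugation rule: if `e = x * y` is idempotent, then `e` is also equal to `y * e * x`. -/
theorem conj_eq (hM : IsDAb M) {x y : M} (he : x * y * (x * y) = x * y) :
    y * (x * y) * x = x * y := by
  refine eq_of_D_of_idempotent hM he ?_ ?_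
  · calc y * (x * y) * x * (y * (x * y) * x) = y * (x * y * (x * y) * (x * y)) * x := by
          simp only [mul_assoc]
      _ = y * (x * y) * x := by rw [he, he]
  -- The path is `x * y`, then `x * y * x` by an `ℛ`-step, then `y * (x * y) * x` by an `ℒ`-step.
  · refine Relation.ReflTransGen.tail (Relation.ReflTransGen.single (b := x * y * x) (Or.inr ?_))
      (Or.inl ?_)
    · exact ⟨x, y * (x * y), rfl, by
        rw [show x * y * x * (y * (x * y)) = x * y * (x * y) * (x * y) by simp only [mul_assoc],
          he, he]⟩
    · exact ⟨y, x, by simp only [mul_assoc], by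
        rw [show x * (y * (x * y) * x) = x * y * (x * y) * x by simp only [mul_assoc], he]⟩

/-- An element that commutes with the idempotent `e` and acts on its `𝒟`-class. -/
def Acts (e x : M) : Prop := x * e = e * x ∧ Green.D e (e * x)

/-- Rotating the factorization of `e` by `conj_eq` in two ways shows that `q * e * p` is inverse to
`a` on both sides with respect to `e`. Hence `e * a` and `a * e` lie in the group of `e`, whose
neutral element is `e`, and both equal `e * a * e`. -/
theorem acts_of_factor (hM : IsDAb M) (he : e * e = e) {p a q : M} (h : e = p * a * q) :
    Acts e a := by
  have h1 : a * (q * e * p) = e := by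
    have h2 : p * (a * q) = e := by rw [h, mul_assoc]
    have := conj_eq hM (x := p) (y := a * q) (by rw [h2, he])
    rw [h2] at this
    exact Eq.trans (by simp only [mul_assoc]) this
  have h2 : (q * e * p) * a = e := by
    have h3 : p * a * q = e := h.symm
    have := conj_eq hM (x := p * a) (y := q) (by rw [h3, he])
    rw [h3] at this
    exact Eq.trans (by simp only [mul_assoc]) this
  have hR : Green.D e (e * a) := Relation.ReflTransGen.single
    (Or.inr ⟨a, q * e * p, rfl, by rw [mul_assoc, h1, he]⟩)
  have hL : Green.D e (a * e) := Relation.ReflTransGen.single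
    (Or.inl ⟨a, q * e * p, rfl, by rw [← mul_assoc, h2, he]⟩)
  refine ⟨?_, hR⟩
  have h3 := DGroup.mul_val (hM := hM) (he := he) ⟨a * e, hL⟩
  have h4 := DGroup.val_mul_self (hM := hM) (he := he) ⟨e * a, hR⟩
  change e * (a * e) = a * e at h3
  change e * a * e = e * a at h4
  rw [← h3, ← mul_assoc, h4]

end DAbMonoid

/-! ### Values of words and of signed words -/

/-- The value of a word of codes under an assignment of the codes. -/
def wordVal {M : Type*} [Monoid M] (g : ℕ → M) (w : List ℕ) : M := (w.map g).prod

section wordVal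

variable {M : Type*} [Monoid M] (g : ℕ → M)

@[simp] theorem wordVal_nil : wordVal g [] = 1 := rfl

@[simp] theorem wordVal_cons (a : ℕ) (w : List ℕ) : wordVal g (a :: w) = g a * wordVal g w := by
  simp [wordVal]

@[simp] theorem wordVal_append (v w : List ℕ) :
    wordVal g (v ++ w) = wordVal g v * wordVal g w := by
  simp [wordVal]

@[simp] theorem wordVal_replicate_flatten (n : ℕ) (w : List ℕ) :
    wordVal g (List.replicate n w).flatten = wordVal g w ^ n := by
  induction n with
  | zero => simp
  | succ n ih => rw [List.replicate_succ, List.flatten_cons, wordVal_append, ih, pow_succ']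

end wordVal

/-! ### Exponents in the role of `ω`, and the action of words on the group of an idempotent. -/

namespace DAbMonoid

variable {M : Type*} [Monoid M] {e : M}

/-- `K` plays the role of a factorial `k !` with `k` large with respect to `M`. -/
def GoodExp (M : Type*) [Monoid M] (K : ℕ) : Prop := 2 ≤ K ∧ ∀ x : M, x ^ (K - 1) * x ^ K = x ^ (K - 1)

theorem GoodExp.idem {K : ℕ} (hK : GoodExp M K) (x : M) : x ^ K * x ^ K = x ^ K := by
  have h : x ^ K = x * x ^ (K - 1) := by rw [← pow_succ']; congr 1; have := hK.1; omega
  calc x ^ K * x ^ K = x * (x ^ (K - 1) * x ^ K) := by rw [← mul_assoc, ← h]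
    _ = x ^ K := by rw [hK.2, h]

/-- The powers with exponents `k! - 1`, `(k + 1)! - 1` and `(k + 2)! - 1` coincide. With `K = k!`
the second exponent is `(K - 1) + K * k`, so multiples of `K * k` can be dropped; the third is `(K -
1) + K` plus such a multiple. -/
theorem goodExp_factorial [Finite M] {k : ℕ} (hk : Nat.card M + 2 ≤ k) :
    GoodExp M k.factorial := by
  have h2 : 2 ≤ k.factorial := by
    have := Nat.self_le_factorial k; omega
  refine ⟨h2, fun x => ?_⟩
  have h3 := FreeProfiniteMonoid.pow_factorial_sub_one_eq (n := Nat.card M) le_rfl hk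
    (show Nat.card M + 2 ≤ k + 1 by omega) x
  have h4 := FreeProfiniteMonoid.pow_factorial_sub_one_eq (n := Nat.card M) le_rfl hk
    (show Nat.card M + 2 ≤ k + 2 by omega) x
  set K := k.factorial with hK
  have hk1 : (k + 1).factorial - 1 = (K - 1) + K * k := by
    rw [Nat.factorial_succ, ← hK, add_mul, one_mul, mul_comm k]; omega
  have hk2 : (k + 2).factorial - 1 = (K - 1) + K * (k * (k + 3)) + K := by
    rw [Nat.factorial_succ, Nat.factorial_succ, ← hK,
      show (k + 1 + 1) * ((k + 1) * K) = K * (k * (k + 3)) + K + K by ring]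
    omega
  rw [hk1] at h3
  rw [hk2] at h4
  have h5 : ∀ j, x ^ (K - 1) * x ^ (K * (k * j)) = x ^ (K - 1) := by
    intro j
    induction j with
    | zero => simp
    | succ j ih =>
      rw [show K * (k * (j + 1)) = K * k + K * (k * j) by ring, pow_add, ← mul_assoc,
        ← pow_add, ← h3, ih]
  rw [pow_add, pow_add, h5] at h4
  exact h4.symm

/-- A letter of `b` is a factor of the idempotent `b ^ K`, so `acts_of_factor` applies. -/
theorem acts_letter (hM : IsDAb M) {K : ℕ} (hK : GoodExp M K) (g : ℕ → M) {b : List ℕ} {a : ℕ}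
    (ha : a ∈ b) : Acts (wordVal g b ^ K) (g a) := by
  obtain ⟨b₁, b₂, rfl⟩ := List.append_of_mem ha
  refine acts_of_factor hM (hK.idem _) (p := wordVal g b₁)
    (q := wordVal g b₂ * wordVal g (b₁ ++ a :: b₂) ^ (K - 1)) ?_
  have h : ∀ x : M, x ^ K = x * x ^ (K - 1) := fun x => by
    rw [← pow_succ']; congr 1; have := hK.1; omega
  rw [h]
  simp [mul_assoc]

variable (hM : IsDAb M) (he : e * e = e) (g : ℕ → M)

open Classical in
/-- The action of a letter on the group of `e`. -/
noncomputable def theta (a : ℕ) : DGroup hM he :=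
  -- The value `1` only makes the map total; it is irrelevant wherever all letters of a word act on
  -- the group of `e`.
  if h : Acts e (g a) then ⟨e * g a, h.2⟩ else 1

/-- The action of a word on the group of `e`. -/
noncomputable def thetaWord (w : List ℕ) : DGroup hM he := (w.map (theta hM he g)).prod

theorem thetaWord_append (v w : List ℕ) :
    thetaWord hM he g (v ++ w) = thetaWord hM he g v * thetaWord hM he g w := by
  simp [thetaWord]

theorem thetaWord_flatten_replicate (n : ℕ) (w : List ℕ) :
    thetaWord hM he g (List.replicate n w).flatten = thetaWord hM he g w ^ n := by
  induction n with
  | zero => simp [thetaWord]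
  | succ n ih =>
    rw [List.replicate_succ, List.flatten_cons, thetaWord_append, ih, pow_succ']

theorem thetaWord_perm {v w : List ℕ} (h : v.Perm w) :
    thetaWord hM he g v = thetaWord hM he g w := (h.map _).prod_eq

variable {g}

/-- Since `e` is idempotent and commutes with each letter, a copy of `e` can be placed before every
letter, which turns the word into a product in the group of `e`. -/
theorem mul_wordVal {w : List ℕ} (hw : ∀ a ∈ w, Acts e (g a)) :
    e * wordVal g w = (thetaWord hM he g w).val ∧ wordVal g w * e = e * wordVal g w := by
  induction w with
  | nil => simp [thetaWord, DGroup.val_one]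
  | cons a w ih =>
    obtain ⟨h1, h2⟩ := ih fun b hb => hw b (List.mem_cons_of_mem _ hb)
    have ha := hw a List.mem_cons_self
    have ht : (theta hM he g a).val = e * g a := by rw [theta, dif_pos ha]
    constructor
    · rw [thetaWord, List.map_cons, List.prod_cons, DGroup.val_mul, ← thetaWord, ← h1, ht,
        wordVal_cons]
      rw [← mul_assoc (e * g a), mul_assoc e (g a) e, ha.1, ← mul_assoc e e, he, mul_assoc]
    · rw [wordVal_cons, mul_assoc, h2, ← mul_assoc, ha.1, mul_assoc]

theorem DGroup.pow_eq_one {hM : IsDAb M} {he : e * e = e} {K : ℕ} (hK : GoodExp M K)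
    (x : DGroup hM he) : x ^ K = 1 := by
  have h : x ^ K * x ^ K = x ^ K := by
    apply DGroup.val_injective
    have := hK.1
    rw [DGroup.val_mul, DGroup.val_pow _ (by omega), hK.idem]
  simpa using h

theorem DGroup.pow_pred {hM : IsDAb M} {he : e * e = e} {K : ℕ} (hK : GoodExp M K)
    (x : DGroup hM he) : x ^ (K - 1) = x⁻¹ := by
  rw [eq_inv_iff_mul_eq_one, ← pow_succ, Nat.sub_add_cancel (by have := hK.1; omega),
    DGroup.pow_eq_one hK]

/-- The idempotent of a word acts trivially if its letters occur in the word of `e`. -/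
theorem mul_wordVal_pow {K : ℕ} (hK : GoodExp M K) {w : List ℕ} (hw : ∀ a ∈ w, Acts e (g a))
    (hM : IsDAb M) (he : e * e = e) :
    e * wordVal g w ^ K = e := by
  rw [← wordVal_replicate_flatten, (mul_wordVal hM he ?_).1, thetaWord_flatten_replicate,
    DGroup.pow_eq_one hK, DGroup.val_one]
  intro a ha
  simp only [List.mem_flatten, List.mem_replicate] at ha
  obtain ⟨l, ⟨_, rfl⟩, ha⟩ := ha
  exact hw a ha

/-- The idempotent power of a word depends only on its content. -/
theorem wordVal_pow_congr (hM : IsDAb M) {K : ℕ} (hK : GoodExp M K) {b c : List ℕ}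
    (h : ∀ a, a ∈ b ↔ a ∈ c) : wordVal g b ^ K = wordVal g c ^ K := by
  -- Each of the two idempotents absorbs the other from the right; as they commute, they are equal.
  have h1 : wordVal g b ^ K * wordVal g c ^ K = wordVal g b ^ K :=
    mul_wordVal_pow hK (fun a ha => acts_letter hM hK g ((h a).2 ha)) hM (hK.idem _)
  have h2 : wordVal g c ^ K * wordVal g b ^ K = wordVal g c ^ K :=
    mul_wordVal_pow hK (fun a ha => acts_letter hM hK g ((h a).1 ha)) hM (hK.idem _)
  rw [← h1]
  have h3 := (mul_wordVal hM (hK.idem (wordVal g c))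
    (fun a ha => acts_letter hM hK g ((h a).1 ha) : ∀ a ∈ b, _)).2
  exact ((Commute.pow_left (show Commute (wordVal g b) (wordVal g c ^ K) from h3) K).eq.trans h2)

end DAbMonoid

/-! ### Equations of pseudowords as equations between values of terms -/

namespace FreeProfiniteMonoid

open UniformSpace

variable {A : Type u}

/-- Words that are close in the profinite metric have the same image in a given finite monoid. -/
theorem eventually_map_eq {M : Type} [Monoid M] [Finite M] (φ : FreeMonoid A →* M) :
    ∀ᶠ p : FreeMonoid A × FreeMonoid A in uniformity (FreeMonoid A), φ p.1 = φ p.2 := by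
  refine mem_of_superset (Metric.dist_mem_uniformity
    (show (0 : ℝ) < (1 / 2) ^ (Nat.card M + 1) by positivity)) ?_
  rintro ⟨x, y⟩ h
  exact (ProfiniteWord.dist_le_iff x y (Nat.card M)).1 (le_of_lt h) M φ le_rfl

/-- Every homomorphism from words to a finite monoid extends continuously to pseudowords. -/
theorem exists_extension {M : Type} [Monoid M] [Finite M] (φ : FreeMonoid A →* M) :
    letI : TopologicalSpace M := ⊥
    ∃ ψ : FreeProfiniteMonoid A →* M, Continuous ψ ∧
      ∀ x : FreeMonoid A, ψ (x : Completion (FreeMonoid A)) = φ x := by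
  let _ : UniformSpace M := ⊥
  have : DiscreteUniformity M := ⟨rfl⟩
  have hu : UniformContinuous φ := by
    rw [uniformContinuous_iff_eventually]
    intro r hr
    filter_upwards [eventually_map_eq φ] with p hp
    rw [hp]
    exact refl_mem_uniformity hr
  have hc : Continuous (Completion.extension φ) := Completion.continuous_extension
  have hx : ∀ x : FreeMonoid A, Completion.extension φ (x : Completion (FreeMonoid A)) = φ x :=
    fun x => Completion.extension_coe hu x
  refine ⟨⟨⟨Completion.extension φ, ?_⟩, ?_⟩, hc, hx⟩
  · rw [← coe_one, hx, map_one]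
  · intro α β
    refine Completion.induction_on₂ α β (isClosed_eq (hc.comp continuous_mul)
      ((hc.comp continuous_fst).mul (hc.comp continuous_snd))) ?_
    intro x y
    change Completion.extension φ ((x : FreeProfiniteMonoid A) * y) =
      Completion.extension φ (x : Completion (FreeMonoid A)) *
        Completion.extension φ (y : Completion (FreeMonoid A))
    rw [← coe_mul, hx, map_mul, hx, hx]

/-- A continuous homomorphism maps the `(ω - 1)`-power to the power with exponent `k ! - 1`, for
`k` large. -/
theorem map_omegaSubOnePow {M : Type*} [Monoid M] [Finite M] (φ : FreeProfiniteMonoid A →* M)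
    (hφ : letI : TopologicalSpace M := ⊥; Continuous φ) (α : FreeProfiniteMonoid A) {k : ℕ}
    (hk : Nat.card M + 2 ≤ k) : φ α.omegaSubOnePow = φ α ^ (k.factorial - 1) := by
  let _ : TopologicalSpace M := ⊥
  have : DiscreteTopology M := ⟨rfl⟩
  have h1 := (hφ.tendsto _).comp (tendsto_omegaSubOnePow α)
  have h2 : Tendsto (φ ∘ fun k : ℕ => α ^ (k.factorial - 1)) atTop
      (𝓝 (φ α ^ (k.factorial - 1))) := by
    refine tendsto_const_nhds.congr' ?_
    filter_upwards [eventually_ge_atTop (Nat.card M + 2)] with l hl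
    rw [Function.comp_apply, map_pow]
    exact pow_factorial_sub_one_eq le_rfl hk hl _
  exact tendsto_nhds_unique h1 h2

end FreeProfiniteMonoid

/-! ### From continuous homomorphisms to assignments of letter codes. -/

namespace OmegaTerm

variable {A : Type u} [Encodable A] {M : Type*} [Monoid M]

/-- The value of a term, where the `(ω - 1)`-power is read as the power with exponent `K - 1`. -/
def termVal (g : ℕ → M) (K : ℕ) : OmegaTerm A → M
  | letter a => g (Encodable.encode a)
  | concat s t => s.termVal g K * t.termVal g K
  | power t => t.termVal g K ^ (K - 1)

theorem map_toPseudoword [Finite M] (φ : FreeProfiniteMonoid A →* M)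
    (hφ : letI : TopologicalSpace M := ⊥; Continuous φ) {g : ℕ → M} {k : ℕ}
    (hk : Nat.card M + 2 ≤ k)
    (hg : ∀ a : A, φ ((FreeMonoid.of a : FreeMonoid A) : UniformSpace.Completion (FreeMonoid A)) =
      g (Encodable.encode a)) (t : OmegaTerm A) :
    φ t.toPseudoword = t.termVal g k.factorial := by
  induction t with
  | letter a => exact hg a
  | concat s t ihs iht => rw [toPseudoword, map_mul, ihs, iht, termVal]
  | power t ih =>
    rw [toPseudoword, FreeProfiniteMonoid.map_omegaSubOnePow φ hφ _ hk, ih, termVal]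

/-- This removes all topology: a continuous homomorphism into a finite monoid is given by arbitrary
values of the letters, and there `ω - 1` may be replaced by `k! - 1` for every sufficiently large
`k`. Assigning values to codes makes everything that follows independent of the alphabet. -/
theorem dabSatisfiesEq_iff (s t : OmegaTerm A) :
    DAbSatisfiesEq s.toPseudoword t.toPseudoword ↔
      ∀ (M : Type) [Monoid M], IsDAb M → ∀ (g : ℕ → M) (k : ℕ), Nat.card M + 2 ≤ k →
        s.termVal g k.factorial = t.termVal g k.factorial := by
  constructor
  · intro h M _ hM g k hk
    have := hM.1
    obtain ⟨ψ, hc, hψ⟩ := FreeProfiniteMonoid.exists_extension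
      (FreeMonoid.lift fun a : A => g (Encodable.encode a))
    have h1 := h M hM ψ hc
    have hg : ∀ a : A, ψ ((FreeMonoid.of a : FreeMonoid A) :
        UniformSpace.Completion (FreeMonoid A)) = g (Encodable.encode a) := fun a => by
      rw [hψ, FreeMonoid.lift_eval_of]
    rwa [map_toPseudoword ψ hc hk hg, map_toPseudoword ψ hc hk hg] at h1
  · intro h M _ hM φ hφ
    have := hM.1
    let g : ℕ → M := fun i => (Encodable.decode (α := A) i).elim 1 fun a =>
      φ ((FreeMonoid.of a : FreeMonoid A) : UniformSpace.Completion (FreeMonoid A))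
    have hg : ∀ a : A, φ ((FreeMonoid.of a : FreeMonoid A) :
        UniformSpace.Completion (FreeMonoid A)) = g (Encodable.encode a) := fun a => by
      simp [g, Encodable.encodek]
    rw [map_toPseudoword φ hφ le_rfl hg, map_toPseudoword φ hφ le_rfl hg]
    exact h M hM g _ le_rfl

end OmegaTerm

/-! ### Signed items -/

/-- Either a letter `a`, coded as `(false, [a], [])`, or a block, coded as `(true, P, Q)`. The block
`(true, P, Q)` stands for `e * P * Q⁻¹` where `e` is the idempotent whose content is that of
`P ++ Q`. -/
abbrev SignedItem : Type := Bool × List ℕ × List ℕ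

namespace SignedItem

/-- The letters that occur in an item. -/
def letters (x : SignedItem) : List ℕ := x.2.1 ++ x.2.2

/-- The items that represent letters or blocks. -/
def WF (x : SignedItem) : Prop :=
  (∃ a, x = (false, [a], [])) ∨ x.1 = true ∧ x.letters ≠ []

/-- The word `P * Q ^ (K - 1)`. -/
def signedWord (K : ℕ) (P Q : List ℕ) : List ℕ := P ++ (List.replicate (K - 1) Q).flatten

/-- The word for an item, where the exponent `ω` is replaced by `K`. -/
def itemWord (K : ℕ) (x : SignedItem) : List ℕ :=
  if x.1 = true then (List.replicate K x.letters).flatten ++ signedWord K x.2.1 x.2.2 else x.2.1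

/-- The word for a list of items. -/
def listWord (K : ℕ) (l : List SignedItem) : List ℕ := l.flatMap (itemWord K)

@[simp] theorem listWord_nil (K : ℕ) : listWord K [] = [] := rfl

@[simp] theorem listWord_cons (K : ℕ) (x : SignedItem) (l : List SignedItem) :
    listWord K (x :: l) = itemWord K x ++ listWord K l := rfl

@[simp] theorem listWord_append (K : ℕ) (l l' : List SignedItem) :
    listWord K (l ++ l') = listWord K l ++ listWord K l' := List.flatMap_append

/-- The block `y` absorbs the item `x`. -/
def merge (y x : SignedItem) : SignedItem := (true, y.2.1 ++ x.2.1, y.2.2 ++ x.2.2)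

/-- The item `y` is a block that contains all letters of `x`. -/
def Covers (y x : SignedItem) : Prop := y.1 = true ∧ ∀ a ∈ x.letters, a ∈ y.letters

/-- The block for the `(ω - 1)`-power of a list of items. -/
def negItem (l : List SignedItem) : SignedItem :=
  (true, l.flatMap fun x => x.2.2, l.flatMap fun x => x.2.1)

theorem mem_letters_merge {x y : SignedItem} {a : ℕ} :
    a ∈ (merge y x).letters ↔ a ∈ y.letters ∨ a ∈ x.letters := by
  simp only [letters, merge, List.mem_append]; tauto

theorem mem_letters_negItem {l : List SignedItem} {a : ℕ} :
    a ∈ (negItem l).letters ↔ ∃ x ∈ l, a ∈ x.letters := by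
  simp only [letters, negItem, List.mem_append, List.mem_flatMap]
  grind

theorem WF.merge {x y : SignedItem} (hy : WF y) : WF (merge y x) := by
  right
  refine ⟨rfl, ?_⟩
  rcases hy with ⟨a, rfl⟩ | ⟨_, h⟩
  · simp [letters, SignedItem.merge]
  · simp only [letters, SignedItem.merge, ne_eq, List.append_eq_nil_iff, not_and] at h ⊢
    tauto

theorem WF.letters_ne_nil {x : SignedItem} (hx : WF x) : x.letters ≠ [] := by
  rcases hx with ⟨a, rfl⟩ | ⟨_, h⟩
  · simp [letters]
  · exact h

theorem wf_negItem {l : List SignedItem} (hl : l ≠ []) (h : ∀ x ∈ l, WF x) : WF (negItem l) := by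
  obtain ⟨x, l, rfl⟩ := List.exists_cons_of_ne_nil hl
  obtain ⟨a, ha⟩ := List.exists_mem_of_ne_nil _ (h x List.mem_cons_self).letters_ne_nil
  exact Or.inr ⟨rfl, List.ne_nil_of_mem (mem_letters_negItem.2 ⟨x, List.mem_cons_self, ha⟩)⟩

theorem mem_flatten_replicate {K a : ℕ} {w : List ℕ} (hK : K ≠ 0) :
    a ∈ (List.replicate K w).flatten ↔ a ∈ w := by
  simp [List.mem_flatten, List.mem_replicate, hK]

theorem mem_itemWord {K : ℕ} (hK : 2 ≤ K) {x : SignedItem} (hx : WF x) {a : ℕ} :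
    a ∈ itemWord K x ↔ a ∈ x.letters := by
  rcases hx with ⟨b, rfl⟩ | ⟨h, _⟩
  · simp [itemWord, letters]
  · rw [itemWord, if_pos h, signedWord, List.mem_append, List.mem_append,
      mem_flatten_replicate (by omega), mem_flatten_replicate (by omega), letters, List.mem_append]
    tauto

theorem mem_listWord {K : ℕ} (hK : 2 ≤ K) {l : List SignedItem} (hl : ∀ x ∈ l, WF x) {a : ℕ} :
    a ∈ listWord K l ↔ ∃ x ∈ l, a ∈ x.letters := by
  rw [listWord, List.mem_flatMap]
  exact ⟨fun ⟨x, hx, h⟩ => ⟨x, hx, (mem_itemWord hK (hl x hx)).1 h⟩,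
    fun ⟨x, hx, h⟩ => ⟨x, hx, (mem_itemWord hK (hl x hx)).2 h⟩⟩

/-! ### Values of items in monoids of **DAb** -/

section Value

open DAbMonoid

variable {M : Type*} [Monoid M] {e : M} {K : ℕ} {g : ℕ → M}

theorem mul_signedWord (hM : IsDAb M) (he : e * e = e) (hK : GoodExp M K) {P Q : List ℕ}
    (hP : ∀ a ∈ P, Acts e (g a)) (hQ : ∀ a ∈ Q, Acts e (g a)) :
    e * wordVal g (signedWord K P Q) =
      (thetaWord hM he g P * (thetaWord hM he g Q)⁻¹).val ∧
    wordVal g (signedWord K P Q) * e = e * wordVal g (signedWord K P Q) := by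
  have h := mul_wordVal hM he (w := signedWord K P Q) (g := g) (by
    intro a ha
    rcases List.mem_append.1 ha with h | h
    · exact hP a h
    · simp only [List.mem_flatten, List.mem_replicate] at h
      obtain ⟨l, ⟨_, rfl⟩, h⟩ := h
      exact hQ a h)
  refine ⟨?_, h.2⟩
  rw [h.1, signedWord, thetaWord_append, thetaWord_flatten_replicate, DGroup.pow_pred hK]

/-- In the group of `e` the prefix with exponent `K` acts trivially and the exponent `K - 1`
inverts, so letters and blocks are treated alike: both contribute `P * Q⁻¹`. -/
theorem mul_itemWord (hM : IsDAb M) (he : e * e = e) (hK : GoodExp M K) {x : SignedItem}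
    (hx : WF x) (h : ∀ a ∈ x.letters, Acts e (g a)) :
    e * wordVal g (itemWord K x) =
      (thetaWord hM he g x.2.1 * (thetaWord hM he g x.2.2)⁻¹).val ∧
    wordVal g (itemWord K x) * e = e * wordVal g (itemWord K x) := by
  have h' := mul_wordVal hM he (w := itemWord K x) (g := g)
    fun a ha => h a ((mem_itemWord hK.1 hx).1 ha)
  refine ⟨?_, h'.2⟩
  rw [h'.1]
  congr 1
  rcases hx with ⟨b, rfl⟩ | ⟨hb, _⟩
  · simp [itemWord, thetaWord]
  · rw [itemWord, if_pos hb, signedWord, thetaWord_append, thetaWord_append,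
      thetaWord_flatten_replicate, thetaWord_flatten_replicate, DGroup.pow_pred hK,
      DGroup.pow_eq_one hK, one_mul]

/-- The value of a block lies in the group of its idempotent. -/
theorem val_block (hM : IsDAb M) (hK : GoodExp M K) {x : SignedItem} (hx : WF x) (h : x.1 = true)
    {b : List ℕ} (hb : ∀ a, a ∈ x.letters ↔ a ∈ b) :
    wordVal g (itemWord K x) = (thetaWord hM (hK.idem (wordVal g b)) g x.2.1 *
      (thetaWord hM (hK.idem (wordVal g b)) g x.2.2)⁻¹).val := by
  rw [← (mul_itemWord hM _ hK hx fun a ha => acts_letter hM hK g ((hb a).1 ha)).1]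
  rw [itemWord, if_pos h, wordVal_append, wordVal_replicate_flatten,
    wordVal_pow_congr hM hK hb, ← mul_assoc, hK.idem]

theorem mul_val_block (hM : IsDAb M) (hK : GoodExp M K) {x : SignedItem} (hx : WF x)
    (h : x.1 = true) :
    wordVal g x.letters ^ K * wordVal g (itemWord K x) = wordVal g (itemWord K x) ∧
    wordVal g (itemWord K x) * wordVal g x.letters ^ K = wordVal g (itemWord K x) := by
  rw [val_block hM hK hx h fun a => Iff.rfl]
  exact ⟨DGroup.mul_val _, DGroup.val_mul_self _⟩

/-- The value of `y` absorbs its idempotent, which turns `x` into an element of the same Abelian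
group; so the order of the factors does not matter. The merged block has the content of `y`, hence
the same idempotent. -/
theorem val_merge (hM : IsDAb M) (hK : GoodExp M K) {x y : SignedItem} (hx : WF x) (hy : WF y)
    (h : Covers y x) :
    wordVal g (itemWord K (merge y x)) = wordVal g (itemWord K y) * wordVal g (itemWord K x) ∧
    wordVal g (itemWord K (merge y x)) = wordVal g (itemWord K x) * wordVal g (itemWord K y) := by
  have hb : ∀ a, a ∈ (merge y x).letters ↔ a ∈ y.letters := fun a => by
    rw [mem_letters_merge]; exact ⟨fun h' => h'.elim id (h.2 a), Or.inl⟩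
  have hxa : ∀ a ∈ x.letters, Acts (wordVal g y.letters ^ K) (g a) :=
    fun a ha => acts_letter hM hK g (h.2 a ha)
  have h1 := mul_itemWord hM (hK.idem (wordVal g y.letters)) hK hx hxa
  have h2 := mul_val_block (g := g) hM hK hy h.1
  have h3 := val_block (g := g) hM hK hy h.1 fun a => Iff.rfl
  constructor
  · rw [val_block hM hK hy.merge rfl hb, ← h2.2, mul_assoc, h1.1, h3, ← DGroup.val_mul]
    simp only [merge, thetaWord_append, mul_inv]
    congr 1; rw [mul_mul_mul_comm]
  · rw [val_block hM hK hy.merge rfl hb, ← h2.1, ← mul_assoc, h1.2, h1.1, h3, ← DGroup.val_mul]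
    simp only [merge, thetaWord_append, mul_inv]
    rw [mul_mul_mul_comm]
    exact congrArg DGroup.val (mul_comm _ _)

/-- Together with `val_eq_mul_signedWord` this moves letters across the boundary of two blocks: the
signed word `P * Q⁻¹` can be split off from a block on either side if its letters belong to the
content. -/
theorem mul_val_signedWord (hM : IsDAb M) (hK : GoodExp M K) {y : SignedItem} {P Q : List ℕ}
    (hy : WF y) (h : y.1 = true) (hP : ∀ a ∈ P, a ∈ y.letters) (hQ : ∀ a ∈ Q, a ∈ y.letters) :
    wordVal g (itemWord K (true, y.2.1 ++ P, y.2.2 ++ Q)) =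
      wordVal g (signedWord K P Q) * wordVal g (itemWord K y) := by
  have hb : ∀ a, a ∈ (merge y (true, P, Q)).letters ↔ a ∈ y.letters := fun a => by
    rw [mem_letters_merge]
    simp only [letters, List.mem_append] at hP hQ ⊢
    grind
  have h1 := mul_signedWord hM (hK.idem (wordVal g y.letters)) hK
    (fun a ha => acts_letter hM hK g (hP a ha)) (fun a ha => acts_letter hM hK g (hQ a ha))
  rw [← (mul_val_block hM hK hy h).1, ← mul_assoc, h1.2, h1.1,
    val_block hM hK hy h fun a => Iff.rfl, ← DGroup.val_mul]
  refine (val_block hM hK (x := merge y (true, P, Q)) hy.merge rfl hb).trans ?_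
  simp only [merge, thetaWord_append, mul_inv]
  rw [mul_mul_mul_comm]
  exact congrArg DGroup.val (mul_comm _ _)

/-- The hypothesis on counts says that `x` and `P * Q⁻¹` together represent the same element of the
free Abelian group as `x'`; both sides are images of it in the group of the common idempotent. -/
theorem val_eq_mul_signedWord (hM : IsDAb M) (hK : GoodExp M K) {x x' : SignedItem} {P Q : List ℕ}
    (hx : WF x) (h : x.1 = true) (hx' : WF x') (h' : x'.1 = true)
    (hb : ∀ a, a ∈ x'.letters ↔ a ∈ x.letters)
    (hP : ∀ a ∈ P, a ∈ x.letters) (hQ : ∀ a ∈ Q, a ∈ x.letters)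
    (hc : ∀ a, x.2.1.count a + P.count a + x'.2.2.count a =
      x'.2.1.count a + x.2.2.count a + Q.count a) :
    wordVal g (itemWord K x') = wordVal g (itemWord K x) * wordVal g (signedWord K P Q) := by
  have h1 := mul_signedWord hM (hK.idem (wordVal g x.letters)) hK
    (fun a ha => acts_letter hM hK g (hP a ha)) (fun a ha => acts_letter hM hK g (hQ a ha))
  rw [← (mul_val_block hM hK hx h).2, mul_assoc, h1.1, val_block hM hK hx h fun a => Iff.rfl,
    ← DGroup.val_mul, val_block hM hK hx' h' hb]
  congr 1
  have hp : (x.2.1 ++ P ++ x'.2.2).Perm (x'.2.1 ++ x.2.2 ++ Q) := by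
    rw [List.perm_iff_count]
    intro a
    simpa [List.count_append, add_assoc] using hc a
  have h2 := thetaWord_perm hM (hK.idem (wordVal g x.letters)) g hp
  simp only [thetaWord_append] at h2
  rw [← div_eq_mul_inv, ← div_eq_mul_inv, ← div_eq_mul_inv, div_mul_div_comm,
    div_eq_div_iff_mul_eq_mul, h2, mul_assoc]

/-- By the choice of `K` the power absorbs the idempotent with the content of `l`, so it is the
inverse of an element of an Abelian group. Inversion exchanges the positive and the negative letters
of all items. -/
theorem val_negItem (hM : IsDAb M) (hK : GoodExp M K) {l : List SignedItem} (hl : l ≠ [])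
    (h : ∀ x ∈ l, WF x) :
    wordVal g (itemWord K (negItem l)) = wordVal g (listWord K l) ^ (K - 1) := by
  have hb : ∀ a, a ∈ (negItem l).letters ↔ a ∈ listWord K l := fun a => by
    rw [mem_letters_negItem, mem_listWord hK.1 h]
  set he := hK.idem (wordVal g (listWord K l))
  have hK1 := hK.1
  have hA : ∀ x ∈ l, ∀ a ∈ x.letters, Acts (wordVal g (listWord K l) ^ K) (g a) :=
    fun x hx a ha => acts_letter hM hK g ((mem_listWord hK.1 h).2 ⟨x, hx, ha⟩)
  rw [← hK.2, val_block hM hK (wf_negItem hl h) rfl hb, ← pow_add, add_comm, pow_add,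
    ← wordVal_replicate_flatten (n := K - 1), (mul_wordVal hM he ?_).1,
    thetaWord_flatten_replicate, DGroup.pow_pred hK]
  · congr 1
    have h2 : ∀ l' : List SignedItem, (∀ x ∈ l', WF x) →
        thetaWord hM he g (listWord K l') =
          thetaWord hM he g (l'.flatMap fun x => x.2.1) *
            (thetaWord hM he g (l'.flatMap fun x => x.2.2))⁻¹ := by
      intro l' hl'
      induction l' with
      | nil => simp [thetaWord]
      | cons x l' ih =>
        have hx : thetaWord hM he g (itemWord K x) =
            thetaWord hM he g x.2.1 * (thetaWord hM he g x.2.2)⁻¹ := by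
          rcases hl' x List.mem_cons_self with ⟨b, rfl⟩ | ⟨hb, _⟩
          · simp [itemWord, thetaWord]
          · rw [itemWord, if_pos hb, signedWord, thetaWord_append, thetaWord_append,
              thetaWord_flatten_replicate, thetaWord_flatten_replicate, DGroup.pow_pred hK,
              DGroup.pow_eq_one hK, one_mul]
        rw [listWord_cons, thetaWord_append, hx, ih fun y hy => hl' y (List.mem_cons_of_mem _ hy),
          List.flatMap_cons, List.flatMap_cons, thetaWord_append, thetaWord_append, mul_inv,
          mul_mul_mul_comm]
    rw [h2 l h, mul_inv, inv_inv, mul_comm]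
    rfl
  · intro a ha
    rw [mem_flatten_replicate (by omega)] at ha
    exact acts_letter hM hK g ha

end Value

/-! ### Reduction of lists of items -/

open Classical in
/-- One step of the reduction. The state consists of the items that are still to be read, in
reversed order, and of a reduced list. -/
noncomputable def step (s : List SignedItem × List SignedItem) :
    List SignedItem × List SignedItem :=
  if s.1 = [] then s
  else if s.2 = [] then (s.1.tail, [s.1.headI])
  -- The enlarged block goes back to the input, since it may absorb further items of the reduced
  -- list.
  else if Covers s.1.headI s.2.headI then (merge s.1.headI s.2.headI :: s.1.tail, s.2.tail)
  else if Covers s.2.headI s.1.headI then (s.1.tail, merge s.2.headI s.1.headI :: s.2.tail)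
  else (s.1.tail, s.1.headI :: s.2)

/-- The reduced list of items that has the same value as `l`. -/
noncomputable def normalize (l : List SignedItem) : List SignedItem :=
  -- Each step with nonempty input lowers `2 * s.1.length + s.2.length`, which is `2 * l.length` at
  -- the start.
  (step^[2 * l.length] (l.reverse, [])).2

/-- A list is reduced if no item can be absorbed by a neighbour. -/
def Reduced (l : List SignedItem) : Prop :=
  (∀ x ∈ l, WF x) ∧ l.IsChain fun x y => ¬Covers x y ∧ ¬Covers y x

theorem step_cases {P : List SignedItem × List SignedItem → List SignedItem × List SignedItem → Prop}
    (h0 : ∀ st, P ([], st) ([], st))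
    (h1 : ∀ x l, P (x :: l, []) (l, [x]))
    (h2 : ∀ x l y st, Covers x y → P (x :: l, y :: st) (merge x y :: l, st))
    (h3 : ∀ x l y st, ¬Covers x y → Covers y x → P (x :: l, y :: st) (l, merge y x :: st))
    (h4 : ∀ x l y st, ¬Covers x y → ¬Covers y x → P (x :: l, y :: st) (l, x :: y :: st))
    (s : List SignedItem × List SignedItem) : P s (step s) := by
  rcases s with ⟨_ | ⟨x, l⟩, _ | ⟨y, st⟩⟩
  · simpa [step] using h0 []
  · simpa [step] using h0 _
  · simpa [step] using h1 x l
  · by_cases hxy : Covers x y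
    · simpa [step, hxy] using h2 x l y st hxy
    · by_cases hyx : Covers y x
      · simpa [step, hxy, hyx] using h3 x l y st hxy hyx
      · simpa [step, hxy, hyx] using h4 x l y st hxy hyx

/-- Absorbing a covered item does not change the content of a block. So when the top of the reduced
list absorbs an item, its relation to the next item stays the same. -/
theorem covers_merge {x y z : SignedItem} (h : Covers y x) :
    (Covers (merge y x) z ↔ Covers y z) ∧ (Covers z (merge y x) ↔ Covers z y) := by
  have h1 := h.1
  have h2 := h.2
  constructor
  · constructor
    · rintro ⟨_, h3⟩
      refine ⟨h1, fun a ha => ?_⟩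
      rcases mem_letters_merge.1 (h3 a ha) with h4 | h4
      · exact h4
      · exact h2 a h4
    · rintro ⟨_, h3⟩
      exact ⟨rfl, fun a ha => mem_letters_merge.2 (Or.inl (h3 a ha))⟩
  · constructor
    · rintro ⟨h3, h4⟩
      exact ⟨h3, fun a ha => h4 a (mem_letters_merge.2 (Or.inl ha))⟩
    · rintro ⟨h3, h4⟩
      refine ⟨h3, fun a ha => h4 a ?_⟩
      rcases mem_letters_merge.1 ha with h5 | h5
      · exact h5
      · exact h2 a h5

theorem step_invariant (s : List SignedItem × List SignedItem) :
    (∀ x ∈ s.1, WF x) ∧ Reduced s.2 → (∀ x ∈ (step s).1, WF x) ∧ Reduced (step s).2 := by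
  refine step_cases (P := fun s t => (∀ x ∈ s.1, WF x) ∧ Reduced s.2 →
    (∀ x ∈ t.1, WF x) ∧ Reduced t.2) ?_ ?_ ?_ ?_ ?_ s
  · exact fun st h => h
  · rintro x l ⟨h, _⟩
    refine ⟨fun y hy => h y (List.mem_cons_of_mem _ hy), ?_, List.isChain_singleton _⟩
    simpa using h x List.mem_cons_self
  · rintro x l y st hxy ⟨h, h1, h2⟩
    refine ⟨?_, fun z hz => h1 z (List.mem_cons_of_mem _ hz), h2.tail⟩
    intro z hz
    rcases List.mem_cons.1 hz with rfl | hz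
    · exact (h x List.mem_cons_self).merge
    · exact h z (List.mem_cons_of_mem _ hz)
  · rintro x l y st hxy hyx ⟨h, h1, h2⟩
    refine ⟨fun z hz => h z (List.mem_cons_of_mem _ hz), ?_, ?_⟩
    · intro z hz
      rcases List.mem_cons.1 hz with rfl | hz
      · exact (h1 y List.mem_cons_self).merge
      · exact h1 z (List.mem_cons_of_mem _ hz)
    · rcases st with _ | ⟨z, st⟩
      · exact List.isChain_singleton _
      · simp only [List.isChain_cons_cons] at h2 ⊢
        rw [(covers_merge hyx).1, (covers_merge hyx).2]
        exact h2
  · rintro x l y st hxy hyx ⟨h, h1, h2⟩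
    refine ⟨fun z hz => h z (List.mem_cons_of_mem _ hz), ?_, ?_⟩
    · intro z hz
      rcases List.mem_cons.1 hz with rfl | hz
      · exact h z List.mem_cons_self
      · exact h1 z hz
    · simp only [List.isChain_cons_cons]
      exact ⟨⟨hxy, hyx⟩, h2⟩

theorem step_measure (s : List SignedItem × List SignedItem) :
    2 * (step s).1.length + (step s).2.length ≤ 2 * s.1.length + s.2.length - 1 ∨ s.1 = [] := by
  refine step_cases (P := fun s t => 2 * t.1.length + t.2.length ≤
    2 * s.1.length + s.2.length - 1 ∨ s.1 = []) ?_ ?_ ?_ ?_ ?_ s <;> intros <;>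
    simp <;> omega

theorem step_value {M : Type*} [Monoid M] {K : ℕ} {g : ℕ → M} (hM : IsDAb M)
    (hK : DAbMonoid.GoodExp M K) (s : List SignedItem × List SignedItem) :
    (∀ x ∈ s.1, WF x) ∧ Reduced s.2 →
      wordVal g (listWord K ((step s).1.reverse ++ (step s).2)) =
        wordVal g (listWord K (s.1.reverse ++ s.2)) := by
  refine step_cases (P := fun s t => (∀ x ∈ s.1, WF x) ∧ Reduced s.2 →
    wordVal g (listWord K (t.1.reverse ++ t.2)) = wordVal g (listWord K (s.1.reverse ++ s.2)))
    ?_ ?_ ?_ ?_ ?_ s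
  · intros; rfl
  · intros; simp
  · rintro x l y st hxy ⟨h, h1, h2⟩
    simp [(val_merge (g := g) hM hK (h1 y List.mem_cons_self) (h x List.mem_cons_self) hxy).1,
      mul_assoc]
  · rintro x l y st hxy hyx ⟨h, h1, h2⟩
    simp [(val_merge (g := g) hM hK (h x List.mem_cons_self) (h1 y List.mem_cons_self) hyx).2,
      mul_assoc]
  · intros; simp

theorem iterate_step_invariant {l : List SignedItem} (hl : ∀ x ∈ l, WF x) (n : ℕ) :
    (∀ x ∈ (step^[n] (l.reverse, [])).1, WF x) ∧ Reduced (step^[n] (l.reverse, [])).2 := by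
  induction n with
  | zero => exact ⟨by simpa using hl, by simp [Reduced]⟩
  | succ n ih => rw [Function.iterate_succ_apply']; exact step_invariant _ ih

theorem reduced_normalize {l : List SignedItem} (hl : ∀ x ∈ l, WF x) : Reduced (normalize l) :=
  (iterate_step_invariant hl _).2

theorem iterate_step_fst (l : List SignedItem) : (step^[2 * l.length] (l.reverse, [])).1 = [] := by
  have h : ∀ n, 2 * (step^[n] (l.reverse, [])).1.length + (step^[n] (l.reverse, [])).2.length ≤
      2 * l.length - n ∨ (step^[n] (l.reverse, [])).1 = [] := by
    intro n
    induction n with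
    | zero => left; simp
    | succ n ih =>
      rw [Function.iterate_succ_apply']
      rcases step_measure (step^[n] (l.reverse, [])) with h | h
      · rcases ih with h' | h'
        · left; omega
        · right; simp [step, h']
      · right; simp [step, h]
  rcases h (2 * l.length) with h | h
  · exact List.eq_nil_of_length_eq_zero (by omega)
  · exact h

theorem wordVal_normalize {M : Type*} [Monoid M] {K : ℕ} {g : ℕ → M} (hM : IsDAb M)
    (hK : DAbMonoid.GoodExp M K) {l : List SignedItem} (hl : ∀ x ∈ l, WF x) :
    wordVal g (listWord K (normalize l)) = wordVal g (listWord K l) := by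
  have h : ∀ n, wordVal g (listWord K ((step^[n] (l.reverse, [])).1.reverse ++
      (step^[n] (l.reverse, [])).2)) = wordVal g (listWord K l) := by
    intro n
    induction n with
    | zero => simp
    | succ n ih =>
      rw [Function.iterate_succ_apply', step_value hM hK _ (iterate_step_invariant hl n), ih]
  have h1 := h (2 * l.length)
  rwa [iterate_step_fst, List.reverse_nil, List.nil_append] at h1

/-! ### Comparison of reduced lists -/

/-- Two items are of the same kind and have the same letters. -/
def SameKind (x y : SignedItem) : Prop := x.1 = y.1 ∧ ∀ a, a ∈ x.letters ↔ a ∈ y.letters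

/-- The letter `a` occurs equally often in both lists, counted with signs. -/
def Balanced (l l' : List SignedItem) (a : ℕ) : Prop :=
  (l.flatMap fun x => x.2.1).count a + (l'.flatMap fun x => x.2.2).count a =
    (l'.flatMap fun x => x.2.1).count a + (l.flatMap fun x => x.2.2).count a

/-- The first two items are blocks that contain the letter `a`. -/
def Shared (l : List SignedItem) (a : ℕ) : Prop :=
  -- The default item is `(false, [], [])`, which is not a block; hence nothing is shared at the end
  -- of a list.
  (l.headI.1 = true ∧ a ∈ l.headI.letters) ∧ l.tail.headI.1 = true ∧ a ∈ l.tail.headI.letters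

/-- The comparison of two lists of items item by item: corresponding items are of the same kind, and
at each cut the letters not shared by the neighbouring blocks are balanced. -/
def CutMatch (l l' : List SignedItem) : Prop :=
  l.length = l'.length ∧ ∀ i < l.length, SameKind (l.drop i).headI (l'.drop i).headI ∧
    ∀ a, ¬Shared (l.drop i) a → Balanced (l.drop i).tail (l'.drop i).tail a

/-- The relation on reduced lists that describes the equality of values in all monoids of
**DAb**. -/
def Matches (l l' : List SignedItem) : Prop := CutMatch l l' ∧ ∀ a, Balanced l l' a

theorem cutMatch_cons {x x' : SignedItem} {l l' : List SignedItem} :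
    CutMatch (x :: l) (x' :: l') ↔ (SameKind x x' ∧
      ∀ a, ¬Shared (x :: l) a → Balanced l l' a) ∧ CutMatch l l' := by
  constructor
  · rintro ⟨h1, h2⟩
    refine ⟨h2 0 (by simp), by simpa using h1, fun i hi => ?_⟩
    exact h2 (i + 1) (by simpa using hi)
  · rintro ⟨h1, h2, h3⟩
    refine ⟨by simpa using h2, fun i hi => ?_⟩
    rcases i with _ | i
    · exact h1
    · exact h3 i (by simpa using hi)

theorem balanced_cons {x x' : SignedItem} {l l' : List SignedItem} {a : ℕ} :
    Balanced (x :: l) (x' :: l') a ↔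
      x.2.1.count a + x'.2.2.count a + ((l.flatMap fun x => x.2.1).count a +
        (l'.flatMap fun x => x.2.2).count a) = x'.2.1.count a + x.2.2.count a +
        ((l'.flatMap fun x => x.2.1).count a + (l.flatMap fun x => x.2.2).count a) := by
  simp only [Balanced, List.flatMap_cons, List.count_append]
  omega

theorem SameKind.eq_of_letter {a : ℕ} {x' : SignedItem} (h : SameKind (false, [a], []) x')
    (hx' : WF x') : x' = (false, [a], []) := by
  rcases hx' with ⟨b, rfl⟩ | ⟨h1, _⟩
  · have := (h.2 a).1 (by simp [letters])
    simp only [letters, List.append_nil, List.mem_singleton] at this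
    rw [this]
  · have := h.1
    simp [h1] at this

/-- If the tails are balanced, then the heads have equal values and induction applies to the tails.
Otherwise the discrepancy only concerns letters shared by the first two blocks; it is moved from the
first block of `l'` to the second, after which the tails match. -/
theorem wordVal_eq_of_matches {M : Type*} [Monoid M] {K : ℕ} {g : ℕ → M} (hM : IsDAb M)
    (hK : DAbMonoid.GoodExp M K) : ∀ l l' : List SignedItem, (∀ x ∈ l, WF x) → (∀ x ∈ l', WF x) →
      Matches l l' → wordVal g (listWord K l) = wordVal g (listWord K l') := by
  intro l
  induction l with
  | nil =>
    intro l' _ _ h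
    have : l' = [] := List.eq_nil_of_length_eq_zero h.1.1.symm
    rw [this]
  | cons x l ih =>
    intro l' hl hl' h
    rcases l' with _ | ⟨x', l'⟩
    · exact absurd h.1.1 (by simp)
    obtain ⟨hcut, hbal⟩ := h
    rw [cutMatch_cons] at hcut
    obtain ⟨⟨hkind, hcut0⟩, hcut⟩ := hcut
    have hx := hl x List.mem_cons_self
    have hx' := hl' x' List.mem_cons_self
    have hl2 : ∀ x ∈ l, WF x := fun y hy => hl y (List.mem_cons_of_mem _ hy)
    have hl2' : ∀ x ∈ l', WF x := fun y hy => hl' y (List.mem_cons_of_mem _ hy)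
    rw [listWord_cons, listWord_cons, wordVal_append, wordVal_append]
    by_cases hall : ∀ a, Balanced l l' a
    · rw [ih l' hl2 hl2' ⟨hcut, hall⟩]
      congr 1
      rcases hx with ⟨a, rfl⟩ | ⟨hb, hne⟩
      · rw [hkind.eq_of_letter hx']
      · have hb' : x'.1 = true := hkind.1 ▸ hb
        have h1 := val_eq_mul_signedWord (g := g) (P := []) (Q := []) hM hK (Or.inr ⟨hb, hne⟩) hb
          hx' hb' (fun a => (hkind.2 a).symm) (by simp) (by simp) (fun a => by
            have h2 := balanced_cons.1 (hbal a)
            have h3 : _ = _ := hall a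
            simp only [List.count_nil]
            omega)
        rw [h1]
        have : signedWord K [] [] = [] := by simp [signedWord]
        rw [this, wordVal_nil, mul_one]
    · push Not at hall
      obtain ⟨a₀, ha₀⟩ := hall
      have hsh : Shared (x :: l) a₀ := by
        by_contra hcon
        exact ha₀ (hcut0 a₀ hcon)
      rcases l with _ | ⟨y, l⟩
      · exact absurd hsh.2.1 Bool.false_ne_true
      rcases l' with _ | ⟨y', l'⟩
      · exact absurd hcut.1 (by simp)
      have hxb : x.1 = true := hsh.1.1
      have hyb : y.1 = true := hsh.2.1
      have hxb' : x'.1 = true := hkind.1 ▸ hxb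
      rw [cutMatch_cons] at hcut
      obtain ⟨⟨hkind1, hcut1⟩, hcut⟩ := hcut
      have hyb' : y'.1 = true := hkind1.1 ▸ hyb
      -- The signed word `P * Q⁻¹` is the difference between `x'` and `x`, restricted to the letters
      -- of `y`. Outside these letters the tails are balanced, so `x` and `x'` already agree there.
      -- Thus `x'` equals `x` times this word, and giving the word to `y'` balances the tails
      -- completely.
      set p : ℕ → Bool := fun a => decide (a ∈ y.letters) with hp
      set P := (x'.2.1 ++ x.2.2).filter p with hP
      set Q := (x'.2.2 ++ x.2.1).filter p with hQ
      set y'' : SignedItem := (true, y'.2.1 ++ P, y'.2.2 ++ Q) with hy''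
      have hPy : ∀ a ∈ P, a ∈ y'.letters := fun a ha => (hkind1.2 a).1 (by
        simpa [hp] using (List.mem_filter.1 ha).2)
      have hQy : ∀ a ∈ Q, a ∈ y'.letters := fun a ha => (hkind1.2 a).1 (by
        simpa [hp] using (List.mem_filter.1 ha).2)
      have hPx : ∀ a ∈ P, a ∈ x.letters := fun a ha => by
        have := (List.mem_filter.1 ha).1
        rcases List.mem_append.1 this with h | h
        · exact (hkind.2 a).2 (List.mem_append_left _ h)
        · exact List.mem_append_right _ h
      have hQx : ∀ a ∈ Q, a ∈ x.letters := fun a ha => by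
        have := (List.mem_filter.1 ha).1
        rcases List.mem_append.1 this with h | h
        · exact (hkind.2 a).2 (List.mem_append_right _ h)
        · exact List.mem_append_left _ h
      have hcP : ∀ a, P.count a = if a ∈ y.letters then x'.2.1.count a + x.2.2.count a else 0 := by
        intro a
        split_ifs with h
        · rw [hP, List.count_filter (by simpa [hp] using h), List.count_append]
        · exact List.count_eq_zero.2 fun ha => h (by simpa [hp] using (List.mem_filter.1 ha).2)
      have hcQ : ∀ a, Q.count a = if a ∈ y.letters then x'.2.2.count a + x.2.1.count a else 0 := by
        intro a
        split_ifs with h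
        · rw [hQ, List.count_filter (by simpa [hp] using h), List.count_append]
        · exact List.count_eq_zero.2 fun ha => h (by simpa [hp] using (List.mem_filter.1 ha).2)
      have hns : ∀ a, a ∉ y.letters → Balanced (y :: l) (y' :: l') a := fun a ha =>
        hcut0 a fun h => ha h.2.2
      have hylet : ∀ a, a ∈ y''.letters ↔ a ∈ y'.letters := by
        intro a
        simp only [hy'', letters, List.mem_append] at hPy hQy ⊢
        grind
      have hy''wf : WF y'' := WF.merge (x := (true, P, Q)) (hl2' y' List.mem_cons_self)
      have h1 := ih (y'' :: l') hl2 (by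
        intro z hz
        rcases List.mem_cons.1 hz with rfl | hz
        · exact hy''wf
        · exact hl2' z (List.mem_cons_of_mem _ hz)) (by
        refine ⟨cutMatch_cons.2 ⟨⟨⟨hyb, fun a => (hkind1.2 a).trans (hylet a).symm⟩, hcut1⟩, hcut⟩,
          fun a => ?_⟩
        have h2 := balanced_cons.1 (hbal a)
        simp only [List.flatMap_cons, List.count_append] at h2
        rw [balanced_cons]
        simp only [hy'', List.count_append]
        rw [hcP, hcQ]
        split_ifs with h
        · omega
        · have := balanced_cons.1 (hns a h)
          omega)
      rw [h1, listWord_cons, listWord_cons, wordVal_append, wordVal_append, ← mul_assoc,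
        ← mul_assoc]
      congr 1
      rw [mul_val_signedWord hM hK (hl2' y' List.mem_cons_self) hyb' hPy hQy, ← mul_assoc]
      congr 1
      refine (val_eq_mul_signedWord hM hK hx hxb hx' hxb' (fun a => (hkind.2 a).symm) hPx hQx
        fun a => ?_).symm
      rw [hcP, hcQ]
      split_ifs with h
      · omega
      · have h2 := balanced_cons.1 (hbal a)
        have h3 : _ = _ := hns a h
        omega

end SignedItem

/-! ### The list of items of a term -/

namespace OmegaTerm

open SignedItem

variable {A : Type u} [Encodable A]

/-- The list of items of a term. -/
def items : OmegaTerm A → List SignedItem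
  | letter a => [(false, [Encodable.encode a], [])]
  | concat s t => s.items ++ t.items
  | power t => [negItem t.items]

theorem items_wf (t : OmegaTerm A) : t.items ≠ [] ∧ ∀ x ∈ t.items, WF x := by
  induction t with
  | letter a => simp [items, WF]
  | concat s t ihs iht =>
    refine ⟨by simp [items, ihs.1], fun x hx => ?_⟩
    rcases List.mem_append.1 hx with h | h
    · exact ihs.2 x h
    · exact iht.2 x h
  | power t ih => simpa [items] using wf_negItem ih.1 ih.2

theorem termVal_eq {M : Type*} [Monoid M] (hM : IsDAb M) {K : ℕ} (hK : DAbMonoid.GoodExp M K)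
    (g : ℕ → M) (t : OmegaTerm A) : t.termVal g K = wordVal g (listWord K t.items) := by
  induction t with
  | letter a => simp [termVal, items, itemWord]
  | concat s t ihs iht => rw [termVal, ihs, iht, items, listWord_append, wordVal_append]
  | power t ih =>
    rw [termVal, ih, items, listWord_cons, listWord_nil, List.append_nil,
      val_negItem hM hK t.items_wf.1 t.items_wf.2]

/-- The reduced list of items of a term. -/
noncomputable def normalForm (t : OmegaTerm A) : List SignedItem := normalize t.items

theorem reduced_normalForm (t : OmegaTerm A) : Reduced t.normalForm :=
  reduced_normalize t.items_wf.2

theorem termVal_eq_normalForm {M : Type*} [Monoid M] (hM : IsDAb M) {K : ℕ}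
    (hK : DAbMonoid.GoodExp M K) (g : ℕ → M) (t : OmegaTerm A) :
    t.termVal g K = wordVal g (listWord K t.normalForm) := by
  rw [termVal_eq hM hK, normalForm, wordVal_normalize hM hK t.items_wf.2]

end OmegaTerm

/-! ### A criterion for membership in **DAb** -/

theorem Green.D.symm {M : Type*} [Monoid M] {s t : M} (h : Green.D s t) : Green.D t s := by
  induction h with
  | refl => exact Relation.ReflTransGen.refl
  | tail _ h ih =>
    refine Relation.ReflTransGen.head ?_ ih
    rcases h with ⟨x, x', h1, h2⟩ | ⟨x, x', h1, h2⟩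
    · exact Or.inl ⟨x', x, h2.symm, h1.symm⟩
    · exact Or.inr ⟨x', x, h2.symm, h1.symm⟩

/-- A finite monoid `M` belongs to **DAb** if there is a homomorphism `π` to a commutative monoid
satisfying `x ^ (n + 1) = x` such that elements with the same image under `π` are identified by
multiplication with an idempotent of the same content. -/
theorem isDAb_of_hom {M N : Type*} [Monoid M] [CommMonoid N] [Finite M] {n : ℕ} (hn : n ≠ 0)
    (hN : ∀ x : N, x ^ (n + 1) = x) (π : M →* N)
    (H : ∀ e s t : M, e * e = e → π s = π t → π s ^ n = π e → e * s = e * t ∧ s * e = t * e) :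
    IsDAb M := by
  obtain ⟨n, rfl⟩ := Nat.exists_eq_succ_of_ne_zero hn
  simp only [Nat.succ_eq_add_one] at *
  refine ⟨inferInstance, ?_⟩
  rintro C ⟨⟨s, rfl⟩, e, hes, he⟩
  have hC : Green.DClass s = Green.DClass e := by
    ext t
    exact ⟨fun h => (Green.D.symm hes).trans h, fun h => Relation.ReflTransGen.trans hes h⟩
  rw [hC]
  have hE : π e * π e = π e := by rw [← map_mul, he]
  have hidem : ∀ k, π e ^ (k + 1) = π e := by
    intro k
    induction k with
    | zero => simp
    | succ k ih => rw [pow_succ, ih, hE]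
  have hN2 : ∀ x : N, x ^ (n + 1) * x ^ (n + 1) = x ^ (n + 1) := by
    intro x
    calc x ^ (n + 1) * x ^ (n + 1) = x ^ (n + 1 + 1) * x ^ n := by
          rw [← pow_add, ← pow_add]; congr 1; omega
      _ = x ^ (n + 1) := by rw [hN, ← pow_succ']
  -- `S v` says that the content of `v` is contained in that of `e`
  let S : M → Prop := fun v => π e * π v ^ (n + 1) = π e
  have hSmul : ∀ v w, S v → S w → S (v * w) := by
    intro v w hv hw
    change _ = _
    rw [map_mul, mul_pow, ← mul_assoc, hv, hw]
  have hSpow : ∀ v k, S v → S (v ^ k) := by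
    intro v k hv
    induction k with
    | zero => simp [S]
    | succ k ih => rw [pow_succ]; exact hSmul _ _ ih hv
  have hSe : ∀ v, S v → (π e * π v) ^ (n + 1) = π e := by
    intro v hv
    rw [mul_pow, hidem, hv]
  -- The elements `v * e * v ^ n` and `v ^ n * e * v` have the same image as `e`. So `e = v * e * v
  -- ^ n * e` and `e = e * (v ^ n * e * v)`; inserting one identity into `e * v` and then using the
  -- other moves `v` to the left.
  have hcomm : ∀ v, S v → e * v = v * e := by
    intro v hv
    have h1 : π (v * e * v ^ n) = π e := by
      rw [map_mul, map_mul, map_pow, mul_right_comm, ← pow_succ', mul_comm, hv]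
    have h2 : π (v ^ n * e * v) = π e := by
      rw [map_mul, map_mul, map_pow, mul_right_comm, ← pow_succ, mul_comm, hv]
    have h3 := (H e _ e he h1 (by rw [h1, hidem])).2
    have h4 := (H e _ e he h2 (by rw [h2, hidem])).1
    rw [he] at h3 h4
    calc e * v = v * e * v ^ n * e * v := by rw [h3]
      _ = v * (e * (v ^ n * e * v)) := by simp only [mul_assoc]
      _ = v * e := by rw [h4]
  have hpow : ∀ v, S v → e * v ^ (n + 1) = e := by
    intro v hv
    have h1 : π (e * v ^ (n + 1)) = π e := by rw [map_mul, map_pow, hv]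
    have h2 := (H e _ e he h1 (by rw [h1, hidem])).1
    rwa [← mul_assoc, he] at h2
  have hswap : ∀ v w, S v → S w → e * (v * w) = e * (w * v) := by
    intro v w hv hw
    have h1 : π (e * (v * w)) = π (e * (w * v)) := by
      simp only [map_mul]; rw [mul_comm (π v)]
    have h2 := (H e _ _ he h1 (by
      rw [map_mul, hSe _ (hSmul v w hv hw)])).1
    rwa [← mul_assoc e e (v * w), ← mul_assoc e e (w * v), he] at h2
  have hmem : ∀ t, t ∈ Green.DClass e ↔ ∃ y, S y ∧ t = e * y := by
    intro t
    constructor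
    · intro h
      induction h with
      | refl => exact ⟨1, by simp [S], by simp⟩
      | tail _ h ih =>
        obtain ⟨y, hy, rfl⟩ := ih
        -- A multiplier that can be undone cannot add content: raising the equation to the power `n
        -- + 1` exhibits the idempotent `π x ^ (n + 1)` as a factor of `π e`.
        have key : ∀ x x' : M, π (e * y) = π x' * (π x * π (e * y)) → S x := by
          intro x x' h
          have h1 : π e = π x' ^ (n + 1) * (π x ^ (n + 1) * π e) := by
            have := congrArg (· ^ (n + 1)) h
            simpa only [map_mul, mul_pow, hidem, show π e * π y ^ (n + 1) = π e from hy] using this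
          change π e * π x ^ (n + 1) = π e
          calc π e * π x ^ (n + 1)
              = π x' ^ (n + 1) * (π x ^ (n + 1) * π x ^ (n + 1) * π e) := by
                conv_lhs => rw [h1]
                ac_rfl
            _ = π e := by rw [hN2, ← h1]
        rcases h with ⟨x, x', h1, h2⟩ | ⟨x, x', h1, h2⟩
        · have hx : S x := key x x' (by rw [← map_mul, ← map_mul, h1, ← h2])
          exact ⟨x * y, hSmul x y hx hy, by rw [← h1, ← mul_assoc, ← hcomm x hx, mul_assoc]⟩
        · have hx : S x := key x x' (by
            rw [mul_comm (π x), ← map_mul, h1, mul_comm, ← map_mul, ← h2])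
          exact ⟨y * x, hSmul y x hy hx, by rw [← h1, mul_assoc]⟩
    · rintro ⟨y, hy, rfl⟩
      refine Relation.ReflTransGen.single (Or.inr ⟨y, y ^ n, rfl, ?_⟩)
      rw [mul_assoc, ← pow_succ', hpow y hy]
  have hmul : ∀ y z, S y → e * y * (e * z) = e * (y * z) := by
    intro y z hy
    rw [hcomm y hy, mul_assoc, ← mul_assoc e e, he, ← mul_assoc, ← hcomm y hy, mul_assoc]
  refine ⟨?_, ?_, e, Relation.ReflTransGen.refl, ?_, ?_⟩
  · intro a ha b hb
    obtain ⟨y, hy, rfl⟩ := (hmem a).1 ha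
    obtain ⟨z, hz, rfl⟩ := (hmem b).1 hb
    exact (hmem _).2 ⟨y * z, hSmul y z hy hz, hmul y z hy⟩
  · intro a ha b hb
    obtain ⟨y, hy, rfl⟩ := (hmem a).1 ha
    obtain ⟨z, hz, rfl⟩ := (hmem b).1 hb
    rw [hmul y z hy, hmul z y hz, hswap y z hy hz]
  · intro a ha
    obtain ⟨y, hy, rfl⟩ := (hmem a).1 ha
    rw [← mul_assoc, he]
  · intro a ha
    obtain ⟨y, hy, rfl⟩ := (hmem a).1 ha
    refine ⟨e * y ^ n, (hmem _).2 ⟨y ^ n, hSpow y n hy, rfl⟩, ?_⟩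
    rw [hmul y _ hy, ← pow_succ', hpow y hy]

/-! ### Finite monoids defined by rules -/

/-- Words with the same content and the same number of occurrences of each letter modulo `n`. -/
def SameSig (n : ℕ) (z z' : List ℕ) : Prop :=
  z.toFinset = z'.toFinset ∧ ∀ a, z.count a ≡ z'.count a [MOD n]

/-- A rule: behind `m` words of a common content, words of this content with the same signature are
identified. -/
def RightRule (m n : ℕ) (v w : FreeMonoid ℕ) : Prop :=
  ∃ (us : List (List ℕ)) (z z' : List ℕ), z ≠ [] ∧ us.length = m ∧
    (∀ u ∈ us, u.toFinset = z.toFinset) ∧ SameSig n z z' ∧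
    v = FreeMonoid.ofList (us.flatten ++ z) ∧ w = FreeMonoid.ofList (us.flatten ++ z')

/-- The mirror image of `RightRule`. -/
def LeftRule (m n : ℕ) (v w : FreeMonoid ℕ) : Prop :=
  ∃ (us : List (List ℕ)) (z z' : List ℕ), z ≠ [] ∧ us.length = m ∧
    (∀ u ∈ us, u.toFinset = z.toFinset) ∧ SameSig n z z' ∧
    v = FreeMonoid.ofList (z ++ us.flatten) ∧ w = FreeMonoid.ofList (z' ++ us.flatten)

/-- The congruence on words generated by the rules. -/
def ruleCon (m n : ℕ) : Con (FreeMonoid ℕ) := conGen fun v w => RightRule m n v w ∨ LeftRule m n v w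

theorem SameSig.refl (n : ℕ) (z : List ℕ) : SameSig n z z := ⟨rfl, fun _ => rfl⟩

theorem SameSig.symm {n : ℕ} {z z' : List ℕ} (h : SameSig n z z') : SameSig n z' z :=
  ⟨h.1.symm, fun a => (h.2 a).symm⟩

theorem SameSig.append {n : ℕ} {y y' z z' : List ℕ} (h : SameSig n y y') (h' : SameSig n z z') :
    SameSig n (y ++ z) (y' ++ z') :=
  ⟨by rw [List.toFinset_append, List.toFinset_append, h.1, h'.1], fun a => by
    rw [List.count_append, List.count_append]; exact (h.2 a).add (h'.2 a)⟩

/-- Equality of signatures as a congruence. -/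
def sigCon (n : ℕ) : Con (FreeMonoid ℕ) where
  r v w := SameSig n v.toList w.toList
  iseqv := ⟨fun _ => SameSig.refl _ _, fun h => h.symm, fun h h' =>
    ⟨h.1.trans h'.1, fun a => (h.2 a).trans (h'.2 a)⟩⟩
  mul' h h' := h.append h'

theorem ruleCon_le_sigCon (m n : ℕ) : ruleCon m n ≤ sigCon n := by
  refine Con.conGen_le.2 ?_
  rintro v w (⟨us, z, z', _, _, _, h, rfl, rfl⟩ | ⟨us, z, z', _, _, _, h, rfl, rfl⟩)
  · exact (SameSig.refl n us.flatten).append h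
  · exact h.append (SameSig.refl n us.flatten)

noncomputable instance (n : ℕ) : CommMonoid (sigCon n).Quotient :=
  { (inferInstance : Monoid (sigCon n).Quotient) with
    mul_comm := by
      intro x y
      induction x using Con.induction_on with | _ x
      induction y using Con.induction_on with | _ y
      refine (Con.eq _).2 ?_
      change SameSig n (x.toList ++ y.toList) (y.toList ++ x.toList)
      exact ⟨by rw [List.toFinset_append, List.toFinset_append, Finset.union_comm],
        fun a => by rw [List.count_append, List.count_append, add_comm]⟩ }

/-- Powers keep the content, and `(n + 1) * c` is congruent to `c` modulo `n`. -/
theorem sigQuotient_pow (n : ℕ) (x : (sigCon n).Quotient) : x ^ (n + 1) = x := by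
  induction x using Con.induction_on with | _ x
  have h : ∀ k, ((x ^ (k + 1) : FreeMonoid ℕ)).toList.toFinset = x.toList.toFinset ∧
      ∀ a, ((x ^ (k + 1) : FreeMonoid ℕ)).toList.count a = (k + 1) * x.toList.count a := by
    intro k
    induction k with
    | zero => simp
    | succ k ih =>
      rw [pow_succ, FreeMonoid.toList_mul, List.toFinset_append, ih.1, Finset.union_self]
      refine ⟨rfl, fun a => ?_⟩
      rw [List.count_append, ih.2]; ring
  refine (Con.eq _).2 ⟨(h n).1, fun a => ?_⟩
  rw [(h n).2 a, add_mul, one_mul]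
  simp [Nat.ModEq]

theorem toList_pow_eq (u : FreeMonoid ℕ) (m : ℕ) :
    (u ^ m).toList = (List.replicate m u.toList).flatten := by
  induction m with
  | zero => rfl
  | succ m ih => rw [pow_succ', FreeMonoid.toList_mul, ih, List.replicate_succ, List.flatten_cons]

theorem coe_pow_quotient (c : Con (FreeMonoid ℕ)) (u : FreeMonoid ℕ) (k : ℕ) :
    ((u ^ k : FreeMonoid ℕ) : c.Quotient) = (u : c.Quotient) ^ k := map_pow c.mk' u k

/-- An idempotent equals its `m`-th power. So it is represented by `m` consecutive copies of a word
with the content of `z`, and the rules apply literally. -/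
theorem ruleCon_absorb {m n : ℕ} (hm : m ≠ 0) (hn : n ≠ 0) (π : (ruleCon m n).Quotient →*
      (sigCon n).Quotient) (hπ : ∀ w : FreeMonoid ℕ, π (w : (ruleCon m n).Quotient) = (w : (sigCon n).Quotient))
    (e s t : (ruleCon m n).Quotient) (he : e * e = e) (hst : π s = π t) (hse : π s ^ n = π e) :
    e * s = e * t ∧ s * e = t * e := by
  induction e using Con.induction_on with | _ u
  induction s using Con.induction_on with | _ z
  induction t using Con.induction_on with | _ z'
  rw [hπ, hπ] at hst
  rw [hπ, hπ, ← coe_pow_quotient] at hse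
  have h1 : SameSig n z.toList z'.toList := (Con.eq _).1 hst
  have h2 : SameSig n (z ^ n).toList u.toList := (Con.eq _).1 hse
  have h3 : (z ^ n).toList.toFinset = z.toList.toFinset := by
    ext a
    rw [List.mem_toFinset, List.mem_toFinset, toList_pow_eq, SignedItem.mem_flatten_replicate hn]
  have h4 : ∀ k, k ≠ 0 → (u : (ruleCon m n).Quotient) ^ k = u := by
    intro k hk
    induction k with
    | zero => exact absurd rfl hk
    | succ k ih =>
      rcases eq_or_ne k 0 with rfl | h
      · simp
      · rw [pow_succ, ih h, he]
  -- The rules require `z ≠ []`; an empty word has the same content only as itself.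
  by_cases hz : z.toList = []
  · have hz' : z'.toList = [] := by
      have := h1.1
      rw [hz] at this
      simpa using this.symm
    have : z = z' := FreeMonoid.toList.injective (hz.trans hz'.symm)
    rw [this]; exact ⟨rfl, rfl⟩
  have hus : ∀ w ∈ List.replicate m u.toList, w.toFinset = z.toList.toFinset := by
    intro w hw
    rw [(List.mem_replicate.1 hw).2, ← h2.1, h3]
  rw [← h4 m hm, ← coe_pow_quotient]
  constructor
  · rw [← Con.coe_mul, ← Con.coe_mul]
    refine (Con.eq _).2 (ConGen.Rel.of _ _ (Or.inl ⟨List.replicate m u.toList, z.toList, z'.toList, hz,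
      List.length_replicate, hus, h1, ?_, ?_⟩)) <;>
    exact FreeMonoid.toList.injective (by rw [FreeMonoid.toList_mul, toList_pow_eq]; rfl)
  · rw [← Con.coe_mul, ← Con.coe_mul]
    refine (Con.eq _).2 (ConGen.Rel.of _ _ (Or.inr ⟨List.replicate m u.toList, z.toList, z'.toList, hz,
      List.length_replicate, hus, h1, ?_, ?_⟩)) <;>
    exact FreeMonoid.toList.injective (by rw [FreeMonoid.toList_mul, toList_pow_eq]; rfl)

/-- The submonoid of the words with letters less than `r`. -/
def boundedWords (m n r : ℕ) : Submonoid (ruleCon m n).Quotient where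
  carrier := {x | ∃ w : List ℕ, (∀ a ∈ w, a < r) ∧ x = ((FreeMonoid.ofList w : FreeMonoid ℕ) :
    (ruleCon m n).Quotient)}
  one_mem' := ⟨[], by simp, rfl⟩
  mul_mem' := by
    rintro _ _ ⟨v, hv, rfl⟩ ⟨w, hw, rfl⟩
    refine ⟨v ++ w, fun a ha => (List.mem_append.1 ha).elim (hv a) (hw a), rfl⟩

theorem exists_chop (N L : ℕ) (w : List ℕ) (h : N * L ≤ w.length) :
    ∃ (us : List (List ℕ)) (q : List ℕ), w = us.flatten ++ q ∧ us.length = N ∧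
      ∀ u ∈ us, u.length = L := by
  induction N generalizing w with
  | zero => exact ⟨[], w, by simp⟩
  | succ N ih =>
    rw [add_mul, one_mul] at h
    obtain ⟨us, q, h1, h2, h3⟩ := ih (w.drop L) (by rw [List.length_drop]; omega)
    refine ⟨w.take L :: us, q, ?_, by simp [h2], ?_⟩
    · rw [List.flatten_cons, List.append_assoc, ← h1, List.take_append_drop]
    · intro u hu
      rcases List.mem_cons.1 hu with rfl | hu
      · rw [List.length_take]; omega
      · exact h3 u hu

/-- A long word over a bounded number of letters has many consecutive factors of the same
content. -/
theorem exists_uniform_factors (c N : ℕ) : ∃ R : ℕ, ∀ w : List ℕ, w.toFinset.card ≤ c →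
    R ≤ w.length → ∃ (p q : List ℕ) (us : List (List ℕ)) (C : Finset ℕ),
      w = p ++ us.flatten ++ q ∧ us.length = N ∧ C.Nonempty ∧ ∀ u ∈ us, u.toFinset = C := by
  induction c with
  | zero =>
    refine ⟨1, fun w hw hl => ?_⟩
    have : w = [] := by simpa using hw
    simp [this] at hl
  | succ c ih =>
    obtain ⟨R, hR⟩ := ih
    -- Cut off `N` factors of length `R`. Either all of them have full content, or one of them
    -- misses a letter and induction applies inside it. The summand `1` makes the word, and thus the
    -- content, nonempty.
    refine ⟨N * R + 1, fun w hw hl => ?_⟩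
    obtain ⟨us, q, h1, h2, h3⟩ := exists_chop N R w (by omega)
    by_cases hall : ∀ u ∈ us, u.toFinset = w.toFinset
    · refine ⟨[], q, us, w.toFinset, by simpa using h1, h2, ?_, hall⟩
      rw [List.toFinset_nonempty_iff]
      rintro rfl
      simp at hl
    · push Not at hall
      obtain ⟨u, hu, hne⟩ := hall
      have hsub : u.toFinset ⊆ w.toFinset := by
        intro a ha
        rw [List.mem_toFinset] at ha ⊢
        rw [h1]
        exact List.mem_append_left _ (List.mem_flatten.2 ⟨u, hu, ha⟩)
      have hlt := Finset.card_lt_card (hsub.ssubset_of_ne hne)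
      obtain ⟨p', q', us', C, h4, h5, h6, h7⟩ := hR u (by omega) (h3 u hu).ge
      obtain ⟨us₁, us₂, rfl⟩ := List.append_of_mem hu
      refine ⟨us₁.flatten ++ p', q' ++ us₂.flatten ++ q, us', C, ?_, h5, h6, h7⟩
      rw [h1, List.flatten_append, List.flatten_cons, h4]
      simp only [List.append_assoc]

/-- By the pigeonhole principle some letter occurs more than `n` times. Removing `n` of its
occurrences keeps at least one, so the content survives; the order of letters is irrelevant for the
signature. -/
theorem exists_shorter {n : ℕ} (hn : n ≠ 0) {r : ℕ} {z : List ℕ} (hr : ∀ a ∈ z, a < r)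
    (hl : n * r < z.length) : ∃ z' : List ℕ, SameSig n z z' ∧ z'.length < z.length := by
  obtain ⟨a, ha, hlt⟩ : ∃ a ∈ z.toFinset, n < z.count a := by
    by_contra hcon
    push Not at hcon
    have h1 : ∑ a ∈ z.toFinset, z.count a = z.length := by
      simp
    have h2 : z.toFinset.card ≤ r := by
      simpa using Finset.card_le_card (show z.toFinset ⊆ Finset.range r from fun a ha =>
        Finset.mem_range.2 (hr a (List.mem_toFinset.1 ha)))
    have h3 := Finset.sum_le_card_nsmul _ _ n hcon
    rw [h1, smul_eq_mul, mul_comm] at h3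
    have := Nat.mul_le_mul_left n h2
    omega
  have hcount : ∀ b, (List.replicate (z.count a - n) a ++ z.filter (· ≠ a)).count b =
      if b = a then z.count a - n else z.count b := by
    intro b
    rw [List.count_append, List.count_replicate]
    by_cases hb : b = a
    · subst hb
      have : (z.filter (· ≠ b)).count b = 0 := List.count_eq_zero.2 (by simp [List.mem_filter])
      rw [if_pos rfl, this]
      simp
    · rw [if_neg hb, List.count_filter (by simpa using hb)]
      have : (a == b) = false := by simpa using Ne.symm hb
      simp [this]
  refine ⟨List.replicate (z.count a - n) a ++ z.filter (· ≠ a), ⟨?_, ?_⟩, ?_⟩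
  · ext b
    rw [List.mem_toFinset, List.mem_toFinset, ← List.count_pos_iff, ← List.count_pos_iff, hcount]
    split_ifs with h
    · subst h; omega
    · rfl
  · intro b
    rw [hcount]
    split_ifs with h
    · subst h
      exact ((Nat.modEq_iff_dvd' (Nat.sub_le _ _)).2 (by
        rw [Nat.sub_sub_self hlt.le])).symm
    · rfl
  · have h1 := List.length_eq_countP_add_countP (fun b => b == a) (l := z)
    rw [List.length_append, List.length_replicate, ← List.countP_eq_length_filter]
    have h2 : z.countP (fun b => b == a) = z.count a := rfl
    have h3 : z.countP (fun b => decide ¬((b == a) = true)) = z.countP (fun b => decide (b ≠ a)) := by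
      congr 1; ext b; simp
    omega

/-- A long word has many consecutive factors of a common content. The first `m` of them permit
rewriting the others, and `n * r + 1` nonempty factors form a word long enough to be shortened by
`exists_shorter`. So each class contains a word of length less than `R`. -/
instance finite_boundedWords (m n r : ℕ) [hn : NeZero n] : Finite (boundedWords m n r) := by
  obtain ⟨R, hR⟩ := exists_uniform_factors r (m + (n * r + 1))
  have hfin : {w : List ℕ | w.length < R ∧ ∀ a ∈ w, a < r}.Finite := by
    refine ((List.finite_length_lt (Fin r) R).image (List.map Fin.val)).subset ?_
    rintro w ⟨h1, h2⟩
    refine ⟨w.pmap (fun a h => ⟨a, h⟩) h2, by simpa using h1, ?_⟩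
    rw [List.map_pmap]; simp
  have key : ∀ k, ∀ w : List ℕ, w.length = k → (∀ a ∈ w, a < r) →
      ∃ v : List ℕ, (v.length < R ∧ ∀ a ∈ v, a < r) ∧
        ruleCon m n (FreeMonoid.ofList w) (FreeMonoid.ofList v) := by
    intro k
    induction k using Nat.strong_induction_on with
    | _ k ih =>
      rintro w rfl hw
      rcases lt_or_ge w.length R with hlt | hge
      · exact ⟨w, ⟨hlt, hw⟩, (ruleCon m n).refl _⟩
      obtain ⟨p, q, us, C, h1, h2, hC, h3⟩ := hR w (by
        simpa using Finset.card_le_card (show w.toFinset ⊆ Finset.range r from fun a ha =>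
          Finset.mem_range.2 (hw a (List.mem_toFinset.1 ha)))) hge
      have hne : ∀ u ∈ us, 1 ≤ u.length := by
        intro u hu
        rw [Nat.one_le_iff_ne_zero, Ne, List.length_eq_zero_iff]
        rintro rfl
        have := h3 _ hu
        rw [← this] at hC
        simp at hC
      obtain ⟨us₁, us₂, rfl, hl1, hl2⟩ : ∃ us₁ us₂, us = us₁ ++ us₂ ∧ us₁.length = m ∧
          us₂.length = n * r + 1 :=
        ⟨us.take m, us.drop m, (List.take_append_drop m us).symm, by
          rw [List.length_take]; omega, by rw [List.length_drop]; omega⟩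
      set z := us₂.flatten with hz
      have hzw : ∀ a ∈ z, a ∈ w := fun a ha => by
        rw [h1, List.flatten_append]; simp [← hz, ha]
      have hzl : us₂.length ≤ z.length := by
        rw [hz, List.length_flatten]
        have := List.card_nsmul_le_sum (us₂.map List.length) 1 (by
          intro x hx
          obtain ⟨u, hu, rfl⟩ := List.mem_map.1 hx
          exact hne u (List.mem_append_right _ hu))
        simpa using this
      have hzC : z.toFinset = C := by
        ext a
        rw [List.mem_toFinset, hz, List.mem_flatten]
        constructor
        · rintro ⟨u, hu, ha⟩
          rw [← h3 u (List.mem_append_right _ hu)]; exact List.mem_toFinset.2 ha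
        · intro ha
          obtain ⟨u, hu⟩ := List.exists_mem_of_length_pos (show 0 < us₂.length by omega)
          rw [← h3 u (List.mem_append_right _ hu)] at ha
          exact ⟨u, hu, List.mem_toFinset.1 ha⟩
      obtain ⟨z', hsig, hlen⟩ := exists_shorter hn.out (fun a ha => hw a (hzw a ha))
        (show n * r < z.length by omega)
      have hrule : ruleCon m n (FreeMonoid.ofList (us₁.flatten ++ z))
          (FreeMonoid.ofList (us₁.flatten ++ z')) := by
        refine ConGen.Rel.of _ _ (Or.inl ⟨us₁, z, z', ?_, hl1, fun u hu => ?_, hsig, rfl, rfl⟩)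
        · intro h; rw [h] at hlen; simp at hlen
        · rw [hzC]; exact h3 u (List.mem_append_left _ hu)
      have hw' : w = p ++ (us₁.flatten ++ z) ++ q := by
        rw [h1, List.flatten_append]
      have hrule' : ruleCon m n (FreeMonoid.ofList w)
          (FreeMonoid.ofList (p ++ (us₁.flatten ++ z') ++ q)) := by
        rw [hw']
        exact (ruleCon m n).mul ((ruleCon m n).mul ((ruleCon m n).refl (FreeMonoid.ofList p)) hrule)
          ((ruleCon m n).refl (FreeMonoid.ofList q))
      obtain ⟨v, hv, hv'⟩ := ih (p ++ (us₁.flatten ++ z') ++ q).length (by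
        rw [hw']; simp only [List.length_append]; omega) _ rfl (by
        intro a ha
        have hz' : a ∈ z' → a ∈ z := fun h => by
          rw [← List.mem_toFinset, hsig.1, List.mem_toFinset]; exact h
        apply hw
        rw [hw']
        simp only [List.mem_append] at ha ⊢
        tauto)
      exact ⟨v, hv, (ruleCon m n).trans hrule' hv'⟩
  refine Set.Finite.to_subtype ((hfin.image fun w => ((FreeMonoid.ofList w : FreeMonoid ℕ) :
    (ruleCon m n).Quotient)).subset ?_)
  rintro _ ⟨w, hw, rfl⟩
  obtain ⟨v, hv, hv'⟩ := key _ w rfl hw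
  exact ⟨v, hv, ((Con.eq _).2 hv').symm⟩

theorem isDAb_boundedWords (m n r : ℕ) [hm : NeZero m] [hn : NeZero n] :
    IsDAb (boundedWords m n r) := by
  let π : (ruleCon m n).Quotient →* (sigCon n).Quotient :=
    Con.map (ruleCon m n) (sigCon n) (ruleCon_le_sigCon m n)
  refine isDAb_of_hom hn.out (sigQuotient_pow n) (π.comp (boundedWords m n r).subtype) ?_
  intro e s t he hst hse
  have := ruleCon_absorb hm.out hn.out π (fun w => rfl) e.1 s.1 t.1 (congrArg Subtype.val he)
    hst hse
  exact ⟨Subtype.ext this.1, Subtype.ext this.2⟩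

/-! ### Segmentations of words -/

/-- The kinds of segments: a letter, the core of a block with content `B`, or the segment between the
cores of neighbouring blocks with contents `A` and `B`. -/
inductive Tag : Type
  | letter (a : ℕ)
  | core (B : Finset ℕ)
  | mid (A B : Finset ℕ)

/-- The letters of which the occurrences may be moved across the boundaries of a segment. -/
def Tag.shared : Tag → Finset ℕ
  | mid A B => A ∩ B
  | _ => ∅

/-- Words suited for a segment. -/
def Tag.Admits : Tag → List ℕ → Prop
  | letter a, w => w = [a]
  | core B, w => w.toFinset = B ∧ w ≠ []
  | mid A B, w => ∀ a ∈ w, a ∈ A ∧ a ∈ B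

/-- Tagged words. -/
abbrev Seg : Type := Tag × List ℕ

namespace Seg

/-- The condition for neighbouring segments. -/
def Adj : Seg → Seg → Prop
  | (.letter _, _), (.letter _, _) => True
  | (.letter a, _), (.core B, _) => a ∉ B
  | (.core B, _), (.letter a, _) => a ∉ B
  -- A core next to another block starts or ends with a letter foreign to that block. This fixes the
  -- boundary and makes segmentations unique. The segment between two cores is always present but
  -- may be empty.
  | (.core B, k), (.mid B₁ B₂, _) => B = B₁ ∧ ∀ a ∈ k.getLast?, a ∉ B₂
  | (.mid B₁ B₂, _), (.core B, k) => B = B₂ ∧ ∀ a ∈ k.head?, a ∉ B₁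
  | _, _ => False

/-- The valid segmentations. -/
def Valid (G : List Seg) : Prop := (∀ s ∈ G, s.1.Admits s.2) ∧ G.IsChain Adj

/-- The segmented word. -/
def flat (G : List Seg) : List ℕ := (G.map Prod.snd).flatten

@[simp] theorem flat_nil : flat [] = [] := rfl

@[simp] theorem flat_cons (s : Seg) (G : List Seg) : flat (s :: G) = s.2 ++ flat G := rfl

@[simp] theorem flat_append (G G' : List Seg) : flat (G ++ G') = flat G ++ flat G' := by
  simp [flat]

/-- The cut at position `i` does not touch a segment that shares `a`. -/
def Tight (τ : List Tag) (i a : ℕ) : Prop :=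
  (∀ t ∈ τ[i]?, a ∉ t.shared) ∧ ∀ j, j + 1 = i → ∀ t ∈ τ[j]?, a ∉ t.shared

/-- At all tight cuts the numbers of letters agree modulo `n`. -/
def Cong (n : ℕ) (τ : List Tag) (G G' : List Seg) : Prop :=
  ∀ i ≤ τ.length, ∀ a, Tight τ i a →
    (flat (G.take i)).count a ≡ (flat (G'.take i)).count a [MOD n] ∧
    (flat (G.drop i)).count a ≡ (flat (G'.drop i)).count a [MOD n]

theorem Cong.refl (n : ℕ) (τ : List Tag) (G : List Seg) : Cong n τ G G :=
  fun _ _ _ _ => ⟨rfl, rfl⟩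

theorem Cong.trans {n : ℕ} {τ : List Tag} {G G' G'' : List Seg} (h : Cong n τ G G')
    (h' : Cong n τ G' G'') : Cong n τ G G'' :=
  fun i hi a ha => ⟨(h i hi a ha).1.trans (h' i hi a ha).1, (h i hi a ha).2.trans (h' i hi a ha).2⟩

/-- Truncated subtraction sends every cut at or before the start of the replaced part to `i = 0`,
where tightness is not at hand; therefore tightness is supplied only for positive `i`. -/
theorem cong_replace {n : ℕ} {τ : List Tag} {H₁ H₂ X X' : List Seg} (hl : X.length = X'.length)
    (h : ∀ i a, (0 < i → Tight τ (H₁.length + i) a) →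
      (flat (X.take i)).count a ≡ (flat (X'.take i)).count a [MOD n] ∧
      (flat (X.drop i)).count a ≡ (flat (X'.drop i)).count a [MOD n]) :
    Cong n τ (H₁ ++ X ++ H₂) (H₁ ++ X' ++ H₂) := by
  intro i _ a ha
  have h1 := h (i - H₁.length) a (fun h0 => by
    rwa [show H₁.length + (i - H₁.length) = i by omega])
  simp only [List.take_append, List.drop_append, flat_append, List.count_append,
    List.length_append, hl]
  exact ⟨((Nat.ModEq.refl _).add h1.1).add_right _, ((Nat.ModEq.refl _).add h1.2).add_right _⟩

/-- A pigeonhole argument: if two consecutive factors do not both fit into the current segment,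
discarding the segment together with these two factors preserves the inequality. Two factors are
needed to exclude letter segments and to have a factor on each side of a position inside a core. -/
theorem exists_inner (ws : List (List ℕ)) : ∀ (us : List (List ℕ)) (p q : List ℕ),
    (∀ u ∈ us, u ≠ []) → 2 * ws.length + 1 ≤ us.length → ws.flatten = p ++ us.flatten ++ q →
    ∃ ws₁ s ws₂ us₁ u u' us₂ c₁ c₂, ws = ws₁ ++ s :: ws₂ ∧ us = us₁ ++ u :: u' :: us₂ ∧
      s = c₁ ++ u ++ u' ++ c₂ ∧ p ++ us₁.flatten = ws₁.flatten ++ c₁ ∧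
      us₂.flatten ++ q = c₂ ++ ws₂.flatten := by
  induction ws with
  | nil =>
    intro us p q hne hl h
    rcases us with _ | ⟨u, us⟩
    · simp at hl
    · have := hne u List.mem_cons_self
      simp_all
  | cons s ws ih =>
    intro us p q hne hl h
    rw [List.flatten_cons, List.append_assoc] at h
    rcases List.append_eq_append_iff.1 h with ⟨p', rfl, h'⟩ | ⟨s', rfl, h'⟩
    · obtain ⟨ws₁, t, ws₂, us₁, u, u', us₂, c₁, c₂, h1, h2, h3, h4, h5⟩ :=
        ih us p' q hne (by simp at hl; omega) (by rw [h', List.append_assoc])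
      exact ⟨s :: ws₁, t, ws₂, us₁, u, u', us₂, c₁, c₂, by rw [h1]; rfl, h2, h3,
        by rw [List.append_assoc, h4]; simp, h5⟩
    · rcases us with _ | ⟨u, _ | ⟨u', us⟩⟩
      · simp at hl
      · simp at hl
      rw [show (u :: u' :: us).flatten ++ q = (u ++ u') ++ (us.flatten ++ q) by simp] at h'
      rcases List.append_eq_append_iff.1 h' with ⟨p', rfl, h2⟩ | ⟨c₂, hc, h2⟩
      · exact ⟨[], p ++ (u ++ u' ++ p'), ws, [], u, u', us, p, p', by simp, by simp, by
          simp, by simp, h2⟩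
      · obtain ⟨ws₁, t, ws₂, us₁, v, v', us₂, c₁, c₂', h3, h4, h5, h6, h7⟩ :=
          ih us c₂ q (fun w hw => hne w (by simp [hw])) (by simp at hl; omega)
            (by rw [h2, List.append_assoc])
        refine ⟨(p ++ s') :: ws₁, t, ws₂, u :: u' :: us₁, v, v', us₂, c₁, c₂', by rw [h3]; rfl,
          by rw [h4]; rfl, h5, ?_, h7⟩
        rw [List.flatten_cons, List.flatten_cons, List.flatten_cons, ← List.append_assoc u, hc]
        simp [h6]

/-- The word `r` cannot reach into `rest`, because `rest` begins with a letter outside `D`. -/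
theorem eq_append_of_append_eq {D : ℕ → Prop} {r q m rest : List ℕ} (h : r ++ q = m ++ rest)
    (hr : ∀ a ∈ r, D a) (hrest : ∀ a ∈ rest.head?, ¬D a) :
    ∃ q₁, m = r ++ q₁ ∧ q = q₁ ++ rest := by
  rcases List.append_eq_append_iff.1 h with ⟨q₁, h1, h2⟩ | ⟨e, h1, h2⟩
  · exact ⟨q₁, h1, h2⟩
  · rcases e with _ | ⟨a, e⟩
    · exact ⟨[], by simpa using h1.symm, by simpa using h2.symm⟩
    · exact absurd (hr a (by simp [h1])) (hrest a (by simp [h2]))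

theorem exists_last_not {D : ℕ → Prop} {t : List ℕ} (h : ∃ a ∈ t, ¬D a) :
    ∃ k a y, t = k ++ [a] ++ y ∧ ¬D a ∧ ∀ b ∈ y, D b := by
  induction t using List.reverseRecOn with
  | nil => simp at h
  | append_singleton t b ih =>
    by_cases hb : D b
    · obtain ⟨k, a, y, h1, h2, h3⟩ := ih (by
        obtain ⟨a, ha, hD⟩ := h
        rcases List.mem_append.1 ha with h | h
        · exact ⟨a, h, hD⟩
        · rw [List.mem_singleton.1 h] at hD
          exact absurd hb hD)
      refine ⟨k, a, y ++ [b], by rw [h1]; simp, h2, fun c hc => ?_⟩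
      rcases List.mem_append.1 hc with h | h
      · exact h3 c h
      · rw [List.mem_singleton.1 h]; exact hb
    · exact ⟨t, b, [], by simp, hb, by simp⟩

/-- Both decompositions cut directly behind the last letter outside `D`. -/
theorem eq_of_append_eq_last {D : ℕ → Prop} {k y k₂ y₂ : List ℕ} {a : ℕ}
    (h : k ++ y = k₂ ++ [a] ++ y₂) (ha : ¬D a) (hy : ∀ b ∈ y, D b) (hy₂ : ∀ b ∈ y₂, D b)
    (hk : ∀ b ∈ k.getLast?, ¬D b) : k = k₂ ++ [a] := by
  rcases List.append_eq_append_iff.1 h with ⟨e, h1, h2⟩ | ⟨e, h1, h2⟩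
  · rcases List.eq_nil_or_concat e with rfl | ⟨e, b, rfl⟩
    · simpa using h1.symm
    · have : a = b := by
        have := congrArg List.getLast? h1
        simpa using this
      subst this
      exact absurd (hy a (by simp [h2])) ha
  · rcases List.eq_nil_or_concat e with rfl | ⟨e, b, rfl⟩
    · simpa using h1
    · refine absurd (hy₂ b (by simp [h2])) (hk b ?_)
      rw [h1, List.concat_eq_append, ← List.append_assoc, List.getLast?_concat]
      rfl

theorem Adj.core_congr {k k' : List ℕ} {B : Finset ℕ} {s : Seg} (hh : k.head? = k'.head?)
    (h : Adj s (.core B, k)) : Adj s (.core B, k') := by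
  rcases s with ⟨_ | _ | _, w⟩ <;> simp only [Adj] at h ⊢
  · exact h
  · exact ⟨h.1, hh ▸ h.2⟩

theorem Adj.mid_congr {k k' : List ℕ} {A B : Finset ℕ} {s : Seg}
    (h : Adj s (.mid A B, k)) : Adj s (.mid A B, k') := by
  rcases s with ⟨_ | _ | _, w⟩ <;> simp only [Adj] at h ⊢
  exact h

theorem Valid.replace {H₁ T T' : List Seg} {s s' : Seg} (h : Valid (H₁ ++ s :: T))
    (h' : Valid (s' :: T')) (hs : ∀ x, Adj x s → Adj x s') : Valid (H₁ ++ s' :: T') := by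
  obtain ⟨h1, h2⟩ := h
  rw [List.isChain_append] at h2
  refine ⟨fun x hx => ?_, ?_⟩
  · rcases List.mem_append.1 hx with h | h
    · exact h1 x (List.mem_append_left _ h)
    · exact h'.1 x h
  · rw [List.isChain_append]
    refine ⟨h2.1, h'.2, fun x hx y hy => ?_⟩
    simp only [List.head?_cons, Option.mem_some_iff] at hy
    subst hy
    exact hs x (h2.2.2 x hx s (by simp))

theorem Valid.of_append {H₁ T : List Seg} (h : Valid (H₁ ++ T)) : Valid T :=
  ⟨fun x hx => h.1 x (List.mem_append_right _ hx), (List.isChain_append.1 h.2).2.1⟩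

theorem Valid.tail {s : Seg} {T : List Seg} (h : Valid (s :: T)) : Valid T :=
  Valid.of_append (H₁ := [s]) h

theorem valid_cons {s : Seg} {T : List Seg} :
    Valid (s :: T) ↔ s.1.Admits s.2 ∧ (∀ y ∈ T.head?, Adj s y) ∧ Valid T := by
  rw [Valid, Valid, List.isChain_cons, List.forall_mem_cons]
  tauto

/-- With `head?_mid`, this bounds the reach of a rewriting: a factor over the content of the current
block cannot spill over into the next letter or the next core. -/
theorem head?_core {G : List Seg} (hG : Valid G) {B : Finset ℕ} {k : List ℕ}
    (h : ∀ s ∈ G.head?, Adj (.core B, k) s) (hnm : ∀ s ∈ G.head?, ∀ A A', s.1 ≠ .mid A A') :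
    ∀ a ∈ (flat G).head?, a ∉ B := by
  rcases G with _ | ⟨⟨t, w⟩, G⟩
  · simp
  · have h1 := h _ rfl
    have h2 := hnm _ rfl
    rcases t with b | C | ⟨C, C'⟩
    · have h3 : w = [b] := hG.1 _ List.mem_cons_self
      subst h3
      simpa using (show b ∉ B from h1)
    · exact absurd h1 (by simp [Adj])
    · exact absurd rfl (h2 C C')

theorem head?_mid {G : List Seg} (hG : Valid G) {A B : Finset ℕ} {k : List ℕ}
    (h : ∀ s ∈ G.head?, Adj (.mid A B, k) s) :
    ∀ a ∈ (flat G).head?, a ∉ A := by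
  rcases G with _ | ⟨⟨t, w⟩, G⟩
  · simp
  · have h1 := h _ rfl
    rcases t with b | C | ⟨C, C'⟩
    · exact absurd h1 (by simp [Adj])
    · have h3 : w.toFinset = C ∧ w ≠ [] := hG.1 _ List.mem_cons_self
      obtain ⟨b, w, rfl⟩ := List.exists_cons_of_ne_nil h3.2
      simpa using h1.2
    · exact absurd h1 (by simp [Adj])

theorem mem_of_sameSig {n : ℕ} {z z' : List ℕ} (h : SameSig n z z') (a : ℕ) : a ∈ z' ↔ a ∈ z := by
  rw [← List.mem_toFinset, ← h.1, List.mem_toFinset]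

/-- The rewritten part may straddle the boundary between the core `s` and the segment `y` behind it,
so the boundary is placed anew behind the last letter outside `B₂`. This letter is in `q₁`, or else
in `z'`, as `z` and `z'` have equal content. The factor `u` remains inside the core and preserves
its content and first letter. -/
theorem exists_core_replace {z z' s y c₁ u u' c₂ r q₁ : List ℕ} {B₂ : Finset ℕ}
    (hzz : ∀ a, a ∈ z' ↔ a ∈ z) (hune : u ≠ []) (hune' : u' ≠ []) (hu : ∀ a, a ∈ u ↔ a ∈ z)
    (hu' : ∀ a, a ∈ u' ↔ a ∈ z) (hrz : ∀ a ∈ r, a ∈ z) (h3 : s = c₁ ++ u ++ u' ++ c₂)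
    (hq₁ : c₂ ++ y = r ++ z ++ q₁) (hy : ∀ a ∈ y, a ∈ B₂) (hlast : ∀ a ∈ s.getLast?, a ∉ B₂) :
    ∃ k' y', k' ++ y' = c₁ ++ u ++ u' ++ (r ++ z' ++ q₁) ∧ (∀ a ∈ y', a ∈ B₂) ∧
      (∀ a ∈ k'.getLast?, a ∉ B₂) ∧ (∀ a, a ∈ k' ↔ a ∈ s) ∧ s.head? = k'.head? := by
  have hsy : s ++ y = c₁ ++ u ++ u' ++ (r ++ z ++ q₁) := by
    rw [h3, List.append_assoc _ c₂, hq₁]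
  have hhead : ∀ v v', (c₁ ++ u ++ u' ++ v).head? = (c₁ ++ u ++ u' ++ v').head? := by
    intro v v'
    obtain ⟨b, u, rfl⟩ := List.exists_cons_of_ne_nil hune
    rcases c₁ with _ | ⟨c, c₁⟩ <;> simp
  by_cases hD : ∃ a ∈ q₁, a ∉ B₂
  · obtain ⟨q₂, a, y₂, rfl, ha, hy₂⟩ := exists_last_not (D := (· ∈ B₂)) hD
    have hs := eq_of_append_eq_last (D := (· ∈ B₂)) (y₂ := y₂) (a := a)
      (k₂ := c₁ ++ u ++ u' ++ (r ++ z ++ q₂)) (hsy.trans (by simp)) ha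
      (fun b hb => hy b hb) hy₂ hlast
    refine ⟨c₁ ++ u ++ u' ++ (r ++ z' ++ q₂ ++ [a]), y₂, by simp, hy₂, ?_, ?_, ?_⟩
    · intro b hb
      rw [← List.append_assoc] at hb
      simp only [List.getLast?_concat, Option.mem_some_iff] at hb
      rwa [← hb]
    · intro b
      rw [hs]
      simp only [List.mem_append, hzz, or_assoc]
    · rw [hs, List.append_assoc _ _ [a]]; exact hhead _ _
  · push Not at hD
    by_cases hE : ∃ a ∈ z, a ∉ B₂
    · obtain ⟨z₂, a, y₂, hz₂, ha, hy₂⟩ := exists_last_not (D := (· ∈ B₂)) hE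
      obtain ⟨z₂', a', y₂', hz₂', ha', hy₂'⟩ := exists_last_not (D := (· ∈ B₂))
        (t := z') (by obtain ⟨a, ha, h⟩ := hE; exact ⟨a, (hzz a).2 ha, h⟩)
      have hs := eq_of_append_eq_last (D := (· ∈ B₂)) (y₂ := y₂ ++ q₁) (a := a)
        (k₂ := c₁ ++ u ++ u' ++ (r ++ z₂)) (hsy.trans (by rw [hz₂]; simp)) ha
        (fun b hb => hy b hb)
        (fun b hb => (List.mem_append.1 hb).elim (hy₂ b) (hD b)) hlast
      refine ⟨c₁ ++ u ++ u' ++ (r ++ z₂' ++ [a']), y₂' ++ q₁, by rw [hz₂']; simp,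
        fun b hb => (List.mem_append.1 hb).elim (hy₂' b) (hD b), ?_, ?_, ?_⟩
      · intro b hb
        rw [← List.append_assoc] at hb
        simp only [List.getLast?_concat, Option.mem_some_iff] at hb
        rwa [← hb]
      · intro b
        have e1 : b ∈ z₂ ∨ b = a → b ∈ u := fun h => (hu b).2 (by
          rw [hz₂]; simp only [List.mem_append, List.mem_singleton]; tauto)
        have e2 : b ∈ z₂' ∨ b = a' → b ∈ u := fun h => (hu b).2 ((hzz b).1 (by
          rw [hz₂']; simp only [List.mem_append, List.mem_singleton]; tauto))
        rw [hs]
        simp only [List.mem_append, List.mem_singleton]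
        tauto
      · rw [hs, List.append_assoc _ _ [a]]; exact hhead _ _
    -- If neither `z` nor `q₁` had a letter outside `B₂`, then neither would `u'` and `c₂`; but `s`
    -- ends with `u' ++ c₂`, and its last letter lies outside `B₂`.
    · push Not at hE
      exfalso
      have hc₂ : ∀ a ∈ c₂, a ∈ B₂ := by
        intro a ha
        have : a ∈ r ++ z ++ q₁ := by rw [← hq₁]; exact List.mem_append_left _ ha
        rcases List.mem_append.1 this with h | h
        · exact (List.mem_append.1 h).elim (fun h => hE a (hrz a h)) (hE a)
        · exact hD a h
      have hne : u' ++ c₂ ≠ [] := by simp [hune']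
      have hl := List.getLast?_eq_some_getLast hne
      refine hlast ((u' ++ c₂).getLast hne) ?_ ?_
      · rw [h3, List.append_assoc _ u', List.getLast?_append, hl]; rfl
      · rcases List.mem_append.1 (List.getLast_mem hne) with h | h
        · exact hE _ ((hu' _).1 h)
        · exact hc₂ _ h

/-- The right rules preserve segmentations. -/
theorem exists_of_rightRule {n : ℕ} {τ : List Tag} {G : List Seg} (hG : Valid G)
    (hτ : G.map Prod.fst = τ) {us : List (List ℕ)} {z z' p q : List ℕ} (hz : z ≠ [])
    (hus : ∀ u ∈ us, u.toFinset = z.toFinset) (hsig : SameSig n z z')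
    (hlen : 2 * τ.length + 1 ≤ us.length) (hflat : flat G = p ++ (us.flatten ++ z) ++ q) :
    ∃ G', Valid G' ∧ G'.map Prod.fst = τ ∧ flat G' = p ++ (us.flatten ++ z') ++ q ∧
      Cong n τ G G' := by
  have hmem : ∀ u ∈ us, ∀ a, a ∈ u ↔ a ∈ z := fun u hu a => by
    rw [← List.mem_toFinset, hus u hu, List.mem_toFinset]
  have hzz : ∀ a, a ∈ z' ↔ a ∈ z := mem_of_sameSig hsig
  -- Some segment contains two consecutive factors, hence all letters of `z`; what follows up to the
  -- end of `z` is a word over the content of this segment.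
  obtain ⟨ws₁, s₀, ws₂, us₁, u, u', us₂, c₁, c₂, h1, h2, h3, h4, h5⟩ :=
    exists_inner (G.map Prod.snd) us p (z ++ q) (by
      rintro u hu rfl
      have := hus _ hu
      simp only [List.toFinset_nil] at this
      exact hz (by simpa using this.symm)) (by
      rw [List.length_map]; rw [← hτ, List.length_map] at hlen; exact hlen) (by
      change flat G = _
      rw [hflat]; simp)
  obtain ⟨G₁, G', rfl, hG₁, hG'⟩ := List.map_eq_append_iff.1 h1
  obtain ⟨⟨t, s⟩, G₂, rfl, hw, hG₂⟩ := List.map_eq_cons_iff.1 hG'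
  dsimp only at hw
  subst hw
  have hu : u ∈ us := by simp [h2]
  have hu' : u' ∈ us := by simp [h2]
  have hune : u ≠ [] := by
    rintro rfl
    have := hus _ hu
    simp only [List.toFinset_nil] at this
    exact hz (by simpa using this.symm)
  have hune' : u' ≠ [] := by
    rintro rfl
    have := hus _ hu'
    simp only [List.toFinset_nil] at this
    exact hz (by simpa using this.symm)
  set r := us₂.flatten with hr
  have hrz : ∀ a ∈ r, a ∈ z := by
    intro a ha
    obtain ⟨v, hv, hav⟩ := List.mem_flatten.1 ha
    exact (hmem v (by simp [h2, hv]) a).1 hav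
  have hflat₁ : p ++ us₁.flatten = flat G₁ ++ c₁ := by rw [h4, ← hG₁]; rfl
  have hrest : r ++ z ++ q = c₂ ++ flat G₂ := by rw [List.append_assoc, h5, ← hG₂]; rfl
  have hgoal : p ++ (us.flatten ++ z') ++ q = flat G₁ ++ (c₁ ++ u ++ u' ++ (r ++ z' ++ q)) := by
    rw [h2, List.flatten_append, List.flatten_cons, List.flatten_cons]
    calc _ = (p ++ us₁.flatten) ++ (u ++ u' ++ (r ++ z' ++ q)) := by simp [hr]
      _ = _ := by rw [hflat₁]; simp
  have hV := hG.of_append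
  have hadj : ∀ y ∈ G₂.head?, Adj (t, s) y := (List.isChain_cons.1 hV.2).1
  have hcount : ∀ c d : List ℕ, ∀ a,
      (c ++ z ++ d).count a ≡ (c ++ z' ++ d).count a [MOD n] := fun c d a => by
    simp only [List.count_append]
    exact ((Nat.ModEq.refl _).add (hsig.2 a)).add_right _
  rcases t with b | B | ⟨A, B⟩
  · -- a letter is too short
    have h6 : s = [b] := hV.1 _ List.mem_cons_self
    have h7 := congrArg List.length (h3.symm.trans h6)
    have h8 := List.length_pos_iff.2 hune
    have h9 := List.length_pos_iff.2 hune'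
    simp at h7
    omega
  · have hsB : s.toFinset = B ∧ s ≠ [] := hV.1 _ List.mem_cons_self
    have hmB : ∀ a, a ∈ B ↔ a ∈ s := fun a => by rw [← hsB.1, List.mem_toFinset]
    have hzB : ∀ a ∈ z, a ∈ B := fun a ha => (hmB a).2 (by
      rw [h3]; simp [(hmem u hu a).2 ha])
    by_cases hmid : ∃ A' B₂ y G₃, G₂ = (Tag.mid A' B₂, y) :: G₃
    · obtain ⟨A', B₂, y, G₃, rfl⟩ := hmid
      have hA := hadj _ rfl
      obtain ⟨rfl, hlast⟩ : B = A' ∧ ∀ a ∈ s.getLast?, a ∉ B₂ := hA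
      have hy : ∀ a ∈ y, a ∈ B ∧ a ∈ B₂ := hV.tail.1 _ List.mem_cons_self
      have hadj₃ : ∀ x ∈ G₃.head?, Adj (.mid B B₂, y) x := (List.isChain_cons.1 hV.tail.2).1
      rw [flat_cons, ← List.append_assoc] at hrest
      obtain ⟨q₁, hq₁, rfl⟩ := eq_append_of_append_eq (D := (· ∈ B)) hrest
        (fun a ha => (List.mem_append.1 ha).elim (fun h => hzB a (hrz a h)) (hzB a))
        (head?_mid hV.tail.tail hadj₃)
      have hq₁B : ∀ a ∈ q₁, a ∈ B := fun a ha => by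
        have : a ∈ c₂ ++ y := by rw [hq₁]; exact List.mem_append_right _ ha
        rcases List.mem_append.1 this with h | h
        · rw [hmB, h3]; simp [h]
        · exact (hy a h).1
      obtain ⟨k', y', hky, hy', hk', hkB, hkh⟩ : ∃ k' y',
          k' ++ y' = c₁ ++ u ++ u' ++ (r ++ z' ++ q₁) ∧ (∀ a ∈ y', a ∈ B₂) ∧
          (∀ a ∈ k'.getLast?, a ∉ B₂) ∧ (∀ a, a ∈ k' ↔ a ∈ s) ∧ s.head? = k'.head? :=
        exists_core_replace hzz hune hune' (hmem u hu) (hmem u' hu') hrz h3 hq₁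
          (fun a ha => (hy a ha).2) hlast
      have hyB : ∀ a ∈ y', a ∈ B := by
        intro a ha
        have h6 : a ∈ c₁ ++ u ++ u' ++ (r ++ z' ++ q₁) := by
          rw [← hky]; exact List.mem_append_right _ ha
        have h7 : a ∈ c₁ ++ u ++ u' → a ∈ B := fun h => by
          rw [hmB, h3]; exact List.mem_append_left _ h
        rcases List.mem_append.1 h6 with h | h
        · exact h7 h
        · rcases List.mem_append.1 h with h | h
          · rcases List.mem_append.1 h with h | h
            · exact hzB a (hrz a h)
            · exact hzB a ((hzz a).1 h)
          · exact hq₁B a h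
      refine ⟨G₁ ++ (.core B, k') :: (.mid B B₂, y') :: G₃, ?_, ?_, ?_, ?_⟩
      · refine hG.replace (valid_cons.2 ⟨⟨?_, ?_⟩, ?_, valid_cons.2 ⟨?_, ?_, hV.tail.tail⟩⟩)
          fun x hx => hx.core_congr hkh
        · ext a; rw [List.mem_toFinset, hkB, hmB]
        · rintro rfl
          rw [List.head?_nil, List.head?_eq_none_iff] at hkh
          exact hsB.2 hkh
        · rintro _ ⟨⟩
          exact ⟨rfl, hk'⟩
        · exact fun a ha => ⟨hyB a ha, hy' a ha⟩
        · intro x hx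
          have := hadj₃ x hx
          rcases x with ⟨_ | _ | _, w⟩ <;> exact this
      · rw [← hτ]; simp
      · rw [hgoal]
        simp only [flat_append, flat_cons]
        rw [← List.append_assoc k', hky]
        simp
      · have h8 := cong_replace (n := n) (τ := τ) (H₁ := G₁) (H₂ := G₃)
          (X := [(.core B, s), (.mid B B₂, y)]) (X' := [(.core B, k'), (.mid B B₂, y')]) rfl ?_
        · simpa using h8
        · have htot : ∀ a, (s ++ y).count a ≡ (k' ++ y').count a [MOD n] := by
            intro a
            rw [hky, h3, List.append_assoc _ c₂, hq₁]
            have := hcount (c₁ ++ u ++ u' ++ r) q₁ a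
            simpa only [List.append_assoc] using this
          intro i a hi
          rcases i with _ | _ | i
          · exact ⟨by simp [Nat.ModEq.refl], by simpa using htot a⟩
          -- The boundary between core and movable letters may have shifted, but a letter for which
          -- this cut is tight does not occur among the movable letters.
          · have hta := (hi (by simp)).1 (.mid B B₂) (by rw [← hτ]; simp)
            simp only [Tag.shared, Finset.mem_inter, not_and] at hta
            have e1 : y.count a = 0 := List.count_eq_zero.2 fun h => hta (hy a h).1 (hy a h).2
            have e2 : y'.count a = 0 := List.count_eq_zero.2 fun h => hta (hyB a h) (hy' a h)
            have := htot a
            rw [List.count_append, List.count_append, e1, e2] at this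
            exact ⟨by simpa using this, by simp [e1, e2, Nat.ModEq.refl]⟩
          · exact ⟨by simpa using htot a, by simp [Nat.ModEq.refl]⟩
    · have hnm : ∀ x ∈ G₂.head?, ∀ A A', x.1 ≠ .mid A A' := by
        rintro ⟨t, w⟩ hs A A' rfl
        rcases G₂ with _ | ⟨x, G₂⟩
        · simp at hs
        · simp only [List.head?_cons, Option.mem_some_iff] at hs
          exact hmid ⟨A, A', w, G₂, by rw [hs]⟩
      obtain ⟨q₁, hq₁, rfl⟩ := eq_append_of_append_eq (D := (· ∈ B)) hrest
        (fun a ha => (List.mem_append.1 ha).elim (fun h => hzB a (hrz a h)) (hzB a))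
        (head?_core hV.tail hadj hnm)
      refine ⟨G₁ ++ (.core B, c₁ ++ u ++ u' ++ (r ++ z' ++ q₁)) :: G₂, ?_, ?_, ?_, ?_⟩
      · refine hG.replace (valid_cons.2 ⟨⟨?_, ?_⟩, ?_, hV.tail⟩) fun x hx => hx.core_congr ?_
        · ext a
          rw [List.mem_toFinset, hmB, h3, hq₁]
          simp only [List.mem_append, hzz]
        · simp [hune]
        · rintro ⟨t, w⟩ hx
          have h6 := hadj _ hx
          have h7 := hnm _ hx
          rcases t with b | C | ⟨C, C'⟩
          · exact h6
          · exact h6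
          · exact absurd rfl (h7 C C')
        · rw [h3]
          obtain ⟨b, u, rfl⟩ := List.exists_cons_of_ne_nil hune
          rcases c₁ with _ | ⟨c, c₁⟩ <;> simp
      · rw [← hτ]; simp
      · rw [hgoal]; simp
      · have h8 := cong_replace (n := n) (τ := τ) (H₁ := G₁) (H₂ := G₂)
          (X := [(.core B, s)]) (X' := [(.core B, c₁ ++ u ++ u' ++ (r ++ z' ++ q₁))]) rfl ?_
        · simpa using h8
        · intro i a _
          have := hcount (c₁ ++ u ++ u' ++ r) q₁ a
          rcases i with _ | i
          · exact ⟨by simp [Nat.ModEq.refl], by simpa [h3, hq₁] using this⟩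
          · exact ⟨by simpa [h3, hq₁] using this, by simp [Nat.ModEq.refl]⟩
  · have hs : ∀ a ∈ s, a ∈ A ∧ a ∈ B := hV.1 _ List.mem_cons_self
    have hzA : ∀ a ∈ z, a ∈ A ∧ a ∈ B := fun a ha => hs a (by
      rw [h3]; simp [(hmem u hu a).2 ha])
    obtain ⟨q₁, hq₁, rfl⟩ := eq_append_of_append_eq (D := (· ∈ A)) hrest
      (fun a ha => (List.mem_append.1 ha).elim (fun h => (hzA a (hrz a h)).1)
        (fun h => (hzA a h).1)) (head?_mid hV.tail hadj)
    refine ⟨G₁ ++ (.mid A B, c₁ ++ u ++ u' ++ (r ++ z' ++ q₁)) :: G₂, ?_, ?_, ?_, ?_⟩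
    · refine hG.replace (valid_cons.2 ⟨?_, ?_, hV.tail⟩) fun x hx => hx.mid_congr
      · intro a ha
        apply hs
        rw [h3, hq₁]
        simpa only [List.mem_append, hzz] using ha
      · rintro ⟨t, w⟩ hx
        have h6 := hadj _ hx
        rcases t with b | C | ⟨C, C'⟩ <;> exact h6
    · rw [← hτ]; simp
    · rw [hgoal]; simp
    · have h8 := cong_replace (n := n) (τ := τ) (H₁ := G₁) (H₂ := G₂)
        (X := [(.mid A B, s)]) (X' := [(.mid A B, c₁ ++ u ++ u' ++ (r ++ z' ++ q₁))]) rfl ?_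
      · simpa using h8
      · intro i a _
        have := hcount (c₁ ++ u ++ u' ++ r) q₁ a
        rcases i with _ | i
        · exact ⟨by simp [Nat.ModEq.refl], by simpa [h3, hq₁] using this⟩
        · exact ⟨by simpa [h3, hq₁] using this, by simp [Nat.ModEq.refl]⟩

end Seg

/-! ### Mirror images, invariance under the congruence, and uniqueness of segmentations. -/

/-- The kind of the mirror image of a segment. -/
def Tag.rev : Tag → Tag
  | mid A B => mid B A
  | t => t

namespace Seg

/-- The mirror image of a segment. -/
def rev (s : Seg) : Seg := (s.1.rev, s.2.reverse)

/-- The mirror image of a segmentation. -/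
def revList (G : List Seg) : List Seg := (G.map rev).reverse

theorem flat_revList (G : List Seg) : flat (revList G) = (flat G).reverse := by
  induction G with
  | nil => rfl
  | cons s G ih =>
    have : revList (s :: G) = revList G ++ [s.rev] := by simp [revList]
    rw [this, flat_append, ih]
    simp [rev]

theorem adj_rev {s t : Seg} : Adj t.rev s.rev ↔ Adj s t := by
  rcases s with ⟨_ | _ | _, v⟩ <;> rcases t with ⟨_ | _ | _, w⟩ <;> simp [rev, Tag.rev, Adj]

theorem Valid.revList {G : List Seg} (h : Valid G) : Valid (revList G) := by
  refine ⟨fun s hs => ?_, ?_⟩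
  · simp only [Seg.revList, List.mem_reverse, List.mem_map] at hs
    obtain ⟨⟨t, w⟩, ht, rfl⟩ := hs
    have := h.1 _ ht
    rcases t with _ | _ | _ <;> simp_all [rev, Tag.rev, Tag.Admits]
  · rw [Seg.revList, List.isChain_reverse, List.isChain_map]
    simpa only [adj_rev] using h.2

theorem take_revList (G : List Seg) (i : ℕ) :
    (revList G).take i = revList (G.drop (G.length - i)) := by
  simp [revList, List.take_reverse, List.map_drop]

theorem drop_revList (G : List Seg) (i : ℕ) :
    (revList G).drop i = revList (G.take (G.length - i)) := by
  simp [revList, List.drop_reverse, List.map_take]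

theorem shared_rev (t : Tag) : t.rev.shared = t.shared := by
  rcases t with _ | _ | ⟨A, B⟩ <;> simp [Tag.rev, Tag.shared, Finset.inter_comm]

theorem Tight.rev {τ : List Tag} {i a : ℕ} (hi : i ≤ τ.length) (h : Tight τ i a) :
    Tight (τ.map Tag.rev).reverse (τ.length - i) a := by
  constructor
  · intro t ht
    rcases i with _ | i
    · rw [List.getElem?_eq_none (by simp)] at ht; simp at ht
    · rw [List.getElem?_reverse (by rw [List.length_map]; omega), List.length_map,
        List.getElem?_map] at ht
      obtain ⟨t, ht', rfl⟩ := Option.map_eq_some_iff.1 ht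
      rw [shared_rev]
      exact h.2 i rfl t (by rw [Option.mem_def, ← ht']; congr 1; omega)
  · intro j hj t ht
    rw [List.getElem?_reverse (by rw [List.length_map]; omega), List.length_map,
        List.getElem?_map, show τ.length - 1 - j = i by omega] at ht
    obtain ⟨t, ht', rfl⟩ := Option.map_eq_some_iff.1 ht
    rw [shared_rev]
    exact h.1 t ht'

theorem map_fst_revList (G : List Seg) :
    (revList G).map Prod.fst = ((G.map Prod.fst).map Tag.rev).reverse := by
  simp [revList, rev, Function.comp_def]

/-- Reversal exchanges the parts before and behind a cut, which is why `Cong` records both. -/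
theorem Cong.revList {n : ℕ} {τ : List Tag} {G G' : List Seg} (hG : G.length = τ.length)
    (hG' : G'.length = τ.length) (h : Cong n (τ.map Tag.rev).reverse (revList G) G') :
    Cong n τ G (revList G') := by
  intro i hi a ha
  have h1 := h (τ.length - i) (by simp) a (ha.rev hi)
  rw [take_revList, drop_revList, flat_revList, flat_revList, List.count_reverse,
    List.count_reverse, hG, Nat.sub_sub_self hi] at h1
  rw [take_revList, drop_revList, flat_revList, flat_revList, List.count_reverse,
    List.count_reverse, hG']
  exact ⟨h1.2, h1.1⟩

/-- The left rules preserve segmentations. -/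
theorem exists_of_leftRule {n : ℕ} {τ : List Tag} {G : List Seg} (hG : Valid G)
    (hτ : G.map Prod.fst = τ) {us : List (List ℕ)} {z z' p q : List ℕ} (hz : z ≠ [])
    (hus : ∀ u ∈ us, u.toFinset = z.toFinset) (hsig : SameSig n z z')
    (hlen : 2 * τ.length + 1 ≤ us.length) (hflat : flat G = p ++ (z ++ us.flatten) ++ q) :
    ∃ G', Valid G' ∧ G'.map Prod.fst = τ ∧ flat G' = p ++ (z' ++ us.flatten) ++ q ∧
      Cong n τ G G' := by
  have hsig' : SameSig n z.reverse z'.reverse := by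
    refine ⟨by rw [List.toFinset_reverse, List.toFinset_reverse, hsig.1], fun a => ?_⟩
    rw [List.count_reverse, List.count_reverse]; exact hsig.2 a
  have hrev : ∀ us : List (List ℕ), us.flatten.reverse = (us.map List.reverse).reverse.flatten := by
    intro us
    rw [List.reverse_flatten]
  obtain ⟨G', h1, h2, h3, h4⟩ := exists_of_rightRule (n := n) hG.revList (map_fst_revList G)
    (us := (us.map List.reverse).reverse) (z := z.reverse) (z' := z'.reverse) (p := q.reverse)
    (q := p.reverse) (by simpa using hz) (by
      intro u hu
      simp only [List.mem_reverse, List.mem_map] at hu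
      obtain ⟨u, hu, rfl⟩ := hu
      rw [List.toFinset_reverse, List.toFinset_reverse, hus u hu]) hsig'
    (by rw [hτ]; simpa using hlen)
    (by rw [flat_revList, hflat, ← hrev]; simp)
  rw [hτ] at h2 h4
  refine ⟨revList G', h1.revList, ?_, ?_, ?_⟩
  · rw [map_fst_revList, h2]
    have : ∀ t : Tag, t.rev.rev = t := fun t => by rcases t with _ | _ | _ <;> rfl
    simp [Function.comp_def, this]
  · rw [flat_revList, h3, ← hrev]; simp
  · refine Cong.revList ?_ ?_ h4
    · rw [← hτ, List.length_map]
    · have := congrArg List.length h2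
      simpa using this

/-- The word has a segmentation of the given kind and with the same cut counts as `G₀`. -/
def Reach (n : ℕ) (τ : List Tag) (G₀ : List Seg) (w : FreeMonoid ℕ) : Prop :=
  ∃ G, Valid G ∧ G.map Prod.fst = τ ∧ flat G = w.toList ∧ Cong n τ G₀ G

/-- Having the same reachability in all contexts `p * _ * q` is a congruence. It contains the rules,
which can be applied in both directions because signatures are symmetric. -/
theorem reach_iff_of_ruleCon {m n : ℕ} {τ : List Tag} (G₀ : List Seg) (hm : 2 * τ.length + 1 ≤ m)
    {v w : FreeMonoid ℕ} (h : ruleCon m n v w) : Reach n τ G₀ v ↔ Reach n τ G₀ w := by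
  let c : Con (FreeMonoid ℕ) :=
    { r := fun v w => ∀ p q, Reach n τ G₀ (p * v * q) ↔ Reach n τ G₀ (p * w * q)
      iseqv := ⟨fun _ _ _ => Iff.rfl, fun h p q => (h p q).symm,
        fun h h' p q => (h p q).trans (h' p q)⟩
      mul' := by
        intro v v' w w' h h' p q
        have h1 := h p (w * q)
        have h2 := h' (p * v') q
        simp only [mul_assoc] at h1 h2 ⊢
        exact h1.trans h2 }
  have key : ruleCon m n ≤ c := by
    refine Con.conGen_le.2 ?_
    rintro v w (⟨us, z, z', hz, hl, hus, hsig, rfl, rfl⟩ | ⟨us, z, z', hz, hl, hus, hsig, rfl, rfl⟩)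
    · intro p q
      have hz' : z' ≠ [] := by
        rintro rfl
        exact hz (by simpa using hsig.1)
      constructor
      · rintro ⟨G, h1, h2, h3, h4⟩
        obtain ⟨G', h5, h6, h7, h8⟩ := exists_of_rightRule h1 h2 hz hus hsig (by omega) h3
        exact ⟨G', h5, h6, h7, h4.trans h8⟩
      · rintro ⟨G, h1, h2, h3, h4⟩
        obtain ⟨G', h5, h6, h7, h8⟩ := exists_of_rightRule h1 h2 hz'
          (fun u hu => (hus u hu).trans hsig.1) hsig.symm (by omega) h3
        exact ⟨G', h5, h6, h7, h4.trans h8⟩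
    · intro p q
      have hz' : z' ≠ [] := by
        rintro rfl
        exact hz (by simpa using hsig.1)
      constructor
      · rintro ⟨G, h1, h2, h3, h4⟩
        obtain ⟨G', h5, h6, h7, h8⟩ := exists_of_leftRule h1 h2 hz hus hsig (by omega) h3
        exact ⟨G', h5, h6, h7, h4.trans h8⟩
      · rintro ⟨G, h1, h2, h3, h4⟩
        obtain ⟨G', h5, h6, h7, h8⟩ := exists_of_leftRule h1 h2 hz'
          (fun u hu => (hus u hu).trans hsig.1) hsig.symm (by omega) h3
        exact ⟨G', h5, h6, h7, h4.trans h8⟩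
  simpa using key h 1 1

/-- The surplus `e` of the longer first segment would have to start the rest of the other
segmentation. That is impossible when the rest begins with a letter outside the content; if movable
letters follow a core, `e` consists of such letters, but the longer core must end with a letter
foreign to the next block. -/
theorem Valid.eq_nil_of_append {t : Tag} {k e : List ℕ} {G G' : List Seg}
    (hG : Valid ((t, k) :: G)) (hG' : Valid ((t, k ++ e) :: G'))
    (ht : G.map Prod.fst = G'.map Prod.fst) (hf : flat G = e ++ flat G') : e = [] := by
  have hnil : ∀ {D : ℕ → Prop}, (∀ a ∈ e, D a) → (∀ a ∈ (flat G).head?, ¬D a) → e = [] := by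
    intro D h1 h2
    rcases e with _ | ⟨b, e⟩
    · rfl
    · exact absurd (h1 b List.mem_cons_self) (h2 b (by rw [hf]; rfl))
  have hadj := (List.isChain_cons.1 hG.2).1
  rcases t with a | B | ⟨B₁, B₂⟩
  · have h1 : k = [a] := hG.1 _ List.mem_cons_self
    have h2 : k ++ e = [a] := hG'.1 _ List.mem_cons_self
    rw [h1] at h2
    simpa using h2
  · have h1 : (k ++ e).toFinset = B ∧ k ++ e ≠ [] := hG'.1 _ List.mem_cons_self
    have heB : ∀ a ∈ e, a ∈ B := fun a ha => by
      rw [← h1.1, List.mem_toFinset]; exact List.mem_append_right _ ha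
    by_cases hmid : ∃ A' B₂ y G₃, G = (Tag.mid A' B₂, y) :: G₃
    · obtain ⟨A', B₂, y, G₃, rfl⟩ := hmid
      rcases G' with _ | ⟨⟨t', y'⟩, G₃'⟩
      · simp at ht
      simp only [List.map_cons, List.cons.injEq] at ht
      obtain ⟨rfl, ht⟩ := ht
      obtain ⟨rfl, -⟩ : B = A' ∧ ∀ a ∈ k.getLast?, a ∉ B₂ := hadj _ rfl
      have hlast : B = B ∧ ∀ a ∈ (k ++ e).getLast?, a ∉ B₂ :=
        (List.isChain_cons.1 hG'.2).1 _ rfl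
      obtain ⟨q, hq, -⟩ := eq_append_of_append_eq (D := (· ∈ B)) (m := y) hf.symm heB
        (head?_mid hG.tail.tail (List.isChain_cons.1 hG.tail.2).1)
      have hy : ∀ a ∈ y, a ∈ B ∧ a ∈ B₂ := hG.tail.1 _ List.mem_cons_self
      rcases List.eq_nil_or_concat e with rfl | ⟨e, b, rfl⟩
      · rfl
      · exact absurd (hy b (by simp [hq])).2 (hlast.2 b (by
          rw [List.concat_eq_append, ← List.append_assoc, List.getLast?_concat]; rfl))
    · refine hnil heB (head?_core hG.tail hadj ?_)
      rintro ⟨t, w⟩ hs A A' rfl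
      rcases G with _ | ⟨x, G⟩
      · simp at hs
      · simp only [List.head?_cons, Option.mem_some_iff] at hs
        exact hmid ⟨A, A', w, G, by rw [hs]⟩
  · have h1 : ∀ a ∈ k ++ e, a ∈ B₁ ∧ a ∈ B₂ := hG'.1 _ List.mem_cons_self
    exact hnil (fun a ha => (h1 a (List.mem_append_right _ ha)).1) (head?_mid hG.tail hadj)

theorem valid_unique : ∀ {G G' : List Seg}, Valid G → Valid G' →
    G.map Prod.fst = G'.map Prod.fst → flat G = flat G' → G = G' := by
  intro G
  induction G with
  | nil =>
    intro G' _ _ ht _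
    simpa using ht.symm
  | cons s G ih =>
    intro G' hG hG' ht hf
    rcases G' with _ | ⟨s', G'⟩
    · simp at ht
    simp only [List.map_cons, List.cons.injEq] at ht
    rcases s with ⟨t, k⟩
    rcases s' with ⟨t', k'⟩
    obtain ⟨rfl : t = t', ht⟩ := ht
    have hw : k = k' := by
      simp only [flat_cons] at hf
      rcases List.append_eq_append_iff.1 hf with ⟨e, rfl, h⟩ | ⟨e, rfl, h⟩
      · rw [hG.eq_nil_of_append hG' ht h, List.append_nil]
      · rw [hG'.eq_nil_of_append hG ht.symm h, List.append_nil]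
    subst hw
    rw [ih hG.tail hG'.tail ht (by simpa using hf)]

end Seg

/-! ### Skeletons -/

/-- The skeleton of an item: a letter or the content of a block. -/
inductive Sk : Type
  | letter (a : ℕ)
  | block (B : Finset ℕ)

namespace Sk

/-- The kind of the main segment of an item. -/
def tag : Sk → Tag
  | letter a => .letter a
  | block B => .core B

/-- The skeleton is that of a block. -/
def IsBlock : Sk → Prop
  | letter _ => False
  | block _ => True

/-- Every word over the first skeleton is a word over the second. -/
def Le : Sk → Sk → Prop
  | letter a, letter b => a = b
  | letter a, block B => a ∈ B
  | block _, letter _ => False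
  | block A, block B => A ⊆ B

theorem Le.trans {x y z : Sk} (h : Le x y) (h' : Le y z) : Le x z := by
  rcases x with a | A <;> rcases y with b | B <;> rcases z with c | C <;>
    simp only [Le] at h h' ⊢
  · exact h.trans h'
  · exact h ▸ h'
  · exact h' h
  · exact h.trans h'

theorem Le.antisymm {x y : Sk} (h : Le x y) (h' : Le y x) : x = y := by
  rcases x with a | A <;> rcases y with b | B <;> simp only [Le] at h h'
  · rw [h]
  · rw [h.antisymm h']

theorem IsBlock.mono {x y : Sk} (hx : IsBlock x) (h : Le x y) : IsBlock y := by
  rcases x with a | A <;> rcases y with b | B <;> simp_all [Le, IsBlock]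

/-- The words over a skeleton. -/
def Over : Sk → List ℕ → Prop
  | letter a, w => w = [a]
  | block B, w => ∀ a ∈ w, a ∈ B

/-- The segment between two neighbouring items. -/
def glue : Sk → List Sk → List Tag
  | block A, block B :: _ => [.mid A B]
  | _, _ => []

/-- The kinds of the segments for a list of items. -/
def tags : List Sk → List Tag
  | [] => []
  | x :: T => x.tag :: (glue x T ++ tags T)

/-- The position of the main segment of an item in the list of segments. -/
def pos : List Sk → ℕ → ℕ
  | _, 0 => 0
  | [], _ => 0
  | x :: T, i + 1 => (x.tag :: glue x T).length + pos T i

theorem length_glue_le (x : Sk) (T : List Sk) : (glue x T).length ≤ 1 := by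
  rcases x with a | A <;> rcases T with _ | ⟨b | B, T⟩ <;> simp [glue]

theorem length_tags_le (T : List Sk) : (tags T).length ≤ 2 * T.length := by
  induction T with
  | nil => simp [tags]
  | cons x T ih =>
    have := length_glue_le x T
    simp only [tags, List.length_cons, List.length_append]
    omega

theorem pos_le (T : List Sk) : ∀ i, pos T i ≤ (tags T).length := by
  induction T with
  | nil => intro i; cases i <;> simp [pos]
  | cons x T ih =>
    intro i
    rcases i with _ | i
    · simp [pos]
    · have := ih i
      simp only [pos, tags, List.length_cons, List.length_append]
      omega

/-- A list of skeletons embeds into another one if its items can be mapped monotonically to larger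
items, where several items may have the same image only if this is a block. -/
inductive Emb : List Sk → List Sk → Prop
  | nil (T : List Sk) : Emb [] T
  | stay {x y : Sk} {S T : List Sk} : Le x y → IsBlock y → Emb S (y :: T) → Emb (x :: S) (y :: T)
  | advance {x y : Sk} {S T : List Sk} : Le x y → Emb S T → Emb (x :: S) (y :: T)
  | skip {y : Sk} {S T : List Sk} : Emb S T → Emb S (y :: T)

theorem Emb.trans {S T U : List Sk} (h : Emb S T) (h' : Emb T U) : Emb S U := by
  induction h' generalizing S with
  | nil U =>
    cases h
    exact .nil U
  | @stay y u T U hyu hu h' ih =>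
    induction S with
    | nil => exact .nil _
    | cons x S ihS =>
      cases h with
      | stay hxy hy h => exact .stay (hxy.trans hyu) hu (ihS h)
      | advance hxy h => exact .stay (hxy.trans hyu) hu (ih h)
      | skip h => exact ih h
  | @advance y u T U hyu h' ih =>
    induction S with
    | nil => exact .nil _
    | cons x S ihS =>
      cases h with
      | stay hxy hy h => exact .stay (hxy.trans hyu) (hy.mono hyu) (ihS h)
      | advance hxy h => exact .advance (hxy.trans hyu) (ih h)
      | skip h => exact .skip (ih h)
  | skip h' ih => exact .skip (ih h)

theorem Emb.of_cons {x : Sk} {S T : List Sk} (h : Emb (x :: S) T) : Emb S T := by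
  induction T with
  | nil => cases h
  | cons y T ih =>
    cases h with
    | stay _ _ h => exact h
    | advance _ h => exact .skip h
    | skip h => exact .skip (ih h)

theorem Emb.append_left {S T : List Sk} (h : Emb S T) (U : List Sk) : Emb S (U ++ T) := by
  induction U with
  | nil => exact h
  | cons y U ih => exact .skip ih

/-- Neighbouring items do not absorb each other. -/
def Normal (S : List Sk) : Prop :=
  S.IsChain fun x y => (IsBlock y → ¬Le x y) ∧ (IsBlock x → ¬Le y x)

/-- Normality forbids the first item to be absorbed into the second, so an embedding would have to
move everything further to the right, until the list is exhausted. -/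
theorem not_emb_tail {x : Sk} {S : List Sk} (hS : Normal (x :: S)) : ¬Emb (x :: S) S := by
  induction S generalizing x with
  | nil => intro h; cases h
  | cons y S ih =>
    intro h
    have hy : Normal (y :: S) := hS.tail
    cases h with
    | stay hxy hb h => exact (List.isChain_cons_cons.1 hS).1.1 hb hxy
    | advance _ h => exact ih hy h
    | skip h => exact ih hy h.of_cons

theorem Emb.of_block {x : Sk} {S T : List Sk} (hS : Normal (x :: S)) (hx : IsBlock x)
    (h : Emb S (x :: T)) : Emb S T := by
  cases h with
  | nil => exact .nil _
  | stay hz _ h => exact absurd hz ((List.isChain_cons_cons.1 hS).1.2 hx)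
  | advance hz h => exact absurd hz ((List.isChain_cons_cons.1 hS).1.2 hx)
  | skip h => exact h

/-- If the first item of the target were skipped, composing with the embedding in the other
direction would embed `y :: T` into `T`. -/
theorem Emb.cases_of_normal {x y : Sk} {S T : List Sk} (hS : Normal (x :: S))
    (hT : Normal (y :: T)) (h : Emb (x :: S) (y :: T)) (h' : Emb (y :: T) (x :: S)) :
    Le x y ∧ (x = y → Emb S T) := by
  cases h with
  | stay hxy hy h => exact ⟨hxy, fun e => by subst e; exact h.of_block hS hy⟩
  | advance hxy h => exact ⟨hxy, fun _ => h⟩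
  | skip h => exact absurd (h'.trans h) (not_emb_tail hT)

theorem Emb.antisymm {S T : List Sk} (hS : Normal S) (hT : Normal T) (h : Emb S T)
    (h' : Emb T S) : S = T := by
  induction S generalizing T with
  | nil => cases h'; rfl
  | cons x S ih =>
    rcases T with _ | ⟨y, T⟩
    · cases h
    obtain ⟨h1, h2⟩ := h.cases_of_normal hS hT h'
    obtain ⟨h3, h4⟩ := h'.cases_of_normal hT hS h
    obtain rfl := h1.antisymm h3
    rw [ih (T := T) hS.tail hT.tail (h2 rfl) (h4 rfl)]

/-- The movable letters between two cores are assigned to the block on the left, which leaves one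
factor per item. -/
theorem exists_over_of_valid {T : List Sk} {G : List Seg} (hG : Seg.Valid G)
    (ht : G.map Prod.fst = tags T) : ∃ ws, List.Forall₂ Over T ws ∧ ws.flatten = Seg.flat G := by
  induction T generalizing G with
  | nil =>
    have : G = [] := by simpa [tags] using ht
    subst this
    exact ⟨[], .nil, rfl⟩
  | cons x T ih =>
    obtain ⟨⟨t, k⟩, G, rfl, rfl, ht'⟩ := List.map_eq_cons_iff.1 ht
    obtain ⟨G₁, G₂, rfl, h1, h2⟩ := List.map_eq_append_iff.1 ht'
    obtain ⟨ws, h3, h4⟩ := ih (G := G₂) (Seg.Valid.of_append (H₁ := (x.tag, k) :: G₁) hG) h2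
    have hk := hG.1 _ List.mem_cons_self
    have key : Over x (k ++ Seg.flat G₁) := by
      rcases x with a | A
      · have : G₁ = [] := by simpa [glue] using h1
        subst this
        rw [Seg.flat_nil, List.append_nil]
        exact hk
      · have hkA : k.toFinset = A ∧ k ≠ [] := hk
        intro a ha
        rcases List.mem_append.1 ha with h | h
        · rw [← hkA.1]; exact List.mem_toFinset.2 h
        · rcases T with _ | ⟨b | B, T⟩
          · simp [glue] at h1; subst h1; simp at h
          · simp [glue] at h1; subst h1; simp at h
          · obtain ⟨⟨t', m⟩, G₃, rfl, rfl, h5⟩ := List.map_eq_cons_iff.1 h1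
            have : G₃ = [] := by simpa using h5
            subst this
            have hm : ∀ a ∈ m, a ∈ A ∧ a ∈ B := hG.1 (.mid A B, m) (by simp)
            exact (hm a (by simpa using h)).1
    exact ⟨_ :: ws, .cons key h3, by simp [h4]⟩

end Sk

/-! ### Embeddings of skeletons obtained from factorizations of words. -/

namespace SignedItem

/-- The skeleton of an item. -/
def sk (x : SignedItem) : Sk :=
  if x.1 = true then .block x.letters.toFinset else .letter x.2.1.headI

theorem exists_of_forall₂_append {α β : Type*} {R : α → β → Prop} {l : List α} {l₁ l₂ : List β}
    (h : List.Forall₂ R l (l₁ ++ l₂)) : ∃ m₁ m₂, List.Forall₂ R m₁ l₁ ∧ List.Forall₂ R m₂ l₂ ∧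
      l = m₁ ++ m₂ := by
  induction l₁ generalizing l with
  | nil => exact ⟨[], l, .nil, h, rfl⟩
  | cons b l₁ ih =>
    obtain ⟨a, l', hab, h', rfl⟩ := List.forall₂_cons_right_iff.1 h
    obtain ⟨m₁, m₂, h1, h2, rfl⟩ := ih h'
    exact ⟨a :: m₁, m₂, .cons hab h1, h2, rfl⟩

theorem exists_mem_flatten {ws : List (List ℕ)} {r q : List ℕ} {a : ℕ}
    (h : ws.flatten = r ++ a :: q) : ∃ ws₁ c₁ c₂ ws₂, ws = ws₁ ++ (c₁ ++ a :: c₂) :: ws₂ ∧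
      q = c₂ ++ ws₂.flatten := by
  induction ws generalizing r with
  | nil => simp at h
  | cons w ws ih =>
    rw [List.flatten_cons] at h
    rcases List.append_eq_append_iff.1 h with ⟨e, rfl, h1⟩ | ⟨e, h1, h2⟩
    · obtain ⟨ws₁, c₁, c₂, ws₂, rfl, h3⟩ := ih h1
      exact ⟨w :: ws₁, c₁, c₂, ws₂, rfl, h3⟩
    · rcases e with _ | ⟨b, e⟩
      · obtain ⟨ws₁, c₁, c₂, ws₂, rfl, h3⟩ := ih (r := []) h2.symm
        exact ⟨w :: ws₁, c₁, c₂, ws₂, rfl, h3⟩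
      · simp only [List.cons_append, List.cons.injEq] at h2
        exact ⟨[], r, e, ws, by rw [h1, h2.1]; rfl, h2.2⟩

-- The word is read from left to right, with `r` as the part already passed. A letter falls into one
-- factor; of the `K` copies of the letters of a block two consecutive ones fall into a common
-- factor, which must belong to a block with larger content. The unread remainder of a block factor
-- can serve again, whereas a letter factor is used up.
open Sk in
theorem emb_of_flatten {K : ℕ} {S : List SignedItem} (hS : ∀ x ∈ S, WF x) {T : List Sk}
    {ws : List (List ℕ)} {r : List ℕ} (h : List.Forall₂ Over T ws)
    (hK : 2 * T.length + 1 ≤ K) (hf : ws.flatten = r ++ listWord K S) : Emb (S.map sk) T := by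
  induction S generalizing T ws r with
  | nil => exact .nil _
  | cons x S ih =>
    have hS' : ∀ x ∈ S, WF x := fun y hy => hS y (List.mem_cons_of_mem _ hy)
    rcases hS x List.mem_cons_self with ⟨a, rfl⟩ | ⟨hb, hne⟩
    · obtain ⟨ws₁, c₁, c₂, ws₂, rfl, h1⟩ := exists_mem_flatten
        (show ws.flatten = r ++ a :: listWord K S by rw [hf]; simp [itemWord])
      obtain ⟨T₁, T', h2, h3, rfl⟩ := exists_of_forall₂_append h
      obtain ⟨t, T₂, h4, h5, rfl⟩ := List.forall₂_cons_right_iff.1 h3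
      refine Emb.append_left ?_ _
      rcases t with b | B
      · have h6 : c₁ ++ a :: c₂ = [b] := h4
        have h7 : c₁ = [] ∧ a = b ∧ c₂ = [] := by
          rcases c₁ with _ | ⟨c, c₁⟩
          · simpa using h6
          · simp at h6
        obtain ⟨rfl, rfl, rfl⟩ := h7
        refine .advance (by simp [sk, Le]) (ih hS' (r := []) h5 ?_ (by rw [h1]; rfl))
        simp at hK
        omega
      · have h6 : ∀ b ∈ c₁ ++ a :: c₂, b ∈ B := h4
        refine .stay (by simpa [sk, Le] using h6 a (by simp)) trivial
          (ih hS' (ws := c₂ :: ws₂) (r := []) (.cons ?_ h5) ?_ (by rw [h1]; rfl))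
        · exact fun b hb => h6 b (by simp [hb])
        · simp at hK ⊢
          omega
    · obtain ⟨ws₁, s, ws₂, us₁, u, u', us₂, c₁, c₂, rfl, h2, h3, h4, h5⟩ :=
        Seg.exists_inner ws (List.replicate K x.letters) r (signedWord K x.2.1 x.2.2 ++ listWord K S)
        (fun u hu => by rw [List.eq_of_mem_replicate hu]; exact hne)
        (by rw [List.length_replicate, ← h.length_eq]; exact hK)
        (by rw [hf]; simp [itemWord, hb])
      have hu : u = x.letters := List.eq_of_mem_replicate (n := K) (by rw [h2]; simp)
      have hu' : u' = x.letters := List.eq_of_mem_replicate (n := K) (by rw [h2]; simp)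
      obtain ⟨T₁, T', h6, h7, rfl⟩ := exists_of_forall₂_append h
      obtain ⟨t, T₂, h8, h9, rfl⟩ := List.forall₂_cons_right_iff.1 h7
      refine Emb.append_left ?_ _
      rcases t with b | B
      · have h10 : s = [b] := h8
        have h11 := congrArg List.length (h3.symm.trans h10)
        have h12 := List.length_pos_iff.2 hne
        rw [hu, hu'] at h11
        simp at h11
        omega
      · have h10 : ∀ b ∈ s, b ∈ B := h8
        refine .stay ?_ trivial (ih hS' (ws := c₂ :: ws₂)
          (r := us₂.flatten ++ signedWord K x.2.1 x.2.2) (.cons ?_ h9) ?_ ?_)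
        · rw [sk, if_pos hb]
          intro b hb
          rw [List.mem_toFinset, ← hu] at hb
          exact h10 b (by rw [h3]; simp [hb])
        · exact fun b hb => h10 b (by rw [h3]; simp [hb])
        · simp at hK ⊢
          omega
        · rw [List.flatten_cons, ← h5]; simp

open Sk in
theorem normal_sk {S : List SignedItem} (h : Reduced S) : Sk.Normal (S.map sk) := by
  obtain ⟨h1, h2⟩ := h
  have key : ∀ x y : SignedItem, WF x → WF y → ¬Covers x y → IsBlock x.sk → ¬Le y.sk x.sk := by
    intro x y hx hy hxy hb hle
    rcases hx with ⟨a, rfl⟩ | ⟨hx, -⟩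
    · simp [sk, IsBlock] at hb
    · refine hxy ⟨hx, fun a ha => ?_⟩
      rcases hy with ⟨b, rfl⟩ | ⟨hy, -⟩
      · simp only [letters, List.append_nil, List.mem_singleton] at ha
        subst ha
        simpa [sk, hx, Le] using hle
      · simp only [sk, hx, hy, if_true, Le] at hle
        exact List.mem_toFinset.1 (hle (List.mem_toFinset.2 ha))
  rw [Sk.Normal, List.isChain_map]
  induction S with
  | nil => exact List.isChain_nil
  | cons x S ih =>
    rw [List.isChain_cons] at h2 ⊢
    refine ⟨fun y hy => ?_, ih (fun y hy => h1 y (List.mem_cons_of_mem _ hy)) h2.2⟩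
    have hx := h1 x List.mem_cons_self
    have hy' := h1 y (List.mem_cons_of_mem _ (List.mem_of_mem_head? hy))
    have := h2.1 y hy
    exact ⟨key y x hy' hx this.2, key x y hx hy' this.1⟩

end SignedItem

/-! ### Segmentations of the words of reduced lists. -/

namespace SignedItem

open Sk Seg

/-- The first item is a block that contains the letter `a`. -/
def InHead (S : List SignedItem) (a : ℕ) : Prop := S.headI.1 = true ∧ a ∈ S.headI.letters

theorem exists_first_not {D : ℕ → Prop} {t : List ℕ} (h : ∃ a ∈ t, ¬D a) :
    ∃ l a k, t = l ++ [a] ++ k ∧ ¬D a ∧ ∀ b ∈ l, D b := by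
  obtain ⟨k, a, y, h1, h2, h3⟩ := exists_last_not (D := D) (t := t.reverse) (by simpa using h)
  exact ⟨y.reverse, a, k.reverse, by simpa using congrArg List.reverse h1, h2, by simpa using h3⟩

/-- The first copy of `u` provides the first letter outside `D`, the third copy, followed by `v`,
the last letter outside `E`, and the second copy stays intact and secures the content of the core.
-/
theorem exists_trim {D E : ℕ → Prop} {u : List ℕ} (hD : ∃ a ∈ u, ¬D a) (hE : ∃ a ∈ u, ¬E a)
    (v : List ℕ) : ∃ l k y, u ++ (u ++ (u ++ v)) = l ++ (k ++ y) ∧ (∀ a ∈ l, D a ∧ a ∈ u) ∧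
      (∀ a ∈ k.head?, ¬D a) ∧ (∀ a ∈ y, E a) ∧ (∀ a ∈ k.getLast?, ¬E a) ∧ ∀ a ∈ u, a ∈ k := by
  obtain ⟨l, b, c, h1, h2, h3⟩ := exists_first_not hD
  obtain ⟨k, a, y, h4, h5, h6⟩ := exists_last_not (D := E) (t := u ++ v) (by
    obtain ⟨a, ha, h⟩ := hE
    exact ⟨a, List.mem_append_left _ ha, h⟩)
  refine ⟨l, ([b] ++ c) ++ (u ++ k) ++ [a], y, ?_, fun e he => ⟨h3 e he, ?_⟩, ?_, h6, ?_, ?_⟩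
  · rw [h4]
    nth_rewrite 1 [h1]
    simp
  · rw [h1]; simp [he]
  · intro e he
    simp only [List.append_assoc, List.cons_append, List.head?_cons, Option.mem_some_iff] at he
    exact he ▸ h2
  · intro e he
    rw [List.getLast?_concat, Option.mem_some_iff] at he
    exact he ▸ h5
  · intro e he
    simp [he]

theorem exists_itemWord {K : ℕ} (hK : 3 ≤ K) {x : SignedItem} (hx : x.1 = true) :
    ∃ v, itemWord K x = x.letters ++ (x.letters ++ (x.letters ++ v)) ∧ ∀ a ∈ v, a ∈ x.letters := by
  obtain ⟨k, rfl⟩ := Nat.exists_eq_add_of_le' hK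
  refine ⟨(List.replicate k x.letters).flatten ++ signedWord (k + 3) x.2.1 x.2.2, ?_, ?_⟩
  · rw [itemWord, if_pos hx]
    simp [List.replicate_succ]
  · intro a ha
    simp only [signedWord, List.mem_append, List.mem_flatten, List.mem_replicate] at ha
    rcases ha with ⟨w, ⟨_, rfl⟩, ha⟩ | ha | ⟨w, ⟨_, rfl⟩, ha⟩
    · exact ha
    · exact List.mem_append_left _ ha
    · exact List.mem_append_right _ ha

/-- The cuts behind the items fit the cuts of a segmentation. -/
def FitsCuts (K : ℕ) (S : List SignedItem) (G : List Seg) : Prop :=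
  ∀ i < S.length, ∃ l, listWord K (S.drop (i + 1)) = l ++ flat (G.drop (pos (S.map sk) (i + 1))) ∧
    ∀ a ∈ l, Shared (S.drop i) a

theorem FitsCuts.cons {K : ℕ} {x : SignedItem} {S : List SignedItem} {X G : List Seg}
    {l : List ℕ} (h : FitsCuts K S G) (hX : X.length = (x.sk.tag :: glue x.sk (S.map sk)).length)
    (h1 : listWord K S = l ++ flat G) (h2 : ∀ a ∈ l, Shared (x :: S) a) :
    FitsCuts K (x :: S) (X ++ G) := by
  intro i hi
  rw [List.map_cons, pos, ← hX, List.drop_length_add_append]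
  rcases i with _ | i
  · exact ⟨l, by cases h : S.map sk <;> simpa [pos] using h1, h2⟩
  · exact h i (by simpa using hi)

/-- The segmentation is built from right to left. The predicate `D` stands for the content of the
item to the left, and the prefix `l` over `D` is handed to that item as movable letters. Reducedness
ensures that each block has letters foreign to its neighbours, so trimming leaves a core. -/
theorem exists_segments {K : ℕ} (hK : 3 ≤ K) {S : List SignedItem} (hS : Reduced S) {D : ℕ → Prop}
    (hD : S.headI.1 = true → ∃ a ∈ S.headI.letters, ¬D a) :
    ∃ l G, listWord K S = l ++ flat G ∧ (∀ a ∈ l, D a ∧ InHead S a) ∧ Valid G ∧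
      G.map Prod.fst = tags (S.map sk) ∧
      (∀ s ∈ G.head?, (∃ B, s.1 = .core B) → ∀ a ∈ s.2.head?, ¬D a) ∧ FitsCuts K S G := by
  induction S generalizing D with
  | nil =>
    exact ⟨[], [], rfl, by simp, ⟨by simp, List.isChain_nil⟩, rfl, by simp, fun i hi => by simp at hi⟩
  | cons x S ih =>
    obtain ⟨hwf, hch⟩ := hS
    rw [List.isChain_cons] at hch
    have hx := hwf x List.mem_cons_self
    -- `InHead [x]` describes the letters of `x` if `x` is a block and is empty if `x` is a letter.
    obtain ⟨l', G', h1, h2, h3, h4, h5, h6⟩ := ih ⟨fun y hy => hwf y (List.mem_cons_of_mem _ hy),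
      hch.2⟩ (D := InHead [x]) (by
        intro hb
        rcases S with _ | ⟨y, S⟩
        · exact absurd hb Bool.false_ne_true
        · have h := (hch.1 y rfl).1
          by_contra! hcon
          by_cases hxb : x.1 = true
          · exact h ⟨hxb, fun a ha => (hcon a ha).2⟩
          · obtain ⟨a, ha⟩ := List.exists_mem_of_ne_nil _
              (hwf y (by simp)).letters_ne_nil
            exact hxb (hcon a ha).1)
    rcases hx with ⟨a, rfl⟩ | ⟨hb, hne⟩
    · have hl' : l' = [] := by
        rcases l' with _ | ⟨b, l'⟩
        · rfl
        · exact absurd (h2 b List.mem_cons_self).1.1 Bool.false_ne_true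
      subst hl'
      have hgl : glue (sk (false, [a], [])) (S.map sk) = [] := by simp [sk, glue]
      refine ⟨[], [(.letter a, [a])] ++ G', ?_, by simp,
        (valid_cons (s := (.letter a, [a]))).2 ⟨rfl, ?_, h3⟩, ?_, ?_, ?_⟩
      · rw [listWord_cons, h1]; simp [itemWord]
      · rintro ⟨t, w⟩ hy
        rcases S with _ | ⟨y, S⟩
        · simp [tags] at h4; subst h4; simp at hy
        · obtain ⟨⟨t', w'⟩, G, rfl, h7 : t' = y.sk.tag, -⟩ := List.map_eq_cons_iff.1 h4
          simp only [List.head?_cons, Option.mem_some_iff, Prod.mk.injEq] at hy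
          obtain ⟨rfl, rfl⟩ := hy
          subst h7
          by_cases hyb : y.1 = true
          · simp only [sk, if_pos hyb, tag, Adj, List.mem_toFinset]
            intro ha
            exact (hch.1 y rfl).2 ⟨hyb, by simpa [letters] using ha⟩
          · simp [sk, if_neg hyb, tag, Adj]
      · rw [List.map_append, h4, List.map_cons (f := sk), tags, hgl]
        simp [sk, tag]
      · simp
      · exact h6.cons (by rw [hgl]; simp) h1 (by simp)
    · obtain ⟨v, hv, hvx⟩ := exists_itemWord hK hb
      obtain ⟨l, k, y, h7, h8, h9, h10, h11, h12⟩ := exists_trim (u := x.letters)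
        (E := InHead S) (hD hb) (by
          by_contra! hcon
          rcases S with _ | ⟨z, S⟩
          · obtain ⟨a, ha⟩ := List.exists_mem_of_ne_nil _ hne
            exact Bool.false_ne_true (hcon a ha).1
          · obtain ⟨a, ha⟩ := List.exists_mem_of_ne_nil _ hne
            exact (hch.1 z rfl).2 ⟨(hcon a ha).1, fun a ha => (hcon a ha).2⟩) v
      have hky : ∀ a ∈ k ++ y, a ∈ x.letters := by
        intro a ha
        have : a ∈ x.letters ++ (x.letters ++ (x.letters ++ v)) := by
          rw [h7]; exact List.mem_append_right _ ha
        simp only [List.mem_append] at this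
        rcases this with h | h | h | h
        exacts [h, h, h, hvx a h]
      have hsk : x.sk = .block x.letters.toFinset := by rw [sk, if_pos hb]
      have hk : k.toFinset = x.letters.toFinset ∧ k ≠ [] := by
        refine ⟨?_, ?_⟩
        · ext a
          rw [List.mem_toFinset, List.mem_toFinset]
          exact ⟨fun h => hky a (List.mem_append_left _ h), h12 a⟩
        · obtain ⟨a, ha⟩ := List.exists_mem_of_ne_nil _ hne
          exact List.ne_nil_of_mem (h12 a ha)
      have hl : ∀ a ∈ l, D a ∧ InHead (x :: S) a := fun a ha => ⟨(h8 a ha).1, hb, (h8 a ha).2⟩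
      have hl2 : ∀ a ∈ l', Shared (x :: S) a := fun a ha => h2 a ha
      by_cases hn : S.headI.1 = true
      · rcases S with _ | ⟨z, S⟩
        · exact absurd hn Bool.false_ne_true
        have hz : z.1 = true := hn
        have hskz : z.sk = .block z.letters.toFinset := by rw [sk, if_pos hz]
        have hgl : glue x.sk ((z :: S).map sk) =
            [.mid x.letters.toFinset z.letters.toFinset] := by
          rw [hsk, List.map_cons, hskz]; rfl
        -- The movable letters are those trimmed from the end of `x` followed by those trimmed from
        -- the start of the next block.
        refine ⟨l, [(.core x.letters.toFinset, k),
          (.mid x.letters.toFinset z.letters.toFinset, y ++ l')] ++ G', ?_, hl,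
          (valid_cons (s := (.core _, k))).2 ⟨hk, ?_,
            (valid_cons (s := (.mid _ _, y ++ l'))).2 ⟨?_, ?_, h3⟩⟩, ?_, ?_, ?_⟩
        · rw [listWord_cons, h1, hv, h7]; simp
        · rintro _ ⟨⟩
          exact ⟨rfl, fun a ha h => h11 a ha ⟨hn, List.mem_toFinset.1 h⟩⟩
        · intro a ha
          rw [List.mem_toFinset, List.mem_toFinset]
          rcases List.mem_append.1 ha with h | h
          · exact ⟨hky a (List.mem_append_right _ h), (h10 a h).2⟩
          · exact ⟨(hl2 a h).1.2, (hl2 a h).2.2⟩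
        · rintro ⟨t, w⟩ hy
          obtain ⟨⟨t', w'⟩, G, rfl, h13 : t' = z.sk.tag, -⟩ := List.map_eq_cons_iff.1 h4
          simp only [List.head?_cons, Option.mem_some_iff, Prod.mk.injEq] at hy
          obtain ⟨rfl, rfl⟩ := hy
          rw [hskz] at h13
          subst h13
          refine ⟨rfl, fun a ha h => ?_⟩
          exact h5 _ rfl ⟨_, rfl⟩ a ha ⟨hb, List.mem_toFinset.1 h⟩
        · rw [List.map_append, h4, List.map_cons (f := sk) (a := x), tags, hgl, hsk]
          simp [tag]
        · rintro _ ⟨⟩ -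
          exact h9
        · exact h6.cons (by rw [hgl]; simp) h1 hl2
      · have hl' : l' = [] := by
          rcases l' with _ | ⟨b, l'⟩
          · rfl
          · exact absurd (h2 b List.mem_cons_self).2.1 hn
        have hy' : y = [] := by
          rcases y with _ | ⟨b, y⟩
          · rfl
          · exact absurd (h10 b List.mem_cons_self).1 hn
        subst hl' hy'
        have hgl : glue x.sk (S.map sk) = [] := by
          rcases S with _ | ⟨z, S⟩
          · rw [hsk]; rfl
          · have hz : ¬z.1 = true := hn
            rw [hsk, List.map_cons, sk, if_neg hz]; rfl
        refine ⟨l, [(.core x.letters.toFinset, k)] ++ G', ?_, hl,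
          (valid_cons (s := (.core _, k))).2 ⟨hk, ?_, h3⟩, ?_, ?_, ?_⟩
        · rw [listWord_cons, h1, hv, h7]; simp
        · rintro ⟨t, w⟩ hy
          rcases S with _ | ⟨z, S⟩
          · simp [tags] at h4; subst h4; simp at hy
          · obtain ⟨⟨t', w'⟩, G, rfl, h7 : t' = z.sk.tag, -⟩ := List.map_eq_cons_iff.1 h4
            simp only [List.head?_cons, Option.mem_some_iff, Prod.mk.injEq] at hy
            obtain ⟨rfl, rfl⟩ := hy
            have hz : ¬z.1 = true := hn
            rcases hwf z (by simp) with ⟨b, rfl⟩ | ⟨h, -⟩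
            · subst h7
              simp only [sk, if_neg hz, tag, Adj, List.mem_toFinset]
              intro ha
              exact (hch.1 _ rfl).1 ⟨hb, by simpa [letters] using ha⟩
            · exact absurd h hz
        · rw [List.map_append, h4, List.map_cons (f := sk), tags, hgl, hsk]
          simp [tag]
        · rintro _ ⟨⟩ -
          exact h9
        · exact h6.cons (by rw [hgl]; simp) h1 (by simp)

theorem Tight.append {X τ : List Tag} {i a : ℕ} (hi : 0 < i) (h : Tight τ i a) :
    Tight (X ++ τ) (X.length + i) a := by
  refine ⟨fun t ht => h.1 t ?_, fun j hj t ht => h.2 (i - 1) (by omega) t ?_⟩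
  · rwa [List.getElem?_append_right (by omega), Nat.add_sub_cancel_left] at ht
  · rwa [List.getElem?_append_right (by omega), show j - X.length = i - 1 by omega] at ht

/-- The cut lies before the main segment of the next item. Of the segments touching it only one
between two cores can share letters, and these are the letters of `Shared`. -/
theorem tight_pos {S : List SignedItem} {i a : ℕ} (hi : i < S.length) (h : ¬Shared (S.drop i) a) :
    Tight (tags (S.map sk)) (pos (S.map sk) (i + 1)) a := by
  induction S generalizing i with
  | nil => simp at hi
  | cons x S ih =>
    have htag : ∀ y : Sk, a ∉ y.tag.shared := by rintro (_ | _) <;> simp [tag, Tag.shared]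
    rw [List.map_cons, pos, tags, ← List.cons_append]
    rcases i with _ | i
    · have hpos : pos (S.map sk) 0 = 0 := by cases S.map sk <;> rfl
      rw [hpos]
      constructor
      · intro t ht
        rw [Nat.add_zero, List.getElem?_append_right le_rfl, Nat.sub_self] at ht
        rcases S with _ | ⟨y, S⟩
        · simp [tags] at ht
        · simp only [List.map_cons, tags, List.getElem?_cons_zero, Option.mem_some_iff] at ht
          exact ht ▸ htag _
      · intro j hj t ht
        rw [List.getElem?_append_left (by omega)] at ht
        rcases List.mem_cons.1 (List.mem_of_getElem? ht) with rfl | ht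
        · exact htag _
        · rcases S with _ | ⟨y, S⟩
          · simp only [List.map_nil] at ht
            cases hx : x.sk <;> simp [hx, glue] at ht
          · by_cases hx : x.1 = true <;> by_cases hy : y.1 = true <;>
              simp [sk, hx, hy, glue] at ht
            subst ht
            simp only [Tag.shared, Finset.mem_inter, List.mem_toFinset]
            exact fun hcon => h ⟨⟨hx, hcon.1⟩, hy, hcon.2⟩
    · refine Tight.append ?_ (ih (by simpa using hi) h)
      rcases S with _ | ⟨y, S⟩
      · simp at hi
      · simp [pos]

end SignedItem

/-- The homomorphism given by the generators of `boundedWords`. -/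
def boundedLetter (m n r a : ℕ) : boundedWords m n r :=
  if h : a < r then ⟨((FreeMonoid.ofList [a] : FreeMonoid ℕ) : (ruleCon m n).Quotient),
    [a], by simpa using h, rfl⟩ else 1

theorem wordVal_boundedLetter {m n r : ℕ} {w : List ℕ} (hw : ∀ a ∈ w, a < r) :
    (wordVal (boundedLetter m n r) w).1 =
      ((FreeMonoid.ofList w : FreeMonoid ℕ) : (ruleCon m n).Quotient) := by
  induction w with
  | nil => rfl
  | cons a w ih =>
    rw [wordVal_cons, Submonoid.coe_mul, ih fun b hb => hw b (List.mem_cons_of_mem _ hb),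
      boundedLetter, dif_pos (hw a List.mem_cons_self)]
    rfl

/-! ### Equal values of reduced lists force them to match. -/

namespace SignedItem

open Sk Seg

/-- Here the hypothesis is evaluated in `boundedWords m n r`, where `r` exceeds all letters
involved. For `K` one takes `k!` with `k` so large that `K` is a multiple of `n` and at least `N`.
-/
theorem exists_ruleCon {S S' : List SignedItem} (hS : ∀ x ∈ S, WF x) (hS' : ∀ x ∈ S', WF x)
    (h : ∀ (M : Type) [Monoid M], IsDAb M → ∀ (g : ℕ → M) (k : ℕ), Nat.card M + 2 ≤ k →
      wordVal g (listWord k.factorial S) = wordVal g (listWord k.factorial S'))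
    (m n N : ℕ) [NeZero m] [NeZero n] : ∃ K, N ≤ K ∧ n ∣ K ∧
      ruleCon m n (FreeMonoid.ofList (listWord K S)) (FreeMonoid.ofList (listWord K S')) := by
  obtain ⟨r, hr⟩ : ∃ r, ∀ a ∈ (S ++ S').flatMap letters, a < r :=
    ⟨((S ++ S').flatMap letters).sum + 1, fun a ha => Nat.lt_succ_of_le (List.le_sum_of_mem ha)⟩
  obtain ⟨k, hk1, hk2, hk3⟩ : ∃ k, Nat.card (boundedWords m n r) + 2 ≤ k ∧ n ≤ k ∧ N ≤ k :=
    ⟨Nat.card (boundedWords m n r) + 2 + n + N, by omega, by omega, by omega⟩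
  have hk : k ≤ k.factorial := Nat.self_le_factorial k
  refine ⟨k.factorial, hk3.trans hk, Nat.dvd_factorial (NeZero.pos n) hk2, ?_⟩
  have h1 := congrArg Subtype.val (h _ (isDAb_boundedWords m n r) (boundedLetter m n r) k hk1)
  rw [wordVal_boundedLetter, wordVal_boundedLetter] at h1
  · exact (Con.eq _).1 h1
  · intro a ha
    obtain ⟨x, hx, hax⟩ := (mem_listWord (by omega) hS').1 ha
    exact hr a (List.mem_flatMap.2 ⟨x, List.mem_append_right _ hx, hax⟩)
  · intro a ha
    obtain ⟨x, hx, hax⟩ := (mem_listWord (by omega) hS).1 ha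
    exact hr a (List.mem_flatMap.2 ⟨x, List.mem_append_left _ hx, hax⟩)

theorem exists_segments_all {K : ℕ} (hK : 3 ≤ K) {S : List SignedItem} (hS : Reduced S) :
    ∃ G, flat G = listWord K S ∧ Valid G ∧ G.map Prod.fst = tags (S.map sk) ∧ FitsCuts K S G := by
  obtain ⟨l, G, h1, h2, h3, h4, -, h6⟩ := exists_segments hK hS (D := fun _ => False) (by
    intro hb
    rcases S with _ | ⟨x, S⟩
    · exact absurd hb Bool.false_ne_true
    · obtain ⟨a, ha⟩ := List.exists_mem_of_ne_nil _ (hS.1 x List.mem_cons_self).letters_ne_nil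
      exact ⟨a, ha, not_false⟩)
  have : l = [] := List.eq_nil_iff_forall_not_mem.2 fun a ha => (h2 a ha).1
  subst this
  exact ⟨G, h1.symm, h3, h4, h6⟩

theorem exists_segments_of_ruleCon {m n : ℕ} {v w : List ℕ} {T : List Sk} {G : List Seg}
    (h : ruleCon m n (FreeMonoid.ofList v) (FreeMonoid.ofList w)) (hG : Valid G)
    (ht : G.map Prod.fst = tags T) (hf : flat G = v) (hm : 4 * T.length + 1 ≤ m) :
    ∃ G', Valid G' ∧ G'.map Prod.fst = tags T ∧ flat G' = w ∧ Cong n (tags T) G G' := by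
  have h1 := length_tags_le T
  exact (reach_iff_of_ruleCon (τ := tags T) G (by omega) h).1 ⟨G, hG, ht, hf, Cong.refl _ _ _⟩

/-- Modulo `K` the exponent `K - 1` counts as `-1` and the exponent `K` as `0`, so the word has the
signed counts of the items. -/
theorem exists_count_listWord {K : ℕ} (hK : 1 ≤ K) {S : List SignedItem} (hS : ∀ x ∈ S, WF x)
    (a : ℕ) : ∃ c, (listWord K S).count a + (S.flatMap fun x => x.2.2).count a =
      (S.flatMap fun x => x.2.1).count a + K * c := by
  induction S with
  | nil => exact ⟨0, rfl⟩
  | cons x S ih =>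
    obtain ⟨c, hc⟩ := ih fun y hy => hS y (List.mem_cons_of_mem _ hy)
    simp only [listWord_cons, List.flatMap_cons, List.count_append]
    rcases hS x List.mem_cons_self with ⟨b, rfl⟩ | ⟨hb, -⟩
    · refine ⟨c, ?_⟩
      simp only [itemWord, Bool.false_eq_true, if_false, List.count_nil]
      omega
    · refine ⟨c + x.letters.count a + x.2.2.count a, ?_⟩
      obtain ⟨k, rfl⟩ := Nat.exists_eq_add_of_le' hK
      simp only [itemWord, hb, if_true, signedWord, List.count_append, List.count_flatten,
        List.map_replicate, List.sum_replicate, smul_eq_mul, Nat.add_sub_cancel]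
      linarith

/-- `Balanced` modulo `n`. -/
def BalancedMod (n : ℕ) (l l' : List SignedItem) (a : ℕ) : Prop :=
  (l.flatMap fun x => x.2.1).count a + (l'.flatMap fun x => x.2.2).count a ≡
    (l'.flatMap fun x => x.2.1).count a + (l.flatMap fun x => x.2.2).count a [MOD n]

theorem balancedMod_of_count {K n : ℕ} (hK : 1 ≤ K) (hn : n ∣ K) {S S' : List SignedItem}
    (hS : ∀ x ∈ S, WF x) (hS' : ∀ x ∈ S', WF x) {a : ℕ}
    (h : (listWord K S).count a ≡ (listWord K S').count a [MOD n]) : BalancedMod n S S' a := by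
  obtain ⟨c, hc⟩ := exists_count_listWord hK hS a
  obtain ⟨c', hc'⟩ := exists_count_listWord hK hS' a
  have h0 : ∀ d, K * d ≡ 0 [MOD n] := fun d => (Nat.modEq_zero_iff_dvd.2 (hn.mul_right d))
  rw [BalancedMod]
  generalize (S.flatMap fun x => x.2.1).count a = P at *
  generalize (S.flatMap fun x => x.2.2).count a = Q at *
  generalize (S'.flatMap fun x => x.2.1).count a = P' at *
  generalize (S'.flatMap fun x => x.2.2).count a = Q' at *
  have h1 := (h.add_right Q).add_right Q'
  rw [hc, add_right_comm _ Q, hc', add_right_comm, add_right_comm P'] at h1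
  exact (((h0 c).add_left (P + Q')).symm.trans h1).trans ((h0 c').add_left (P' + Q))

/-- The modulus is chosen larger than both sides. -/
theorem balanced_of_forall_mod {l l' : List SignedItem} {a : ℕ}
    (h : ∀ n, n ≠ 0 → BalancedMod n l l' a) : Balanced l l' a := by
  refine Nat.ModEq.eq_of_lt_of_lt (h ((l.flatMap fun x => x.2.1).count a +
    (l'.flatMap fun x => x.2.2).count a + ((l'.flatMap fun x => x.2.1).count a +
    (l.flatMap fun x => x.2.2).count a) + 1) (by omega)) ?_ ?_ <;> omega

theorem sk_eq_block {x : SignedItem} {a : ℕ} :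
    x.1 = true ∧ a ∈ x.letters ↔ ∃ B, x.sk = .block B ∧ a ∈ B := by
  by_cases hx : x.1 = true <;> simp [sk, hx]

theorem inHead_congr {S S' : List SignedItem} (h : S.map sk = S'.map sk) (a : ℕ) :
    InHead S a ↔ InHead S' a := by
  rcases S with _ | ⟨x, S⟩ <;> rcases S' with _ | ⟨y, S'⟩
  · rfl
  · simp at h
  · simp at h
  · simp only [List.map_cons, List.cons.injEq] at h
    refine sk_eq_block.trans (Iff.trans ?_ sk_eq_block.symm)
    rw [List.headI_cons, List.headI_cons, h.1]

theorem shared_congr {S S' : List SignedItem} (h : S.map sk = S'.map sk) (a : ℕ) :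
    Shared S a ↔ Shared S' a := by
  refine and_congr (inHead_congr h a) (inHead_congr ?_ a)
  rw [List.map_tail, h, List.map_tail]

theorem sameKind_of_sk {x y : SignedItem} (hx : WF x) (hy : WF y) (h : x.sk = y.sk) :
    SameKind x y := by
  rcases hx with ⟨a, rfl⟩ | ⟨hx, -⟩ <;> rcases hy with ⟨b, rfl⟩ | ⟨hy, -⟩
  · simp only [sk, Bool.false_eq_true, if_false, List.headI_cons, Sk.letter.injEq] at h
    subst h
    exact ⟨rfl, fun _ => Iff.rfl⟩
  · simp [sk, hy] at h
  · simp [sk, hx] at h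
  · simp only [sk, hx, hy, if_true, Sk.block.injEq] at h
    exact ⟨hx.trans hy.symm, fun a => by rw [← List.mem_toFinset, h, List.mem_toFinset]⟩

/-- The congruence carries the segmentation of each word over to the other. Each transferred
segmentation yields an embedding of skeletons, so the skeletons agree; then the transferred
segmentation is the given one by uniqueness, and the preserved counts are those at the cuts of `S'`.
-/
theorem sk_eq_and_balancedMod {S S' : List SignedItem} (hS : Reduced S) (hS' : Reduced S')
    (h : ∀ (M : Type) [Monoid M], IsDAb M → ∀ (g : ℕ → M) (k : ℕ), Nat.card M + 2 ≤ k →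
      wordVal g (listWord k.factorial S) = wordVal g (listWord k.factorial S'))
    {n : ℕ} (hn : n ≠ 0) : S.map sk = S'.map sk ∧ (∀ a, BalancedMod n S S' a) ∧
      ∀ i < S.length, ∀ a, ¬Shared (S.drop i) a →
        BalancedMod n (S.drop (i + 1)) (S'.drop (i + 1)) a := by
  have : NeZero n := ⟨hn⟩
  -- A list of items has at most twice as many segments, and the rules need more than twice as many
  -- factors as segments. The bound for `K` provides three copies of each block and the pigeonhole
  -- argument of `emb_of_flatten`.
  obtain ⟨K, hK, hnK, hcon⟩ := exists_ruleCon hS.1 hS'.1 h (4 * (S.length + S'.length) + 1) n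
    (2 * (S.length + S'.length) + 3)
  obtain ⟨G, hf, hG, ht, hfit⟩ := exists_segments_all (K := K) (by omega) hS
  obtain ⟨G', hf', hG', ht', hfit'⟩ := exists_segments_all (K := K) (by omega) hS'
  obtain ⟨H', hH', htH', hfH', hcong⟩ := exists_segments_of_ruleCon hcon hG ht hf
    (by rw [List.length_map]; omega)
  obtain ⟨H, hH, htH, hfH, -⟩ := exists_segments_of_ruleCon (Con.symm _ hcon) hG' ht' hf'
    (by rw [List.length_map]; omega)
  have hsk : S.map sk = S'.map sk := by
    refine Emb.antisymm (normal_sk hS) (normal_sk hS') ?_ ?_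
    · obtain ⟨ws, h1, h2⟩ := exists_over_of_valid hH htH
      exact emb_of_flatten hS.1 (r := []) h1 (by rw [List.length_map]; omega) (h2.trans hfH)
    · obtain ⟨ws, h1, h2⟩ := exists_over_of_valid hH' htH'
      exact emb_of_flatten hS'.1 (r := []) h1 (by rw [List.length_map]; omega) (h2.trans hfH')
  obtain rfl : H' = G' := valid_unique hH' hG' (by rw [htH', ht', hsk]) (hfH'.trans hf'.symm)
  refine ⟨hsk, fun a => ?_, fun i hi a ha => ?_⟩
  · exact balancedMod_of_count (by omega) hnK hS.1 hS'.1 ((ruleCon_le_sigCon _ _ hcon).2 a)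
  · have hi' : i < S'.length := by
      have := congrArg List.length hsk
      simp only [List.length_map] at this
      omega
    obtain ⟨l, h1, h2⟩ := hfit i hi
    obtain ⟨l', h1', h2'⟩ := hfit' i hi'
    have ha' : ¬Shared (S'.drop i) a := by
      rwa [← shared_congr (S := S.drop i) (by rw [List.map_drop, List.map_drop, hsk])]
    have h3 := (hcong _ (pos_le _ _) a (tight_pos hi ha)).2
    refine balancedMod_of_count (by omega) hnK (fun x hx => hS.1 x (List.mem_of_mem_drop hx))
      (fun x hx => hS'.1 x (List.mem_of_mem_drop hx)) ?_
    rw [h1, h1', List.count_append, List.count_append,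
      List.count_eq_zero.2 fun hl => ha (h2 a hl), List.count_eq_zero.2 fun hl => ha' (h2' a hl),
      Nat.zero_add, Nat.zero_add, ← hsk]
    exact h3

/-- Reduced lists with equal values in all monoids of **DAb** match. -/
theorem matches_of_wordVal_eq {S S' : List SignedItem} (hS : Reduced S) (hS' : Reduced S')
    (h : ∀ (M : Type) [Monoid M], IsDAb M → ∀ (g : ℕ → M) (k : ℕ), Nat.card M + 2 ≤ k →
      wordVal g (listWord k.factorial S) = wordVal g (listWord k.factorial S')) :
    Matches S S' := by
  have hsk := (sk_eq_and_balancedMod hS hS' h one_ne_zero).1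
  refine ⟨⟨by simpa using congrArg List.length hsk, fun i hi => ⟨?_, fun a ha => ?_⟩⟩, fun a =>
    balanced_of_forall_mod fun n hn => (sk_eq_and_balancedMod hS hS' h hn).2.1 a⟩
  · have h1 : (S.drop i).map sk = (S'.drop i).map sk := by
      rw [List.map_drop, List.map_drop, hsk]
    have h2 : S.drop i ≠ [] := by simpa using hi
    have h3 : ∀ x ∈ S.drop i, WF x := fun x hx => hS.1 x (List.mem_of_mem_drop hx)
    have h4 : ∀ x ∈ S'.drop i, WF x := fun x hx => hS'.1 x (List.mem_of_mem_drop hx)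
    generalize S.drop i = L at *
    generalize S'.drop i = L' at *
    rcases L with _ | ⟨x, L⟩
    · exact absurd rfl h2
    rcases L' with _ | ⟨y, L'⟩
    · simp at h1
    simp only [List.map_cons, List.cons.injEq] at h1
    exact sameKind_of_sk (h3 x List.mem_cons_self) (h4 y List.mem_cons_self) h1.1
  · rw [List.tail_drop, List.tail_drop]
    exact balanced_of_forall_mod fun n hn => (sk_eq_and_balancedMod hS hS' h hn).2.2 i hi a ha

end SignedItem

namespace OmegaTerm

theorem dabSatisfiesEq_iff_matches {A : Type u} [Encodable A] (s t : OmegaTerm A) :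
    DAbSatisfiesEq s.toPseudoword t.toPseudoword ↔
      SignedItem.Matches s.normalForm t.normalForm := by
  rw [dabSatisfiesEq_iff]
  constructor
  · intro h
    refine SignedItem.matches_of_wordVal_eq s.reduced_normalForm t.reduced_normalForm ?_
    intro M _ hM g k hk
    have := hM.1
    have hK := DAbMonoid.goodExp_factorial hk
    rw [← termVal_eq_normalForm hM hK, ← termVal_eq_normalForm hM hK, h M hM g k hk]
  · intro h M _ hM g k hk
    have := hM.1
    have hK := DAbMonoid.goodExp_factorial hk
    rw [termVal_eq_normalForm hM hK, termVal_eq_normalForm hM hK,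
      SignedItem.wordVal_eq_of_matches hM hK _ _ s.reduced_normalForm.1 t.reduced_normalForm.1 h]

end OmegaTerm

/-! ### Computability -/

theorem primrecRel_mem : PrimrecRel fun (a : ℕ) (l : List ℕ) => a ∈ l := by
  refine ((PrimrecRel.exists_mem_list (R := fun b a : ℕ => b = a) Primrec.eq).comp
    Primrec.snd Primrec.fst).of_eq fun p => ?_
  simp

theorem primrec_count : Primrec₂ fun (a : ℕ) (l : List ℕ) => l.count a := by
  refine (Primrec.list_length.comp ((PrimrecRel.listFilter (R := fun b a : ℕ => b = a)
    Primrec.eq).comp Primrec.snd Primrec.fst)).of_eq fun p => ?_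
  exact List.count_eq_length_filter.symm

namespace SignedItem

open Primrec

theorem primrec_pos : Primrec fun x : SignedItem => x.2.1 := fst.comp snd

theorem primrec_neg : Primrec fun x : SignedItem => x.2.2 := snd.comp snd

theorem primrec_letters : Primrec letters := list_append.comp primrec_pos primrec_neg

theorem primrec_flatMap_pos : Primrec fun l : List SignedItem => l.flatMap fun x => x.2.1 :=
  list_flatMap Primrec.id (primrec_pos.comp snd).to₂

theorem primrec_flatMap_neg : Primrec fun l : List SignedItem => l.flatMap fun x => x.2.2 :=
  list_flatMap Primrec.id (primrec_neg.comp snd).to₂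

theorem primrec_negItem : Primrec negItem :=
  (Primrec.const true).pair (primrec_flatMap_neg.pair primrec_flatMap_pos)

theorem primrec_merge : Primrec₂ merge :=
  (Primrec.const true).pair
    ((list_append.comp (primrec_pos.comp fst) (primrec_pos.comp snd)).pair
      (list_append.comp (primrec_neg.comp fst) (primrec_neg.comp snd)))

theorem primrecRel_subset : PrimrecRel fun v w : List ℕ => ∀ a ∈ v, a ∈ w :=
  primrecRel_mem.forall_mem_list

theorem primrecRel_covers : PrimrecRel Covers :=
  PrimrecPred.and (Primrec.eq.comp (fst.comp fst) (Primrec.const true))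
    (primrecRel_subset.comp (primrec_letters.comp snd) (primrec_letters.comp fst))

theorem primrec_step : Primrec step := by
  classical
  have h1 : Primrec fun s : List SignedItem × List SignedItem => s.1.headI := list_headI.comp fst
  have h2 : Primrec fun s : List SignedItem × List SignedItem => s.2.headI := list_headI.comp snd
  have t1 : Primrec fun s : List SignedItem × List SignedItem => s.1.tail := list_tail.comp fst
  have t2 : Primrec fun s : List SignedItem × List SignedItem => s.2.tail := list_tail.comp snd
  refine Primrec.ite (Primrec.eq.comp fst (Primrec.const [])) Primrec.id ?_
  refine Primrec.ite (Primrec.eq.comp snd (Primrec.const []))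
    (t1.pair (list_cons.comp h1 (Primrec.const []))) ?_
  refine Primrec.ite (primrecRel_covers.comp h1 h2)
    ((list_cons.comp (primrec_merge.comp h1 h2) t1).pair t2) ?_
  exact Primrec.ite (primrecRel_covers.comp h2 h1)
    (t1.pair (list_cons.comp (primrec_merge.comp h2 h1) t2)) (t1.pair (list_cons.comp h1 snd))

theorem primrec_normalize : Primrec normalize :=
  snd.comp (nat_iterate (nat_mul.comp (Primrec.const 2) list_length)
    (list_reverse.pair (Primrec.const [])) (primrec_step.comp snd).to₂)

theorem primrecRel_sameKind : PrimrecRel SameKind := by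
  refine PrimrecPred.and (Primrec.eq.comp (fst.comp fst) (fst.comp snd)) ?_
  refine (PrimrecPred.and
    (primrecRel_subset.comp (primrec_letters.comp fst) (primrec_letters.comp snd))
    (primrecRel_subset.comp (primrec_letters.comp snd) (primrec_letters.comp fst))).of_eq ?_
  exact fun p => ⟨fun h a => ⟨h.1 a, h.2 a⟩, fun h => ⟨fun a => (h a).1, fun a => (h a).2⟩⟩

theorem primrecRel_balanced :
    PrimrecRel fun (a : ℕ) (p : List SignedItem × List SignedItem) => Balanced p.1 p.2 a := by
  have h1 : Primrec fun q : ℕ × List SignedItem × List SignedItem => q.2.1 := fst.comp snd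
  have h2 : Primrec fun q : ℕ × List SignedItem × List SignedItem => q.2.2 := snd.comp snd
  exact Primrec.eq.comp
    (nat_add.comp (primrec_count.comp fst (primrec_flatMap_pos.comp h1))
      (primrec_count.comp fst (primrec_flatMap_neg.comp h2)))
    (nat_add.comp (primrec_count.comp fst (primrec_flatMap_pos.comp h2))
      (primrec_count.comp fst (primrec_flatMap_neg.comp h1)))

theorem primrecRel_inHead : PrimrecRel fun (a : ℕ) (l : List SignedItem) => InHead l a :=
  PrimrecPred.and (Primrec.eq.comp (fst.comp (list_headI.comp snd)) (Primrec.const true))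
    (primrecRel_mem.comp fst (primrec_letters.comp (list_headI.comp snd)))

theorem primrecRel_shared : PrimrecRel fun (a : ℕ) (l : List SignedItem) => Shared l a :=
  PrimrecPred.and (primrecRel_inHead.comp fst snd) (primrecRel_inHead.comp fst (list_tail.comp snd))

/-- The letters that occur in one of the lists. -/
def allLetters (p : List SignedItem × List SignedItem) : List ℕ := (p.1 ++ p.2).flatMap letters

theorem primrec_allLetters : Primrec allLetters :=
  list_flatMap (list_append.comp fst snd) (primrec_letters.comp snd).to₂

theorem balanced_of_notMem {p : List SignedItem × List SignedItem} {a : ℕ}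
    (h : a ∉ allLetters p) : Balanced p.1 p.2 a := by
  simp only [allLetters, letters, List.mem_flatMap, List.mem_append, not_exists, not_and] at h
  have h1 : ∀ l : List SignedItem, (∀ x ∈ l, x ∈ p.1 ∨ x ∈ p.2) →
      (l.flatMap fun x : SignedItem => x.2.1).count a = 0 := fun l hl =>
    List.count_eq_zero.2 fun ha => by
      obtain ⟨x, hx, hax⟩ := List.mem_flatMap.1 ha
      exact h x (hl x hx) (Or.inl hax)
  have h2 : ∀ l : List SignedItem, (∀ x ∈ l, x ∈ p.1 ∨ x ∈ p.2) →
      (l.flatMap fun x : SignedItem => x.2.2).count a = 0 := fun l hl =>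
    List.count_eq_zero.2 fun ha => by
      obtain ⟨x, hx, hax⟩ := List.mem_flatMap.1 ha
      exact h x (hl x hx) (Or.inr hax)
  rw [Balanced, h1 _ fun x => Or.inl, h1 _ fun x => Or.inr, h2 _ fun x => Or.inl,
    h2 _ fun x => Or.inr]

/-- Both sides vanish for letters that do not occur, so the quantifier over all letters becomes a
bounded search. -/
theorem forall_balanced_iff {p : List SignedItem × List SignedItem} {Q : ℕ → Prop} :
    (∀ a, Q a → Balanced p.1 p.2 a) ↔ ∀ a ∈ allLetters p, Q a → Balanced p.1 p.2 a :=
  ⟨fun h a _ => h a, fun h a ha => by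
    by_cases hm : a ∈ allLetters p
    · exact h a hm ha
    · exact balanced_of_notMem hm⟩

theorem primrecPred_matches :
    PrimrecPred fun p : List SignedItem × List SignedItem => Matches p.1 p.2 := by
  have hall : PrimrecPred fun p : List SignedItem × List SignedItem =>
      ∀ a, Balanced p.1 p.2 a := by
    refine (primrecRel_balanced.forall_mem_list.comp primrec_allLetters Primrec.id).of_eq
      fun p => ?_
    simpa using (forall_balanced_iff (p := p) (Q := fun _ => True)).symm
  have hd1 : Primrec fun q : ℕ × List SignedItem × List SignedItem => q.2.1.drop q.1 :=
    list_drop.comp fst (fst.comp snd)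
  have hd2 : Primrec fun q : ℕ × List SignedItem × List SignedItem => q.2.2.drop q.1 :=
    list_drop.comp fst (snd.comp snd)
  have hcut : PrimrecRel fun (a : ℕ) (p : List SignedItem × List SignedItem) =>
      ¬Shared p.1 a → Balanced p.1.tail p.2.tail a := by
    refine (PrimrecPred.or (primrecRel_shared.comp fst (fst.comp snd))
      (primrecRel_balanced.comp fst
        ((list_tail.comp (fst.comp snd)).pair (list_tail.comp (snd.comp snd))))).of_eq fun q => ?_
    exact or_iff_not_imp_left
  have htail : Primrec fun p : List SignedItem × List SignedItem => (p.1.tail, p.2.tail) :=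
    (list_tail.comp fst).pair (list_tail.comp snd)
  have hcut' : PrimrecPred fun p : List SignedItem × List SignedItem =>
      ∀ a, ¬Shared p.1 a → Balanced p.1.tail p.2.tail a := by
    refine (hcut.forall_mem_list.comp (primrec_allLetters.comp htail) Primrec.id).of_eq fun p => ?_
    exact (forall_balanced_iff (p := (p.1.tail, p.2.tail)) (Q := fun a => ¬Shared p.1 a)).symm
  have hitem : PrimrecRel fun (i : ℕ) (p : List SignedItem × List SignedItem) =>
      SameKind (p.1.drop i).headI (p.2.drop i).headI ∧
        ∀ a, ¬Shared (p.1.drop i) a → Balanced (p.1.drop i).tail (p.2.drop i).tail a :=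
    PrimrecPred.and (primrecRel_sameKind.comp (list_headI.comp hd1) (list_headI.comp hd2))
      (hcut'.comp (hd1.pair hd2))
  refine PrimrecPred.and (PrimrecPred.and
    (Primrec.eq.comp (list_length.comp fst) (list_length.comp snd)) ?_) hall
  refine (hitem.forall_mem_list.comp (list_range.comp (list_length.comp fst)) Primrec.id).of_eq
    fun p => ?_
  simp only [List.mem_range, id]

end SignedItem

/-! ### Computing the normal form from the postfix notation. -/

namespace OmegaTerm

open Primrec

variable {A : Type u} [Primcodable A]

theorem primrec_postfixWord : Primrec (postfixWord (A := A)) :=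
  letI : Primcodable {w : List (A ⊕ Bool) // WellFormed w} :=
    Primcodable.subtype primrecPred_wellFormed
  Primrec.subtype_val.comp (Primrec.of_equiv (e := equivWellFormed (A := A)))

/-- Process one symbol of a postfix word, with a stack of lists of items. -/
def itemsStep (st : List (List SignedItem)) (c : A ⊕ Bool) : List (List SignedItem) :=
  Sum.casesOn c (fun a => [(false, [Encodable.encode a], [])] :: st) fun b =>
    -- On an exhausted stack the default values are read; this never happens for postfix words of
    -- terms.
    cond b ([SignedItem.negItem st.headI] :: st.tail) ((st.tail.headI ++ st.headI) :: st.tail.tail)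

/-- Terms are coded by postfix words, so the structural recursion of `items` is replaced by a left
fold over a stack, which is visibly primitive recursive. -/
theorem foldl_itemsStep (t : OmegaTerm A) (st : List (List SignedItem)) :
    t.postfixWord.foldl itemsStep st = t.items :: st := by
  induction t generalizing st with
  | letter a => rfl
  | concat s t ihs iht => simp [postfixWord, List.foldl_append, ihs, iht, itemsStep, items]
  | power t ih => simp [postfixWord, List.foldl_append, ih, itemsStep, items]

theorem primrec_itemsStep : Primrec₂ (itemsStep (A := A)) := by
  refine Primrec.sumCasesOn snd ?_ ?_
  · exact list_cons.comp (list_cons.comp ((Primrec.const false).pair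
      ((list_cons.comp (Primrec.encode.comp snd) (Primrec.const [])).pair (Primrec.const [])))
      (Primrec.const [])) (fst.comp fst)
  · have hst : Primrec fun p : (List (List SignedItem) × (A ⊕ Bool)) × Bool => p.1.1 :=
      fst.comp fst
    refine Primrec.cond snd ?_ ?_
    · exact list_cons.comp (list_cons.comp (SignedItem.primrec_negItem.comp (list_headI.comp hst))
        (Primrec.const [])) (list_tail.comp hst)
    · exact list_cons.comp (list_append.comp (list_headI.comp (list_tail.comp hst))
        (list_headI.comp hst)) (list_tail.comp (list_tail.comp hst))

theorem primrec_items : Primrec (items (A := A)) := by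
  refine (list_headI.comp (Primrec.list_foldl primrec_postfixWord (Primrec.const [])
    (primrec_itemsStep.comp (fst.comp snd) (snd.comp snd)).to₂)).of_eq fun t => ?_
  rw [foldl_itemsStep, List.headI_cons]

theorem primrec_normalForm : Primrec (normalForm (A := A)) :=
  SignedItem.primrec_normalize.comp primrec_items

end OmegaTerm

theorem mainTheorem3 {A : Type*} [Primcodable A] :
    ComputablePred fun p : OmegaTerm A × OmegaTerm A =>
      DAbSatisfiesEq p.1.toPseudoword p.2.toPseudoword := by
  obtain ⟨d, h⟩ := SignedItem.primrecPred_matches.comp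
    ((OmegaTerm.primrec_normalForm (A := A).comp Primrec.fst).pair
      (OmegaTerm.primrec_normalForm (A := A).comp Primrec.snd))
  exact (show ComputablePred _ from ⟨d, h.to_comp⟩).of_eq fun p =>
    (OmegaTerm.dabSatisfiesEq_iff_matches p.1 p.2).symm
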